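/- A prudent walk is a self-avoiding walk on the square lattice $\mathbb{Z}^2$, started at $(0,0)$, that never takes a step towards an already visited node (no node visited so far lies on the ray from the current node in the direction of the step). A 4-sided (i.e. unrestricted) prudent polygon is a prudent walk with more than one step that ends at a node adjacent to $(0,0)$; it is closed by the edge from its last node to $(0,0)$, its area is the number of enclosed unit cells, and its width and height are those of its bounding box. There are finitely many prudent polygons of each area; let $PA^{(4)}(q)=\sum_{n\ge1}PA^{(4)}_nq^n$, where $PA^{(4)}_n$ is the number of 4-sided prudent polygons of area $n$ (counted as walks). Divide the prudent polygons that end at $(-1,0)$ and are traversed counterclockwise into three classes. Class $\mathcal{X}$ consists of those for which removing the top row of cells neither changes the width nor leaves two or more disconnected pieces. Class $\mathcal{Y}$ consists of the unit square and of those not in $\mathcal{X}$ for which removing the rightmost column of cells neither changes the height nor leaves two or more disconnected pieces. Class $\mathcal{Z}$ consists of those in neither $\mathcal{X}$ nor $\mathcal{Y}$. Let $X(q,u,v)$, $Y(q,u,v)$, $Z(q,u,v)$ be the generating functions (formal power series) of these classes, where $q$ marks area in all three, and $(u,v)$ mark (width, height) in $X$, (height, width) in $Y$, and (width minus $1$,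 height) in $Z$. Then \begin{align*} X(q,u,v)&=\frac{qv}{1-q}[X(q,u,v)-X(q,qu,v)]+\frac{qv}{1-q}[Y(q,v,u)-Y(q,v,qu)]+\frac{quv}{1-q}[Z(q,u,v)-qZ(q,qu,v)],\\ Y(q,u,v)&=quv+\frac{qv}{1-q}[Y(q,u,v)-Y(q,qu,v)]+\frac{qv^2}{1-q}[Z(q,v,u)-Z(q,v,qu)]+quv[X(q,qv,u)+Y(q,u,qv)+qvZ(q,qv,u)],\\ Z(q,u,v)&=\frac{qv}{1-q}[Z(q,u,v)-Z(q,qu,v)]+qvY(q,qv,u)+quvZ(q,u,qv), \end{align*} and \begin{align*} PA^{(4)}(q)&=8[X(q,1,1)+Y(q,1,1)+Z(q,1,1)]\\ &=8q+16q^2+40q^3+96q^4+232q^5+560q^6+1336q^7+3176q^8+7480q^9+17528q^{10}+\cdots. \end{align*} -/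

import Mathlib

namespace PrudentPolygon

/-- A self-avoiding walk on the square lattice starting at the origin, given by the list of the
nodes it visits: consecutive nodes are at distance one, and no node is visited twice. -/
def IsSAW (w : List (ℤ × ℤ)) : Prop :=
  w.head? = some (0, 0) ∧
  w.IsChain (fun p r => |r.1 - p.1| + |r.2 - p.2| = 1) ∧
  w.Nodup

/-- A walk is prudent if it never steps towards an already occupied node: when it steps from
`w[i]` to `w[i + 1]`, the open lattice ray from `w[i]` in the direction of that step contains none
of the nodes `w[0], …, w[i]`. -/
def IsPrudent (w : List (ℤ × ℤ)) : Prop :=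
  ∀ (i : ℕ) (hi : i + 1 < w.length), ∀ p ∈ w.take (i + 1), ∀ k : ℕ, 1 ≤ k →
    p ≠ w[i] + k • (w[i + 1] - w[i])

/-- A prudent polygon is a prudent self-avoiding walk of more than one step that ends at a node
adjacent to its starting point. "4-sided" means that there is no restriction on the sides of the
bounding box on which the walk may end, so these are exactly the 4-sided prudent polygons. -/
def IsPrudentPolygon (w : List (ℤ × ℤ)) : Prop :=
  IsSAW w ∧ IsPrudent w ∧ 2 < w.length ∧ ∃ p, w.getLast? = some p ∧ |p.1| + |p.2| = 1

/-- The directed edges of the closed polygon: the steps of the walk, and the closing edge from its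
last node to its first. -/
def edges (w : List (ℤ × ℤ)) : List ((ℤ × ℤ) × (ℤ × ℤ)) :=
  w.zip (w.rotate 1)

/-- The unit cells enclosed by the polygon. The cell `[a, a + 1] × [b, b + 1]` is named by its
south-west corner `(a, b)`; it is enclosed when the horizontal ray from its centre to the east
crosses the polygon an odd number of times (even-odd rule). -/
def cells (w : List (ℤ × ℤ)) : Set (ℤ × ℤ) :=
  {c | Odd ((edges w).countP
    (fun e => decide (e.1.1 = e.2.1 ∧ c.1 < e.1.1 ∧ min e.1.2 e.2.2 = c.2)))}

/-- The unit cell on the left-hand side of the directed edge from `p` to `r`. -/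
def leftCell (p r : ℤ × ℤ) : ℤ × ℤ :=
  if r = p + (1, 0) then p
  else if r = p + (0, 1) then p + (-1, 0)
  else if r = p + (-1, 0) then p + (-1, -1)
  else p + (0, -1)

/-- The polygon is traversed counterclockwise: its interior lies on the left of each edge. -/
def IsCounterclockwise (w : List (ℤ × ℤ)) : Prop :=
  ∀ e ∈ edges w, leftCell e.1 e.2 ∈ cells w

/-- Area of a set of cells. -/
noncomputable def area (S : Set (ℤ × ℤ)) : ℕ := S.ncard

/-- Width of (the bounding box of) a set of cells: the number of columns from its leftmost to its
rightmost one. -/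
noncomputable def width (S : Set (ℤ × ℤ)) : ℕ :=
  {a : ℤ | ∃ c ∈ S, ∃ d ∈ S, c.1 ≤ a ∧ a ≤ d.1}.ncard

/-- Height of (the bounding box of) a set of cells: the number of rows from its lowest to its
highest one. -/
noncomputable def height (S : Set (ℤ × ℤ)) : ℕ :=
  {b : ℤ | ∃ c ∈ S, ∃ d ∈ S, c.2 ≤ b ∧ b ≤ d.2}.ncard

/-- `S` does not consist of two or more disconnected pieces: any two of its cells are joined by a
chain of cells of `S`, consecutive ones sharing a side. -/
def IsOnePiece (S : Set (ℤ × ℤ)) : Prop :=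
  ∀ c ∈ S, ∀ d ∈ S, Relation.ReflTransGen
    (fun c d => d ∈ S ∧ |d.1 - c.1| + |d.2 - c.2| = 1) c d

/-- What is left of a set of cells when its top row is removed. -/
def removeTopRow (S : Set (ℤ × ℤ)) : Set (ℤ × ℤ) := {c ∈ S | ∃ d ∈ S, c.2 < d.2}

/-- What is left of a set of cells when its rightmost column is removed. -/
def removeRightColumn (S : Set (ℤ × ℤ)) : Set (ℤ × ℤ) := {c ∈ S | ∃ d ∈ S, c.1 < d.1}

/-- The prudent polygons that end at `(-1, 0)` in a counterclockwise direction. -/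
def classW : Set (List (ℤ × ℤ)) :=
  {w | IsPrudentPolygon w ∧ w.getLast? = some (-1, 0) ∧ IsCounterclockwise w}

/-- Class `𝒳`: removing the top row neither changes the width nor disconnects the polygon. -/
def classX : Set (List (ℤ × ℤ)) :=
  {w ∈ classW | width (removeTopRow (cells w)) = width (cells w) ∧
    IsOnePiece (removeTopRow (cells w))}

/-- Class `𝒴`: the unit square, and the polygons not in `𝒳` for which removing the rightmost
column neither changes the height nor disconnects the polygon. -/
def classY : Set (List (ℤ × ℤ)) :=
  {w ∈ classW | area (cells w) = 1 ∨
    (w ∉ classX ∧ height (removeRightColumn (cells w)) = height (cells w) ∧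
      IsOnePiece (removeRightColumn (cells w)))}

/-- Class `𝒵`: the polygons neither in `𝒳` nor in `𝒴`. -/
def classZ : Set (List (ℤ × ℤ)) :=
  {w ∈ classW | w ∉ classX ∧ w ∉ classY}

/-- `X(q, u, v)`: `q` marks area, `u` marks width and `v` marks height.
The variables `q, u, v` have the indices `0, 1, 2`. -/
noncomputable def genX : MvPowerSeries (Fin 3) ℚ := fun m =>
  ({w ∈ classX | area (cells w) = m 0 ∧ width (cells w) = m 1 ∧
    height (cells w) = m 2}.ncard : ℚ)

/-- `Y(q, u, v)`: `q` marks area, `u` marks height and `v` marks width. -/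
noncomputable def genY : MvPowerSeries (Fin 3) ℚ := fun m =>
  ({w ∈ classY | area (cells w) = m 0 ∧ height (cells w) = m 1 ∧
    width (cells w) = m 2}.ncard : ℚ)

/-- `Z(q, u, v)`: `q` marks area, `u` marks width minus one and `v` marks height. -/
noncomputable def genZ : MvPowerSeries (Fin 3) ℚ := fun m =>
  ({w ∈ classZ | area (cells w) = m 0 ∧ width (cells w) = m 1 + 1 ∧
    height (cells w) = m 2}.ncard : ℚ)

/-- The area generating function of all (4-sided) prudent polygons. -/
noncomputable def genPA : PowerSeries ℚ := PowerSeries.mk fun n =>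
  ({w | IsPrudentPolygon w ∧ area (cells w) = n}.ncard : ℚ)

/-- `F(q, a, b)`: substitution of power series `a, b` without constant term for `u, v`. -/
noncomputable def substUV (F a b : MvPowerSeries (Fin 3) ℚ) : MvPowerSeries (Fin 3) ℚ :=
  MvPowerSeries.subst ![MvPowerSeries.X 0, a, b] F

/-- `F(q, 1, 1)`, for a series `F` in which each power of `q` has a coefficient that is a
polynomial in `u, v`. -/
noncomputable def evalOne (F : MvPowerSeries (Fin 3) ℚ) : PowerSeries ℚ :=
  PowerSeries.mk fun n => ∑ᶠ p : ℕ × ℕ,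
    MvPowerSeries.coeff (Finsupp.equivFunOnFinite.symm ![n, p.1, p.2]) F

end PrudentPolygon

open PrudentPolygon

/-! A counterclockwise prudent polygon ending at `(-1, 0)` grows from the unit cell `(-1, 0)` by
adding strips: a row on top that starts at the left side, a column on the right that hangs from the
top, or a row at the bottom that ends at the right side. A `Code` records these additions. The
combinatorial core is that `Code.walk` maps the valid codes bijectively onto `classW`
(`mem_classW_iff`, `walk_injOn`).

Surjectivity. As long as a prudent walk stays in the half-plane of nonnegative abscissas, its end is
in the top row, on the right side or on the bottom side of what is built so far, and each free step
either moves along that side or starts a new strip (`PrudentPath.halfPlaneForm`). If the walk leaves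
the half-plane above the origin, then prudence forces it straight down to `(-1, 0)`
(`eq_vgo_of_suffix`); this rests on `PrudentPath.head_border`, by which the end of a prudent walk is
always on the border of its bounding box. Leaving below the origin gives the mirror image, which is
clockwise.

Injectivity. The enclosed cells of the walk are those of the strips, by counting crossings modulo
two (`Valid.odd_crossings`), and the last strip can be read off the set of cells (`cellSet_injOn`).

The classes depend on the last strip only (`Valid.isX_iff`, `Valid.isZ_iff`): a top row within the
width gives X, a bottom row or a column protruding below gives Z, and everything else gives Y. A top
row has between 1 and width plus one cells, a right column between 1 and height plus one. Summing `q
^ k` over the lengths that fit gives the factor `q / (1 - q)` and the differences in the equations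
(`gf_pairs`); the protruding length gives the remaining terms. A bottom row never reaches the left
column, so its length is at most the width minus one, which is the quantity that `Z` marks.

All prudent polygons arise from the codes by the two orientations and the four possible end nodes,
whence the factor 8. The first coefficients come from a recursive enumeration of the codes. -/

namespace PrudentPolygon

/-! ### Prudent walks as reversed lists of nodes -/

/-- The step from the node `p` to the node `r` is a unit step that does not point towards a node
of `l`. -/
def FreeStep (p r : ℤ × ℤ) (l : List (ℤ × ℤ)) : Prop :=
  (r = (p.1 + 1, p.2) ∧ ∀ q ∈ l, q.2 = p.2 → q.1 ≤ p.1) ∨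
  (r = (p.1 - 1, p.2) ∧ ∀ q ∈ l, q.2 = p.2 → p.1 ≤ q.1) ∨
  (r = (p.1, p.2 + 1) ∧ ∀ q ∈ l, q.1 = p.1 → q.2 ≤ p.2) ∨
  (r = (p.1, p.2 - 1) ∧ ∀ q ∈ l, q.1 = p.1 → p.2 ≤ q.2)

/-- Prudent walks from the origin, as lists of nodes in reversed order: the head of the list is
the current node. -/
def PrudentPath : List (ℤ × ℤ) → Prop
  | [] => False
  | [p] => p = (0, 0)
  | r :: p :: l => FreeStep p r (p :: l) ∧ PrudentPath (p :: l)

theorem prudentPath_cons {p r : ℤ × ℤ} {l : List (ℤ × ℤ)} (h : l.head? = some p) :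
    PrudentPath (r :: l) ↔ FreeStep p r l ∧ PrudentPath l := by
  obtain ⟨t, rfl⟩ := List.head?_eq_some_iff.mp h
  rfl

theorem PrudentPath.induction {Q : ∀ l : List (ℤ × ℤ), PrudentPath l → Prop}
    (start : Q [(0, 0)] rfl)
    (step : ∀ p r l (h : PrudentPath (p :: l)) (hf : FreeStep p r (p :: l)), Q (p :: l) h →
      Q (r :: p :: l) ⟨hf, h⟩) : ∀ {l} (h : PrudentPath l), Q l h
  | [], h => h.elim
  | [p], h => by
    obtain rfl : p = (0, 0) := h
    exact start
  | r :: p :: l, h => step p r l h.2 h.1 (PrudentPath.induction start step h.2)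

theorem PrudentPath.origin_mem {l : List (ℤ × ℤ)} (h : PrudentPath l) : ((0, 0) : ℤ × ℤ) ∈ l := by
  induction h using PrudentPath.induction with
  | start => simp
  | step p r l _ _ ih => exact List.mem_cons_of_mem _ ih

theorem FreeStep.not_mem {p r : ℤ × ℤ} {l : List (ℤ × ℤ)} (h : FreeStep p r l) : r ∉ l := by
  intro hr
  rcases h with ⟨rfl, h⟩ | ⟨rfl, h⟩ | ⟨rfl, h⟩ | ⟨rfl, h⟩ <;> have := h _ hr rfl <;> simp at this

theorem PrudentPath.nodup {l : List (ℤ × ℤ)} (h : PrudentPath l) : l.Nodup := by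
  induction h using PrudentPath.induction with
  | start => simp
  | step p r l _ hf ih => exact List.nodup_cons.2 ⟨hf.not_mem, ih⟩

/-- A discrete intermediate value theorem: a step changes the abscissa by at most one, so no column
between two visited ones is skipped. -/
theorem PrudentPath.exists_snd {l : List (ℤ × ℤ)} (h : PrudentPath l) :
    ∀ q ∈ l, ∀ q' ∈ l, ∀ x, q.1 ≤ x → x ≤ q'.1 → ∃ y, (x, y) ∈ l := by
  induction h using PrudentPath.induction with
  | start => 
    intro q hq q' hq' x h1 h2
    simp at hq hq'; subst hq hq'; exact ⟨0, by simp at h1 h2 ⊢; omega⟩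
  | step p r l _ hf ih =>
    intro q hq q' hq' x h1 h2
    have key : x = r.1 ∨ ∃ y, (x, y) ∈ p :: l := by
      have hr : |r.1 - p.1| ≤ 1 := by
        rcases hf with ⟨rfl, -⟩ | ⟨rfl, -⟩ | ⟨rfl, -⟩ | ⟨rfl, -⟩ <;> simp
      rw [abs_le] at hr
      rcases List.mem_cons.1 hq with rfl | hq <;> rcases List.mem_cons.1 hq' with rfl | hq'
      · left; omega
      · by_cases hx : x = q.1
        · exact Or.inl hx
        · exact Or.inr (ih p (by simp) q' hq' x (by omega) h2)
      · by_cases hx : x = q'.1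
        · exact Or.inl hx
        · exact Or.inr (ih q ‹_› p (by simp) x h1 (by omega))
      · exact Or.inr (ih q hq q' hq' x h1 h2)
    rcases key with rfl | ⟨y, hy⟩
    · exact ⟨r.2, by simp⟩
    · exact ⟨y, List.mem_cons_of_mem _ hy⟩

/-! ### Symmetries of prudent paths -/

theorem FreeStep.swap {p r : ℤ × ℤ} {l : List (ℤ × ℤ)} (h : FreeStep p r l) :
    FreeStep p.swap r.swap (l.map Prod.swap) := by
  rcases h with ⟨rfl, h⟩ | ⟨rfl, h⟩ | ⟨rfl, h⟩ | ⟨rfl, h⟩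
  · refine Or.inr (Or.inr (Or.inl ⟨rfl, ?_⟩))
    simpa only [List.forall_mem_map, Prod.fst_swap, Prod.snd_swap] using h
  · refine Or.inr (Or.inr (Or.inr ⟨rfl, ?_⟩))
    simpa only [List.forall_mem_map, Prod.fst_swap, Prod.snd_swap] using h
  · refine Or.inl ⟨rfl, ?_⟩
    simpa only [List.forall_mem_map, Prod.fst_swap, Prod.snd_swap] using h
  · refine Or.inr (Or.inl ⟨rfl, ?_⟩)
    simpa only [List.forall_mem_map, Prod.fst_swap, Prod.snd_swap] using h

theorem PrudentPath.swap {l : List (ℤ × ℤ)} (h : PrudentPath l) :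
    PrudentPath (l.map Prod.swap) := by
  induction h using PrudentPath.induction with
  | start => rfl
  | step p r l _ hf ih => exact ⟨hf.swap, ih⟩

/-- Reflection of the plane in the horizontal axis. -/
def flip (p : ℤ × ℤ) : ℤ × ℤ := (p.1, -p.2)

theorem FreeStep.flip {p r : ℤ × ℤ} {l : List (ℤ × ℤ)} (h : FreeStep p r l) :
    FreeStep (flip p) (flip r) (l.map flip) := by
  rcases h with ⟨rfl, h⟩ | ⟨rfl, h⟩ | ⟨rfl, h⟩ | ⟨rfl, h⟩
  · refine Or.inl ⟨rfl, ?_⟩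
    simpa only [PrudentPolygon.flip, List.forall_mem_map, neg_inj, neg_le_neg_iff] using h
  · refine Or.inr (Or.inl ⟨rfl, ?_⟩)
    simpa only [PrudentPolygon.flip, List.forall_mem_map, neg_inj, neg_le_neg_iff] using h
  · refine Or.inr (Or.inr (Or.inr ⟨by simp [PrudentPolygon.flip]; ring, ?_⟩))
    simpa only [PrudentPolygon.flip, List.forall_mem_map, neg_inj, neg_le_neg_iff] using h
  · refine Or.inr (Or.inr (Or.inl ⟨by simp [PrudentPolygon.flip]; ring, ?_⟩))
    simpa only [PrudentPolygon.flip, List.forall_mem_map, neg_inj, neg_le_neg_iff] using h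

theorem PrudentPath.flip {l : List (ℤ × ℤ)} (h : PrudentPath l) :
    PrudentPath (l.map flip) := by
  induction h using PrudentPath.induction with
  | start => rfl
  | step p r l _ hf ih => exact ⟨hf.flip, ih⟩

theorem PrudentPath.exists_fst {l : List (ℤ × ℤ)} (h : PrudentPath l) :
    ∀ q ∈ l, ∀ q' ∈ l, ∀ y, q.2 ≤ y → y ≤ q'.2 → ∃ x, (x, y) ∈ l := by
  intro q hq q' hq' y h1 h2
  obtain ⟨x, hx⟩ := h.swap.exists_snd q.swap (List.mem_map_of_mem hq) q'.swap
    (List.mem_map_of_mem hq') y h1 h2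
  obtain ⟨⟨a, b⟩, hz, hz'⟩ := List.mem_map.1 hx
  simp only [Prod.swap_prod_mk, Prod.mk.injEq] at hz'
  exact ⟨a, hz'.1 ▸ hz⟩

/-- The current node of a prudent walk lies on the border of the bounding box of the walk. -/
theorem PrudentPath.head_border {l : List (ℤ × ℤ)} (h : PrudentPath l) :
    ∀ p, l.head? = some p → (∀ q ∈ l, q.1 ≤ p.1) ∨ (∀ q ∈ l, p.1 ≤ q.1) ∨
      (∀ q ∈ l, q.2 ≤ p.2) ∨ (∀ q ∈ l, p.2 ≤ q.2) := by
  induction h using PrudentPath.induction with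
  | start => simp
  | step p r l hl hf ih =>
    intro r' hr'
    obtain rfl : r = r' := by simpa using hr'
    have hn := hf.not_mem
    have hpl := (List.nodup_cons.1 hl.nodup).1
    by_contra hcon
    push Not at hcon
    obtain ⟨⟨q1, h1, h1'⟩, ⟨q2, h2, h2'⟩, ⟨q3, h3, h3'⟩, ⟨q4, h4, h4'⟩⟩ := hcon
    have m1 : q1 ∈ p :: l := (List.mem_cons.1 h1).resolve_left (by rintro rfl; omega)
    have m2 : q2 ∈ p :: l := (List.mem_cons.1 h2).resolve_left (by rintro rfl; omega)
    have m3 : q3 ∈ p :: l := (List.mem_cons.1 h3).resolve_left (by rintro rfl; omega)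
    have m4 : q4 ∈ p :: l := (List.mem_cons.1 h4).resolve_left (by rintro rfl; omega)
    have hlne : l ≠ [] := by
      rintro rfl
      simp at m1 m2; subst m1 m2; omega
    have hl' : PrudentPath l := by
      cases l with
      | nil => exact absurd rfl hlne
      | cons a t => exact hl.2
    have ex := hl'.exists_snd
    have ey := hl'.exists_fst
    rcases ih p rfl with hb | hb | hb | hb <;>
      have b1 := hb _ m1 <;> have b2 := hb _ m2 <;> have b3 := hb _ m3 <;> have b4 := hb _ m4 <;>
      rcases hf with ⟨rfl, hd⟩ | ⟨rfl, hd⟩ | ⟨rfl, hd⟩ | ⟨rfl, hd⟩ <;> dsimp only at * <;>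
      try omega
    -- The surviving cases are those where `p` lies on one side of the box and the step goes
    -- perpendicularly away from that side.
    all_goals
      have n1 : q1 ∈ l ∨ q1 = p := (List.mem_cons.1 m1).symm
      have n2 : q2 ∈ l ∨ q2 = p := (List.mem_cons.1 m2).symm
      have n3 : q3 ∈ l ∨ q3 = p := (List.mem_cons.1 m3).symm
      have n4 : q4 ∈ l ∨ q4 = p := (List.mem_cons.1 m4).symm
    -- There are nodes above and below the row of `p`, so the walk crossed that row before reaching
    -- `p`. The border condition and the free step put the crossing at `p` itself, which contradicts
    -- self-avoidance. The other three cases are alike.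
    · obtain ⟨x, hx⟩ := ey q4 (n4.resolve_right (by rintro rfl; omega)) q3
        (n3.resolve_right (by rintro rfl; omega)) p.2 (by omega) (by omega)
      have e1 := hb _ (List.mem_cons_of_mem _ hx)
      have e2 := hd _ (List.mem_cons_of_mem _ hx) rfl
      exact hpl (by rwa [show x = p.1 from by dsimp only at e1 e2; omega] at hx)
    · obtain ⟨x, hx⟩ := ey q4 (n4.resolve_right (by rintro rfl; omega)) q3
        (n3.resolve_right (by rintro rfl; omega)) p.2 (by omega) (by omega)
      have e1 := hb _ (List.mem_cons_of_mem _ hx)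
      have e2 := hd _ (List.mem_cons_of_mem _ hx) rfl
      exact hpl (by rwa [show x = p.1 from by dsimp only at e1 e2; omega] at hx)
    · obtain ⟨x, hx⟩ := ex q2 (n2.resolve_right (by rintro rfl; omega)) q1
        (n1.resolve_right (by rintro rfl; omega)) p.1 (by omega) (by omega)
      have e1 := hb _ (List.mem_cons_of_mem _ hx)
      have e2 := hd _ (List.mem_cons_of_mem _ hx) rfl
      exact hpl (by rwa [show x = p.2 from by dsimp only at e1 e2; omega] at hx)
    · obtain ⟨x, hx⟩ := ex q2 (n2.resolve_right (by rintro rfl; omega)) q1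
        (n1.resolve_right (by rintro rfl; omega)) p.1 (by omega) (by omega)
      have e1 := hb _ (List.mem_cons_of_mem _ hx)
      have e2 := hd _ (List.mem_cons_of_mem _ hx) rfl
      exact hpl (by rwa [show x = p.2 from by dsimp only at e1 e2; omega] at hx)

/-! ### Straight extensions of a path -/

/-- Extend a path by `n` steps in the direction `d`. -/
def extend (d : ℤ × ℤ) : ℕ → List (ℤ × ℤ) → List (ℤ × ℤ)
  | 0, l => l
  | n + 1, l => match extend d n l with
    | [] => []
    | p :: t => (p + d) :: p :: t

theorem extend_cons (d p : ℤ × ℤ) (l : List (ℤ × ℤ)) (n : ℕ) :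
    (extend d n (p :: l)).head? = some (p + n • d) ∧
      extend d (n + 1) (p :: l) = (p + (n + 1) • d) :: extend d n (p :: l) := by
  have key : ∀ n, (extend d n (p :: l)).head? = some (p + n • d) → 
      extend d (n + 1) (p :: l) = (p + (n + 1) • d) :: extend d n (p :: l) := by
    intro n hn
    obtain ⟨t, ht⟩ := List.head?_eq_some_iff.mp hn
    rw [extend, ht, succ_nsmul]
    simp [add_assoc]
  induction n with
  | zero => exact ⟨by simp [extend], key 0 (by simp [extend])⟩
  | succ n ih =>
    have : (extend d (n + 1) (p :: l)).head? = some (p + (n + 1) • d) := by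
      rw [ih.2]; rfl
    exact ⟨this, key _ this⟩

/-- Extend a path horizontally up to the abscissa `x`. -/
def hgo (x : ℤ) : List (ℤ × ℤ) → List (ℤ × ℤ)
  | [] => []
  | p :: l => if p.1 ≤ x then extend (1, 0) (x - p.1).toNat (p :: l)
    else extend (-1, 0) (p.1 - x).toNat (p :: l)

/-- Extend a path vertically up to the ordinate `y`. -/
def vgo (y : ℤ) : List (ℤ × ℤ) → List (ℤ × ℤ)
  | [] => []
  | p :: l => if p.2 ≤ y then extend (0, 1) (y - p.2).toNat (p :: l)
    else extend (0, -1) (p.2 - y).toNat (p :: l)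

section go

variable {p : ℤ × ℤ} {l : List (ℤ × ℤ)}

theorem hgo_self (h : l.head? = some p) : hgo p.1 l = l := by
  obtain ⟨t, rfl⟩ := List.head?_eq_some_iff.mp h
  simp [hgo, extend]

theorem vgo_self (h : l.head? = some p) : vgo p.2 l = l := by
  obtain ⟨t, rfl⟩ := List.head?_eq_some_iff.mp h
  simp [vgo, extend]

theorem hgo_add_one (h : l.head? = some p) {x : ℤ} (hx : p.1 ≤ x) :
    hgo (x + 1) l = (x + 1, p.2) :: hgo x l := by
  obtain ⟨t, rfl⟩ := List.head?_eq_some_iff.mp h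
  rw [hgo, hgo, if_pos hx, if_pos (by omega),
    show (x + 1 - p.1).toNat = (x - p.1).toNat + 1 by omega,
    (extend_cons _ _ _ _).2]
  congr 1
  ext <;> simp; omega

theorem hgo_sub_one (h : l.head? = some p) {x : ℤ} (hx : x ≤ p.1) :
    hgo (x - 1) l = (x - 1, p.2) :: hgo x l := by
  rcases hx.eq_or_lt with rfl | hx
  · rw [hgo_self h]
    obtain ⟨t, rfl⟩ := List.head?_eq_some_iff.mp h
    rw [hgo, if_neg (by omega), show (p.1 - (p.1 - 1)).toNat = 0 + 1 by omega,
      (extend_cons _ _ _ _).2]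
    congr 1
    ext <;> simp; omega
  · obtain ⟨t, rfl⟩ := List.head?_eq_some_iff.mp h
    rw [hgo, hgo, if_neg (by omega), if_neg (by omega),
      show (p.1 - (x - 1)).toNat = (p.1 - x).toNat + 1 by omega, (extend_cons _ _ _ _).2]
    congr 1
    ext <;> simp; omega

theorem vgo_add_one (h : l.head? = some p) {y : ℤ} (hy : p.2 ≤ y) :
    vgo (y + 1) l = (p.1, y + 1) :: vgo y l := by
  obtain ⟨t, rfl⟩ := List.head?_eq_some_iff.mp h
  rw [vgo, vgo, if_pos hy, if_pos (by omega),
    show (y + 1 - p.2).toNat = (y - p.2).toNat + 1 by omega,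
    (extend_cons _ _ _ _).2]
  congr 1
  ext <;> simp; omega

theorem vgo_sub_one (h : l.head? = some p) {y : ℤ} (hy : y ≤ p.2) :
    vgo (y - 1) l = (p.1, y - 1) :: vgo y l := by
  rcases hy.eq_or_lt with rfl | hy
  · rw [vgo_self h]
    obtain ⟨t, rfl⟩ := List.head?_eq_some_iff.mp h
    rw [vgo, if_neg (by omega), show (p.2 - (p.2 - 1)).toNat = 0 + 1 by omega,
      (extend_cons _ _ _ _).2]
    congr 1
    ext <;> simp; omega
  · obtain ⟨t, rfl⟩ := List.head?_eq_some_iff.mp h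
    rw [vgo, vgo, if_neg (by omega), if_neg (by omega),
      show (p.2 - (y - 1)).toNat = (p.2 - y).toNat + 1 by omega, (extend_cons _ _ _ _).2]
    congr 1
    ext <;> simp; omega

/-- Treats runs to the right and to the left at once, one step at a time away from the starting
abscissa. -/
theorem hgo_induction (h : l.head? = some p) {Q : ℤ → List (ℤ × ℤ) → Prop} (self : Q p.1 l)
    (right : ∀ x, p.1 ≤ x → Q x (hgo x l) → Q (x + 1) ((x + 1, p.2) :: hgo x l))
    (left : ∀ x, x ≤ p.1 → Q x (hgo x l) → Q (x - 1) ((x - 1, p.2) :: hgo x l)) (x : ℤ) :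
    Q x (hgo x l) := by
  induction x using Int.inductionOn' (b := p.1) with
  | zero => rwa [hgo_self h]
  | succ k hk ih => rw [hgo_add_one h hk]; exact right k hk ih
  | pred k hk ih => rw [hgo_sub_one h hk]; exact left k hk ih

theorem vgo_induction (h : l.head? = some p) {Q : ℤ → List (ℤ × ℤ) → Prop} (self : Q p.2 l)
    (up : ∀ y, p.2 ≤ y → Q y (vgo y l) → Q (y + 1) ((p.1, y + 1) :: vgo y l))
    (down : ∀ y, y ≤ p.2 → Q y (vgo y l) → Q (y - 1) ((p.1, y - 1) :: vgo y l)) (y : ℤ) :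
    Q y (vgo y l) := by
  induction y using Int.inductionOn' (b := p.2) with
  | zero => rwa [vgo_self h]
  | succ k hk ih => rw [vgo_add_one h hk]; exact up k hk ih
  | pred k hk ih => rw [vgo_sub_one h hk]; exact down k hk ih

theorem head_hgo (h : l.head? = some p) (x : ℤ) : (hgo x l).head? = some (x, p.2) :=
  hgo_induction (Q := fun x l => l.head? = some (x, p.2)) h h (by simp) (by simp) x

theorem head_vgo (h : l.head? = some p) (y : ℤ) : (vgo y l).head? = some (p.1, y) :=
  vgo_induction (Q := fun y l => l.head? = some (p.1, y)) h h (by simp) (by simp) y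

theorem mem_hgo (h : l.head? = some p) (x : ℤ) (q : ℤ × ℤ) : q ∈ hgo x l ↔
    q ∈ l ∨ q.2 = p.2 ∧ (p.1 ≤ q.1 ∧ q.1 ≤ x ∨ x ≤ q.1 ∧ q.1 ≤ p.1) := by
  obtain ⟨a, b⟩ := q
  refine hgo_induction (Q := fun x t => (a, b) ∈ t ↔
    (a, b) ∈ l ∨ b = p.2 ∧ (p.1 ≤ a ∧ a ≤ x ∨ x ≤ a ∧ a ≤ p.1)) h ?_ ?_ ?_ x
  · have hp : (p.1, p.2) ∈ l := List.mem_of_mem_head? h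
    constructor
    · exact Or.inl
    · rintro (hq | ⟨rfl, hq⟩)
      · exact hq
      · rwa [show a = p.1 by omega]
  · intro x hx ih
    rw [List.mem_cons, ih, Prod.mk.injEq]
    by_cases hq : (a, b) ∈ l <;> simp only [hq, true_or, or_true, false_or]
    omega
  · intro x hx ih
    rw [List.mem_cons, ih, Prod.mk.injEq]
    by_cases hq : (a, b) ∈ l <;> simp only [hq, true_or, or_true, false_or]
    omega

theorem mem_vgo (h : l.head? = some p) (y : ℤ) (q : ℤ × ℤ) : q ∈ vgo y l ↔
    q ∈ l ∨ q.1 = p.1 ∧ (p.2 ≤ q.2 ∧ q.2 ≤ y ∨ y ≤ q.2 ∧ q.2 ≤ p.2) := by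
  obtain ⟨a, b⟩ := q
  refine vgo_induction (Q := fun y t => (a, b) ∈ t ↔
    (a, b) ∈ l ∨ a = p.1 ∧ (p.2 ≤ b ∧ b ≤ y ∨ y ≤ b ∧ b ≤ p.2)) h ?_ ?_ ?_ y
  · have hp : (p.1, p.2) ∈ l := List.mem_of_mem_head? h
    constructor
    · exact Or.inl
    · rintro (hq | ⟨rfl, hq⟩)
      · exact hq
      · rwa [show b = p.2 by omega]
  · intro y hy ih
    rw [List.mem_cons, ih, Prod.mk.injEq]
    by_cases hq : (a, b) ∈ l <;> simp only [hq, true_or, or_true, false_or]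
    omega
  · intro y hy ih
    rw [List.mem_cons, ih, Prod.mk.injEq]
    by_cases hq : (a, b) ∈ l <;> simp only [hq, true_or, or_true, false_or]
    omega

/-- Only old nodes on the line of the run can block it: the nodes of the run itself are always
behind its end. -/
theorem PrudentPath.hgo (h : l.head? = some p) (hl : PrudentPath l) (x : ℤ)
    (hr : p.1 < x → ∀ q ∈ l, q.2 = p.2 → q.1 ≤ p.1)
    (hl' : x < p.1 → ∀ q ∈ l, q.2 = p.2 → p.1 ≤ q.1) : PrudentPath (hgo x l) := by
  revert hr hl'
  refine hgo_induction (Q := fun x t => (p.1 < x → ∀ q ∈ l, q.2 = p.2 → q.1 ≤ p.1) →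
    (x < p.1 → ∀ q ∈ l, q.2 = p.2 → p.1 ≤ q.1) → PrudentPath t) h (fun _ _ => hl) ?_ ?_ x
  · intro x hx ih hr hl'
    rw [prudentPath_cons (head_hgo h x)]
    refine ⟨Or.inl ⟨rfl, fun q hq hq2 => ?_⟩, ih (fun _ => hr (by omega)) (by omega)⟩
    rcases (mem_hgo h x q).1 hq with hq | hq
    · have := hr (by omega) q hq hq2
      dsimp only; omega
    · dsimp only; omega
  · intro x hx ih hr hl'
    rw [prudentPath_cons (head_hgo h x)]
    refine ⟨Or.inr (Or.inl ⟨rfl, fun q hq hq2 => ?_⟩), ih (by omega) (fun _ => hl' (by omega))⟩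
    rcases (mem_hgo h x q).1 hq with hq | hq
    · have := hl' (by omega) q hq hq2
      dsimp only; omega
    · dsimp only; omega

theorem PrudentPath.vgo (h : l.head? = some p) (hl : PrudentPath l) (y : ℤ)
    (hr : p.2 < y → ∀ q ∈ l, q.1 = p.1 → q.2 ≤ p.2)
    (hl' : y < p.2 → ∀ q ∈ l, q.1 = p.1 → p.2 ≤ q.2) : PrudentPath (vgo y l) := by
  revert hr hl'
  refine vgo_induction (Q := fun y t => (p.2 < y → ∀ q ∈ l, q.1 = p.1 → q.2 ≤ p.2) →
    (y < p.2 → ∀ q ∈ l, q.1 = p.1 → p.2 ≤ q.2) → PrudentPath t) h (fun _ _ => hl) ?_ ?_ y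
  · intro y hy ih hr hl'
    rw [prudentPath_cons (head_vgo h y)]
    refine ⟨Or.inr (Or.inr (Or.inl ⟨rfl, fun q hq hq2 => ?_⟩)),
      ih (fun _ => hr (by omega)) (by omega)⟩
    rcases (mem_vgo h y q).1 hq with hq | hq
    · have := hr (by omega) q hq hq2
      dsimp only; omega
    · dsimp only; omega
  · intro y hy ih hr hl'
    rw [prudentPath_cons (head_vgo h y)]
    refine ⟨Or.inr (Or.inr (Or.inr ⟨rfl, fun q hq hq2 => ?_⟩)),
      ih (by omega) (fun _ => hl' (by omega))⟩
    rcases (mem_vgo h y q).1 hq with hq | hq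
    · have := hl' (by omega) q hq hq2
      dsimp only; omega
    · dsimp only; omega

/-- The directed edges of a path given in reversed order. -/
def pathEdges : List (ℤ × ℤ) → List ((ℤ × ℤ) × (ℤ × ℤ))
  | r :: p :: l => (p, r) :: pathEdges (p :: l)
  | _ => []

theorem pathEdges_cons (h : l.head? = some p) (r : ℤ × ℤ) :
    pathEdges (r :: l) = (p, r) :: pathEdges l := by
  obtain ⟨t, rfl⟩ := List.head?_eq_some_iff.mp h
  rfl

theorem mem_pathEdges_hgo (h : l.head? = some p) (x : ℤ) : ∀ e ∈ pathEdges (hgo x l),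
    e ∈ pathEdges l ∨ (∃ t, p.1 ≤ t ∧ t < x ∧ e = ((t, p.2), (t + 1, p.2))) ∨
      ∃ t, x ≤ t ∧ t < p.1 ∧ e = ((t + 1, p.2), (t, p.2)) := by
  refine hgo_induction (Q := fun x m => ∀ e ∈ pathEdges m, e ∈ pathEdges l ∨
    (∃ t, p.1 ≤ t ∧ t < x ∧ e = ((t, p.2), (t + 1, p.2))) ∨
      ∃ t, x ≤ t ∧ t < p.1 ∧ e = ((t + 1, p.2), (t, p.2))) h (fun e he => Or.inl he) ?_ ?_ x
  · intro x hx ih e he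
    rw [pathEdges_cons (head_hgo h x)] at he
    rcases List.mem_cons.1 he with rfl | he
    · exact Or.inr (Or.inl ⟨x, hx, by omega, rfl⟩)
    · rcases ih e he with he | ⟨t, h1, h2, rfl⟩ | ⟨t, h1, h2, rfl⟩
      · exact Or.inl he
      · exact Or.inr (Or.inl ⟨t, h1, by omega, rfl⟩)
      · omega
  · intro x hx ih e he
    rw [pathEdges_cons (head_hgo h x)] at he
    rcases List.mem_cons.1 he with rfl | he
    · exact Or.inr (Or.inr ⟨x - 1, le_rfl, by omega, by simp⟩)
    · rcases ih e he with he | ⟨t, h1, h2, rfl⟩ | ⟨t, h1, h2, rfl⟩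
      · exact Or.inl he
      · omega
      · exact Or.inr (Or.inr ⟨t, by omega, h2, rfl⟩)

theorem mem_pathEdges_vgo (h : l.head? = some p) (y : ℤ) : ∀ e ∈ pathEdges (vgo y l),
    e ∈ pathEdges l ∨ (∃ t, p.2 ≤ t ∧ t < y ∧ e = ((p.1, t), (p.1, t + 1))) ∨
      ∃ t, y ≤ t ∧ t < p.2 ∧ e = ((p.1, t + 1), (p.1, t)) := by
  refine vgo_induction (Q := fun y m => ∀ e ∈ pathEdges m, e ∈ pathEdges l ∨
    (∃ t, p.2 ≤ t ∧ t < y ∧ e = ((p.1, t), (p.1, t + 1))) ∨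
      ∃ t, y ≤ t ∧ t < p.2 ∧ e = ((p.1, t + 1), (p.1, t))) h (fun e he => Or.inl he) ?_ ?_ y
  · intro y hy ih e he
    rw [pathEdges_cons (head_vgo h y)] at he
    rcases List.mem_cons.1 he with rfl | he
    · exact Or.inr (Or.inl ⟨y, hy, by omega, rfl⟩)
    · rcases ih e he with he | ⟨t, h1, h2, rfl⟩ | ⟨t, h1, h2, rfl⟩
      · exact Or.inl he
      · exact Or.inr (Or.inl ⟨t, h1, by omega, rfl⟩)
      · omega
  · intro y hy ih e he
    rw [pathEdges_cons (head_vgo h y)] at he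
    rcases List.mem_cons.1 he with rfl | he
    · exact Or.inr (Or.inr ⟨y - 1, le_rfl, by omega, by simp⟩)
    · rcases ih e he with he | ⟨t, h1, h2, rfl⟩ | ⟨t, h1, h2, rfl⟩
      · exact Or.inl he
      · omega
      · exact Or.inr (Or.inr ⟨t, by omega, h2, rfl⟩)

/-- The number of edges of a path that are crossed by the ray from the cell `c` to the east. -/
def crossings (l : List (ℤ × ℤ)) (c : ℤ × ℤ) : ℕ :=
  (pathEdges l).countP (fun e => decide (e.1.1 = e.2.1 ∧ c.1 < e.1.1 ∧ min e.1.2 e.2.2 = c.2))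

theorem crossings_cons (h : l.head? = some p) (r c : ℤ × ℤ) : crossings (r :: l) c =
    crossings l c + if p.1 = r.1 ∧ c.1 < p.1 ∧ min p.2 r.2 = c.2 then 1 else 0 := by
  rw [crossings, pathEdges_cons h, List.countP_cons]
  simp [crossings]

theorem crossings_hgo (h : l.head? = some p) (x : ℤ) (c : ℤ × ℤ) :
    crossings (hgo x l) c = crossings l c := by
  refine hgo_induction (Q := fun x m => crossings m c = crossings l c) h rfl ?_ ?_ x
  · intro x hx ih
    rw [crossings_cons (head_hgo h x), ih, if_neg (by dsimp only; omega), add_zero]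
  · intro x hx ih
    rw [crossings_cons (head_hgo h x), ih, if_neg (by dsimp only; omega), add_zero]

/-- A straight vertical run crosses a given horizontal ray at most once, and horizontal runs never
do; so the crossings of a walk are known from its corners. -/
theorem crossings_vgo (h : l.head? = some p) (y : ℤ) (c : ℤ × ℤ) :
    crossings (vgo y l) c = crossings l c +
      if c.1 < p.1 ∧ (p.2 ≤ c.2 ∧ c.2 < y ∨ y ≤ c.2 ∧ c.2 < p.2) then 1 else 0 := by
  refine vgo_induction (Q := fun y m => crossings m c = crossings l c +
    if c.1 < p.1 ∧ (p.2 ≤ c.2 ∧ c.2 < y ∨ y ≤ c.2 ∧ c.2 < p.2) then 1 else 0) h ?_ ?_ ?_ y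
  · rw [if_neg (by omega), add_zero]
  · intro y hy ih
    rw [crossings_cons (head_vgo h y), ih]
    dsimp only
    split_ifs <;> omega
  · intro y hy ih
    rw [crossings_cons (head_vgo h y), ih]
    dsimp only
    split_ifs <;> omega

end go

/-! ### Codes for the counterclockwise prudent polygons -/

/-- A code records how a polygon is built up from the unit square: `row c k` adds a row of `k`
cells on top, `col c k` a column of `k` cells on the right, and `bot c k` a row of `k` cells at
the bottom. -/
inductive Code
  | sq : Code
  | row : Code → ℕ → Code
  | col : Code → ℕ → Code
  | bot : Code → ℕ → Code

namespace Code

/-- The width of the polygon. -/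
def wd : Code → ℕ
  | sq => 1
  | row c k => max c.wd k
  | col c _ => c.wd + 1
  | bot c _ => c.wd

/-- The height of the polygon. -/
def ht : Code → ℕ
  | sq => 1
  | row c _ => c.ht + 1
  | col c k => max c.ht k
  | bot c _ => c.ht + 1

/-- The area of the polygon. -/
def ar : Code → ℕ
  | sq => 1
  | row c k => c.ar + k
  | col c k => c.ar + k
  | bot c k => c.ar + k

/-- The ordinate of the top side of the polygon. -/
def tp : Code → ℤ
  | sq => 1
  | row c _ => c.tp + 1
  | col c _ => c.tp
  | bot c _ => c.tp

/-- The ordinate of the bottom side of the polygon. -/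
def bt (c : Code) : ℤ := c.tp - c.ht

/-- The last addition was a top row within the width of the polygon. -/
def isX : Code → Prop
  | row c k => k ≤ c.wd
  | _ => False

/-- The last addition was a bottom row, or a right column that is longer than the polygon. -/
def isZ : Code → Prop
  | col c k => c.ht < k
  | bot _ _ => True
  | _ => False

/-- The codes of the polygons. -/
def Valid : Code → Prop
  | sq => True
  | row c k => c.Valid ∧ 1 ≤ k ∧ k ≤ c.wd + 1
  | col c k => c.Valid ∧ ¬ c.isX ∧ 1 ≤ k ∧ k ≤ c.ht + 1
  | bot c k => c.Valid ∧ c.isZ ∧ 1 ≤ k ∧ k + 1 ≤ c.wd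

/-- The walk of the polygon up to its current node on the right side or in the top row, and up to
its last node on the bottom side (reversed lists). -/
def paths : Code → List (ℤ × ℤ) × List (ℤ × ℤ)
  | sq => ([(0, 0)], [])
  | row c k => (hgo (k - 1) (vgo c.tp c.paths.1), [])
  | col c k => (hgo c.wd (vgo (c.tp - k) c.paths.1), vgo (c.tp - k) c.paths.1)
  | bot c k => (hgo (c.wd - 1) (vgo (c.bt - 1) (hgo (c.wd - 1 - k) c.paths.2)),
      vgo (c.bt - 1) (hgo (c.wd - 1 - k) c.paths.2))

/-- The walk of the polygon up to its current node on the right side or in the top row. -/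
def rpath (c : Code) : List (ℤ × ℤ) := c.paths.1

/-- The walk of the polygon up to its last node on the bottom side. -/
def bpath (c : Code) : List (ℤ × ℤ) := c.paths.2

theorem rpath_sq : sq.rpath = [(0, 0)] := rfl
theorem rpath_row (c : Code) (k : ℕ) : (row c k).rpath = hgo (k - 1) (vgo c.tp c.rpath) := rfl
theorem rpath_col (c : Code) (k : ℕ) : (col c k).rpath = hgo c.wd (col c k).bpath := rfl
theorem rpath_bot (c : Code) (k : ℕ) : (bot c k).rpath = hgo (c.wd - 1) (bot c k).bpath := rfl
theorem bpath_col (c : Code) (k : ℕ) : (col c k).bpath = vgo (c.tp - k) c.rpath := rfl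
theorem bpath_bot (c : Code) (k : ℕ) :
    (bot c k).bpath = vgo (c.bt - 1) (hgo (c.wd - 1 - k) c.bpath) := rfl

/-- The closed walk of the polygon, reversed. -/
def loop (c : Code) : List (ℤ × ℤ) := vgo 0 (hgo (-1) (vgo c.tp c.rpath))

/-- The abscissa of the end of `rpath`. -/
def hx : Code → ℤ
  | sq => 0
  | row _ k => k - 1
  | col c _ => c.wd
  | bot c _ => c.wd - 1

/-- The ordinate of the end of `rpath`. -/
def hy : Code → ℤ
  | sq => 0
  | row c _ => c.tp
  | col c k => c.tp - k
  | bot c _ => c.bt - 1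

/-- The abscissa of the end of `bpath`. -/
def bx : Code → ℤ
  | col c _ => c.wd - 1
  | bot c k => c.wd - 1 - k
  | _ => 0

theorem Valid.one_le_wd : ∀ {c : Code}, c.Valid → 1 ≤ c.wd
  | sq, _ => le_rfl
  | row c k, h => le_max_of_le_left h.1.one_le_wd
  | col c k, _ => by simp [wd]
  | bot c k, h => h.1.one_le_wd

theorem Valid.one_le_ht : ∀ {c : Code}, c.Valid → 1 ≤ c.ht
  | sq, _ => le_rfl
  | row c k, h => by simp [ht]
  | col c k, h => le_max_of_le_left h.1.one_le_ht
  | bot c k, h => by simp [ht]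

theorem Valid.one_le_ar : ∀ {c : Code}, c.Valid → 1 ≤ c.ar
  | sq, _ => le_rfl
  | row _ _, h => le_add_right h.1.one_le_ar
  | col _ _, h => le_add_right h.1.one_le_ar
  | bot _ _, h => le_add_right h.1.one_le_ar

theorem not_isX_of_isZ : ∀ {c : Code}, c.isZ → ¬ c.isX
  | sq, _ => id
  | row _ _, h => h.elim
  | col _ _, _ => id
  | bot _ _, _ => id

/-! ### Invariants of the walk of a code -/

/-- The position of `rpath` in the bounding box of the polygon. -/
structure RInv (c : Code) : Prop where
  head : c.rpath.head? = some (c.hx, c.hy)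
  path : PrudentPath c.rpath
  box : ∀ q ∈ c.rpath, 0 ≤ q.1 ∧ q.1 ≤ c.wd - 1 ∧ c.bt ≤ q.2 ∧ q.2 ≤ c.tp - 1
  -- An occupied column blocks every step down from a new top row into the box.
  hit_col : ∀ x : ℤ, 0 ≤ x → x ≤ c.wd - 1 → ∃ y, (x, y) ∈ c.rpath
  hit_row : ∀ y : ℤ, c.bt ≤ y → y ≤ c.tp - 1 → ∃ x, (x, y) ∈ c.rpath
  above : ∀ q ∈ c.rpath, q.1 = c.hx → q.2 ≤ c.hy
  -- Here the walk has just entered the right column, where its end is its only node. So it may run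
  -- up or down that side, while a step to the left is blocked by an earlier node in the same row.
  right : ¬ c.isX → c.hx = c.wd - 1 ∧ (∀ q ∈ c.rpath, q.1 = c.wd - 1 → q.2 = c.hy) ∧
    (2 ≤ c.wd → ∀ y : ℤ, c.bt ≤ y → y ≤ c.tp - 1 → ∃ x : ℤ, x < c.wd - 1 ∧ (x, y) ∈ c.rpath)
  top : c.isX → c.hy = c.tp - 1

/-- The position of `bpath` in the bounding box of the polygon. -/
structure BInv (c : Code) : Prop where
  rpath_eq : c.rpath = hgo (c.wd - 1) c.bpath
  hy_eq : c.hy = c.bt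
  head : c.bpath.head? = some (c.bx, c.bt)
  path : PrudentPath c.bpath
  box : ∀ q ∈ c.bpath, 0 ≤ q.1 ∧ q.1 ≤ c.wd - 2 ∧ c.bt ≤ q.2 ∧ q.2 ≤ c.tp - 1
  hit_row : ∀ y : ℤ, c.bt ≤ y → y ≤ c.tp - 1 → ∃ x, (x, y) ∈ c.bpath
  hit_col : ∀ x : ℤ, 0 ≤ x → x ≤ c.wd - 2 → ∃ y, c.bt < y ∧ (x, y) ∈ c.bpath
  -- Hence the walk can run along the bottom side in either direction.
  low : ∀ q ∈ c.bpath, q.2 = c.bt → q.1 = c.bx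

theorem RInv.mem {c : Code} (h : c.RInv) : (c.hx, c.hy) ∈ c.rpath := List.mem_of_mem_head? h.head

theorem RInv.hx_hy {c : Code} (h : c.RInv) :
    0 ≤ c.hx ∧ c.hx ≤ c.wd - 1 ∧ c.bt ≤ c.hy ∧ c.hy ≤ c.tp - 1 := h.box _ h.mem

theorem RInv.bt_nonpos {c : Code} (h : c.RInv) : c.bt ≤ 0 ∧ 1 ≤ c.tp := by
  have := h.box _ h.path.origin_mem
  dsimp only at this; omega

theorem BInv.mem {c : Code} (h : c.BInv) : (c.bx, c.bt) ∈ c.bpath := List.mem_of_mem_head? h.head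

theorem rInv_sq : sq.RInv where
  head := rfl
  path := rfl
  box := by simp [rpath_sq, wd, bt, tp, ht]
  hit_col := fun x h1 h2 => ⟨0, by simp [rpath_sq, wd] at *; omega⟩
  hit_row := fun x h1 h2 => ⟨0, by simp [rpath_sq, tp, bt, ht] at *; omega⟩
  above := by simp [rpath_sq, hx, hy]
  right := fun _ => by simp [rpath_sq, hx, hy, wd]
  top := fun h => h.elim

/-- The walk that has just entered a new top row. -/
theorem RInv.head_up {c : Code} (h : c.RInv) : (vgo c.tp c.rpath).head? = some (c.hx, c.tp) :=
  head_vgo h.head _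

theorem RInv.path_up {c : Code} (h : c.RInv) : PrudentPath (vgo c.tp c.rpath) :=
  h.path.vgo h.head _ (fun _ => h.above) (fun h' => by have := h.hx_hy; dsimp only at h'; omega)

theorem RInv.mem_up {c : Code} (h : c.RInv) (q : ℤ × ℤ) : q ∈ vgo c.tp c.rpath ↔
    q ∈ c.rpath ∨ q.1 = c.hx ∧ c.hy ≤ q.2 ∧ q.2 ≤ c.tp := by
  rw [mem_vgo h.head]
  have := h.hx_hy
  by_cases hq : q ∈ c.rpath <;> simp only [hq, true_or, false_or]
  omega

/-- The new row lies above all nodes of `c.rpath`, so the walk may turn either way in it. Only the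
length `c.wd + 1` ends in a new column and so puts the walk on the right side. -/
theorem rInv_row {c : Code} {k : ℕ} (h : c.RInv) (h1 : 1 ≤ k) (h2 : k ≤ c.wd + 1) :
    (row c k).RInv := by
  have hp := h.hx_hy
  have hm := h.mem_up
  have hm' := fun q => mem_hgo h.head_up (k - 1) q
  dsimp only at hm'
  rw [← rpath_row] at hm'
  have hbt : (row c k).bt = c.bt := by simp only [bt, tp, ht]; push_cast; ring
  have hwd : ((row c k).wd : ℤ) = max (c.wd : ℤ) k := by simp [wd]
  have htp : (row c k).tp = c.tp + 1 := rfl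
  have hhx : (row c k).hx = k - 1 := rfl
  have hhy : (row c k).hy = c.tp := rfl
  have hrow : ∀ q ∈ (row c k).rpath, q ∈ c.rpath ∨ (q.1 = c.hx ∧ c.hy ≤ q.2 ∧ q.2 ≤ c.tp) ∨
      (q.2 = c.tp ∧ (c.hx ≤ q.1 ∧ q.1 ≤ k - 1 ∨ k - 1 ≤ q.1 ∧ q.1 ≤ c.hx)) := by
    intro q hq
    rw [hm', hm] at hq
    tauto
  refine ⟨?_, ?_, ?_, ?_, ?_, ?_, ?_, ?_⟩
  · rw [rpath_row]; exact head_hgo h.head_up _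
  · rw [rpath_row]
    refine h.path_up.hgo h.head_up _ (fun _ q hq hq2 => ?_) (fun _ q hq hq2 => ?_) <;>
    · rcases (hm q).1 hq with hq | hq
      · have := h.box q hq
        dsimp only at hq2; omega
      · dsimp only; omega
  · intro q hq
    rcases hrow q hq with hq | hq | hq
    · have := h.box q hq; omega
    · omega
    · omega
  · intro x hx0 hx1
    by_cases hx2 : x ≤ c.wd - 1
    · obtain ⟨y, hy⟩ := h.hit_col x hx0 hx2
      exact ⟨y, (hm' _).2 (Or.inl ((hm _).2 (Or.inl hy)))⟩
    · exact ⟨c.tp, (hm' _).2 (Or.inr (by dsimp only; omega))⟩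
  · intro y hy0 hy1
    by_cases hy2 : y ≤ c.tp - 1
    · obtain ⟨x, hx⟩ := h.hit_row y (by omega) hy2
      exact ⟨x, (hm' _).2 (Or.inl ((hm _).2 (Or.inl hx)))⟩
    · exact ⟨c.hx, (hm' _).2 (Or.inr (by dsimp only; omega))⟩
  · intro q hq _
    rcases hrow q hq with hq | hq | hq
    · have := h.box q hq; omega
    · omega
    · omega
  · intro hX
    have hk : k = c.wd + 1 := by simp only [isX] at hX; omega
    refine ⟨by omega, fun q hq hq1 => ?_, fun _ y hy0 hy1 => ?_⟩
    · rcases hrow q hq with hq | hq | hq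
      · have := h.box q hq; omega
      · omega
      · omega
    · by_cases hy2 : y ≤ c.tp - 1
      · obtain ⟨x, hx⟩ := h.hit_row y (by omega) hy2
        have := h.box _ hx
        exact ⟨x, by dsimp only at this; omega, (hm' _).2 (Or.inl ((hm _).2 (Or.inl hx)))⟩
      · exact ⟨c.hx, by omega, (hm' _).2 (Or.inr (by dsimp only; omega))⟩
  · intro _; omega

/-- The walk that has moved along the right side of the polygon. -/
theorem RInv.path_right {c : Code} (h : c.RInv) (hX : ¬ c.isX) (y : ℤ) :
    PrudentPath (vgo y c.rpath) := by
  obtain ⟨h1, h2, -⟩ := h.right hX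
  exact h.path.vgo h.head _ (fun _ => h.above) (fun _ q hq hq1 => (h2 q hq (by rw [← h1, hq1])).ge)

/-- The walk runs along the right side to the ordinate `c.tp - k` and then steps into an empty
column. Only for `k = c.ht + 1` does it leave the box below, and only then is its position before
that step on a new bottom side. -/
theorem inv_col {c : Code} {k : ℕ} (h : c.RInv) (hX : ¬ c.isX) (hw : 1 ≤ c.wd) (h1 : 1 ≤ k)
    (h2 : k ≤ c.ht + 1) : (col c k).RInv ∧ ((col c k).isZ → (col c k).BInv) := by
  have hp := h.hx_hy
  obtain ⟨g1, g2, g3⟩ := h.right hX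
  have hb : (col c k).bpath.head? = some (c.hx, c.tp - k) := head_vgo h.head _
  have hr : (col c k).rpath.head? = some ((c.wd : ℤ), c.tp - k) := head_hgo hb _
  have hbp : PrudentPath (col c k).bpath := h.path_right hX _
  have hm : ∀ q, q ∈ (col c k).bpath ↔ _ := fun q => mem_vgo h.head (c.tp - k) q
  have hm' : ∀ q, q ∈ (col c k).rpath ↔ _ := fun q => mem_hgo hb c.wd q
  dsimp only at hm hm'
  have hbt' : c.bt = c.tp - c.ht := rfl
  have hbt : (col c k).bt = c.tp - max (c.ht : ℤ) k := by simp [bt, tp, ht]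
  have hwd : ((col c k).wd : ℤ) = c.wd + 1 := by simp [wd]
  have htp : (col c k).tp = c.tp := rfl
  have hhx : (col c k).hx = c.wd := rfl
  have hhy : (col c k).hy = c.tp - k := rfl
  have hbx : (col c k).bx = c.wd - 1 := rfl
  have hbox : ∀ q ∈ (col c k).bpath,
      0 ≤ q.1 ∧ q.1 ≤ (col c k).wd - 2 ∧ (col c k).bt ≤ q.2 ∧ q.2 ≤ (col c k).tp - 1 := by
    intro q hq
    rcases (hm q).1 hq with hq | hq
    · have := h.box q hq; omega
    · omega
  have hrow : ∀ y : ℤ, (col c k).bt ≤ y → y ≤ (col c k).tp - 1 → ∃ x, (x, y) ∈ (col c k).bpath := by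
    intro y hy0 hy1
    by_cases hy2 : c.bt ≤ y
    · obtain ⟨x, hx⟩ := h.hit_row y hy2 hy1
      exact ⟨x, (hm _).2 (Or.inl hx)⟩
    · exact ⟨c.hx, (hm _).2 (Or.inr (by dsimp only; omega))⟩
  have hcol : ∀ x : ℤ, 0 ≤ x → x ≤ (col c k).wd - 2 → ∃ y, c.bt ≤ y ∧ (x, y) ∈ (col c k).bpath := by
    intro x hx0 hx1
    obtain ⟨y, hy⟩ := h.hit_col x hx0 (by omega)
    exact ⟨y, (h.box _ hy).2.2.1, (hm _).2 (Or.inl hy)⟩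
  refine ⟨⟨hr, ?_, ?_, ?_, ?_, ?_, ?_, fun h => h.elim⟩,
    fun hZ => ⟨?_, ?_, ?_, hbp, hbox, hrow, ?_, ?_⟩⟩
  · refine hbp.hgo hb _ (fun _ q hq hq2 => ?_) (fun h' => ?_)
    · have := hbox q hq; dsimp only; omega
    · dsimp only at h'; omega
  · intro q hq
    rcases (hm' q).1 hq with hq | hq
    · have := hbox q hq; omega
    · omega
  · intro x hx0 hx1
    by_cases hx2 : x ≤ c.wd - 1
    · obtain ⟨y, -, hy⟩ := hcol x hx0 (by omega)
      exact ⟨y, (hm' _).2 (Or.inl hy)⟩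
    · exact ⟨c.tp - k, (hm' _).2 (Or.inr (by dsimp only; omega))⟩
  · intro y hy0 hy1
    obtain ⟨x, hx⟩ := hrow y hy0 hy1
    exact ⟨x, (hm' _).2 (Or.inl hx)⟩
  · intro q hq hq1
    rcases (hm' q).1 hq with hq | hq
    · have := hbox q hq; omega
    · omega
  · refine fun _ => ⟨by omega, fun q hq hq1 => ?_, fun _ y hy0 hy1 => ?_⟩
    · rcases (hm' q).1 hq with hq | hq
      · have := hbox q hq; omega
      · omega
    · obtain ⟨x, hx⟩ := hrow y hy0 hy1
      have := hbox _ hx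
      exact ⟨x, by dsimp only at this; omega, (hm' _).2 (Or.inl hx)⟩
  · rw [rpath_col]; congr 1; omega
  · simp only [isZ] at hZ; omega
  · simp only [isZ] at hZ
    rw [hb]; congr 2; omega
  · intro x hx0 hx1
    simp only [isZ] at hZ
    obtain ⟨y, hy, hy'⟩ := hcol x hx0 hx1
    exact ⟨y, by omega, hy'⟩
  · intro q hq hq2
    simp only [isZ] at hZ
    rcases (hm q).1 hq with hq | hq
    · have := h.box q hq; omega
    · omega

/-- The walk that has moved along the bottom side of the polygon. -/
theorem BInv.path_bottom {c : Code} (h : c.BInv) (x : ℤ) : PrudentPath (hgo x c.bpath) :=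
  h.path.hgo h.head _ (fun _ q hq hq2 => (h.low q hq hq2).le)
    (fun _ q hq hq2 => (h.low q hq hq2).ge)

/-- The row below the box is empty, so the walk can run in it to the right side; the bound on `k`
keeps it in the right half-plane. -/
theorem inv_bot {c : Code} {k : ℕ} (h : c.BInv) (h1 : 1 ≤ k)
    (h2 : k + 1 ≤ c.wd) : (bot c k).RInv ∧ (bot c k).BInv := by
  have hp := h.box _ h.mem
  dsimp only at hp
  have ha : (hgo (c.wd - 1 - k) c.bpath).head? = some ((c.wd : ℤ) - 1 - k, c.bt) :=
    head_hgo h.head _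
  have hb : (bot c k).bpath.head? = some ((c.wd : ℤ) - 1 - k, c.bt - 1) := head_vgo ha _
  have hr : (bot c k).rpath.head? = some ((c.wd : ℤ) - 1, c.bt - 1) := head_hgo hb _
  have hm0 := fun q => mem_hgo h.head ((c.wd : ℤ) - 1 - k) q
  have hm : ∀ q, q ∈ (bot c k).bpath ↔ _ := fun q => mem_vgo ha (c.bt - 1) q
  have hm' : ∀ q, q ∈ (bot c k).rpath ↔ _ := fun q => mem_hgo hb (c.wd - 1) q
  dsimp only at hm hm' hm0
  have hbt : (bot c k).bt = c.bt - 1 := by simp only [bt, tp, ht]; push_cast; ring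
  have hwd : ((bot c k).wd : ℤ) = c.wd := rfl
  have htp : (bot c k).tp = c.tp := rfl
  have hhx : (bot c k).hx = c.wd - 1 := rfl
  have hhy : (bot c k).hy = c.bt - 1 := rfl
  have hbx : (bot c k).bx = c.wd - 1 - k := rfl
  have hsub : ∀ q ∈ (bot c k).bpath, q ∈ c.bpath ∨ (q.2 = c.bt ∧ 0 ≤ q.1 ∧ q.1 ≤ c.wd - 2) ∨
      (q.1 = c.wd - 1 - k ∧ c.bt - 1 ≤ q.2 ∧ q.2 ≤ c.bt) := by
    intro q hq
    rcases (hm q).1 hq with hq | hq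
    · rcases (hm0 q).1 hq with hq | hq
      · exact Or.inl hq
      · right; left; omega
    · right; right; omega
  have hbox : ∀ q ∈ (bot c k).bpath,
      0 ≤ q.1 ∧ q.1 ≤ (bot c k).wd - 2 ∧ (bot c k).bt ≤ q.2 ∧ q.2 ≤ (bot c k).tp - 1 := by
    intro q hq
    rcases hsub q hq with hq | hq | hq
    · have := h.box q hq; omega
    · omega
    · omega
  have hlow : ∀ q ∈ (bot c k).bpath, q.2 = (bot c k).bt → q.1 = (bot c k).bx := by
    intro q hq hq2
    rcases hsub q hq with hq | hq | hq
    · have := h.box q hq; omega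
    · omega
    · omega
  have hrow : ∀ y : ℤ, (bot c k).bt ≤ y → y ≤ (bot c k).tp - 1 → ∃ x, (x, y) ∈ (bot c k).bpath := by
    intro y hy0 hy1
    by_cases hy2 : c.bt ≤ y
    · obtain ⟨x, hx⟩ := h.hit_row y hy2 hy1
      exact ⟨x, (hm _).2 (Or.inl ((hm0 _).2 (Or.inl hx)))⟩
    · exact ⟨c.wd - 1 - k, (hm _).2 (Or.inr (by dsimp only; omega))⟩
  have hcol : ∀ x : ℤ, 0 ≤ x → x ≤ (bot c k).wd - 2 →
      ∃ y, (bot c k).bt < y ∧ (x, y) ∈ (bot c k).bpath := by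
    intro x hx0 hx1
    obtain ⟨y, hy', hy⟩ := h.hit_col x hx0 (by omega)
    exact ⟨y, by omega, (hm _).2 (Or.inl ((hm0 _).2 (Or.inl hy)))⟩
  have hbp : PrudentPath (bot c k).bpath := by
    refine (h.path_bottom _).vgo ha _ (fun h' => ?_) (fun _ q hq _ => ?_)
    · dsimp only at h'; omega
    · rcases (hm0 q).1 hq with hq | hq
      · have := h.box q hq; dsimp only; omega
      · dsimp only; omega
  refine ⟨⟨hr, ?_, ?_, ?_, ?_, ?_, ?_, fun h => h.elim⟩,
    ⟨rfl, by omega, by rw [hb, hbx, hbt], hbp, hbox, hrow, hcol, hlow⟩⟩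
  · refine hbp.hgo hb _ (fun _ q hq hq2 => ?_) (fun h' => ?_)
    · have := hlow q hq (by dsimp only at hq2; omega); dsimp only; omega
    · dsimp only at h'; omega
  · intro q hq
    rcases (hm' q).1 hq with hq | hq
    · have := hbox q hq; omega
    · omega
  · intro x hx0 hx1
    by_cases hx2 : x ≤ c.wd - 2
    · obtain ⟨y, -, hy⟩ := hcol x hx0 (by omega)
      exact ⟨y, (hm' _).2 (Or.inl hy)⟩
    · exact ⟨c.bt - 1, (hm' _).2 (Or.inr (by dsimp only; omega))⟩
  · intro y hy0 hy1
    obtain ⟨x, hx⟩ := hrow y hy0 hy1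
    exact ⟨x, (hm' _).2 (Or.inl hx)⟩
  · intro q hq hq1
    rcases (hm' q).1 hq with hq | hq
    · have := hbox q hq; omega
    · omega
  · refine fun _ => ⟨by omega, fun q hq hq1 => ?_, fun _ y hy0 hy1 => ?_⟩
    · rcases (hm' q).1 hq with hq | hq
      · have := hbox q hq; omega
      · omega
    · obtain ⟨x, hx⟩ := hrow y hy0 hy1
      have := hbox _ hx
      exact ⟨x, by dsimp only at this; omega, (hm' _).2 (Or.inl hx)⟩

theorem Valid.inv : ∀ {c : Code}, c.Valid → c.RInv ∧ (c.isZ → c.BInv)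
  | sq, _ => ⟨rInv_sq, fun h => h.elim⟩
  | row _ _, h => ⟨rInv_row h.1.inv.1 h.2.1 h.2.2, fun h => h.elim⟩
  | col _ _, h => inv_col h.1.inv.1 h.2.1 h.1.one_le_wd h.2.2.1 h.2.2.2
  | bot _ _, h =>
    have := inv_bot (h.1.inv.2 h.2.1) h.2.2.1 h.2.2.2
    ⟨this.1, fun _ => this.2⟩

theorem Valid.rInv {c : Code} (h : c.Valid) : c.RInv := h.inv.1

theorem Valid.bInv {c : Code} (h : c.Valid) (hZ : c.isZ) : c.BInv := h.inv.2 hZ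

theorem RInv.head_left {c : Code} (h : c.RInv) :
    (hgo (-1) (vgo c.tp c.rpath)).head? = some (-1, c.tp) := head_hgo h.head_up _

theorem RInv.head_loop {c : Code} (h : c.RInv) : c.loop.head? = some (-1, 0) :=
  head_vgo h.head_left _

/-- The walk closes up along the row `c.tp` and the column `-1`, and neither contains an earlier
node apart from the one where it turns. -/
theorem RInv.path_loop {c : Code} (h : c.RInv) : PrudentPath c.loop := by
  have hp := h.hx_hy
  have ht := h.bt_nonpos
  refine (h.path_up.hgo h.head_up _ (fun h' => ?_) (fun _ q hq hq2 => ?_)).vgo h.head_left _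
    (fun h' => ?_) (fun _ q hq hq2 => ?_)
  · dsimp only at h'; omega
  · rcases (h.mem_up q).1 hq with hq | hq
    · have := h.box q hq; dsimp only at hq2; omega
    · dsimp only; omega
  · dsimp only at h'; omega
  · rcases (mem_hgo h.head_up _ q).1 hq with hq | hq
    · rcases (h.mem_up q).1 hq with hq | hq
      · have := h.box q hq; dsimp only at hq2; omega
      · dsimp only at hq2; omega
    · dsimp only at hq ⊢; omega

end Code

/-! ### Every prudent path in the right half-plane comes from a code -/

open Code

/-- A prudent path in the right half-plane is one of the walks of the construction of a
polygon. -/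
def HalfPlaneForm (l : List (ℤ × ℤ)) : Prop :=
  (∃ (c : Code) (k : ℕ), c.Valid ∧ 1 ≤ k ∧ k ≤ c.wd ∧ l = (row c k).rpath) ∨
  (∃ (c : Code) (y : ℤ), c.Valid ∧ ¬ c.isX ∧ c.bt ≤ y ∧ y ≤ c.tp - 1 ∧ l = vgo y c.rpath) ∨
  (∃ (c : Code) (x : ℤ), c.Valid ∧ c.isZ ∧ 0 ≤ x ∧ x ≤ c.wd - 2 ∧ l = hgo x c.bpath)

theorem halfPlaneForm_rpath {c : Code} (hc : c.Valid) (hX : ¬ c.isX) : HalfPlaneForm c.rpath := by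
  have h := hc.rInv.hx_hy
  exact Or.inr (Or.inl ⟨c, c.hy, hc, hX, h.2.2.1, h.2.2.2, (vgo_self hc.rInv.head).symm⟩)

theorem halfPlaneForm_row_step {c : Code} {k : ℕ} (hc : c.Valid) (h1 : 1 ≤ k) (h2 : k ≤ c.wd)
    {r : ℤ × ℤ} (hr : 0 ≤ r.1) (hf : FreeStep ((k : ℤ) - 1, c.tp) r (row c k).rpath) :
    HalfPlaneForm (r :: (row c k).rpath) := by
  have hi := hc.rInv
  have hp := hi.hx_hy
  have hv : (row c k).Valid := ⟨hc, h1, by omega⟩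
  have hmem := fun q => mem_hgo hi.head_up ((k : ℤ) - 1) q
  rw [← rpath_row] at hmem
  dsimp only at hmem
  rcases hf with ⟨rfl, hd⟩ | ⟨rfl, hd⟩ | ⟨rfl, hd⟩ | ⟨rfl, hd⟩ <;> dsimp only at hr hd
  · have hk : c.hx ≤ k - 1 := by
      by_contra hlt
      have := hd ((k : ℤ), c.tp) ((hmem _).2 (Or.inr (by dsimp only; omega))) rfl
      dsimp only at this; omega
    have e : ((k : ℤ) - 1 + 1, c.tp) :: (row c k).rpath = (row c (k + 1)).rpath := by
      rw [rpath_row, rpath_row, ← hgo_add_one hi.head_up hk]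
      push_cast; ring_nf
    rw [e]
    -- A step beyond the old width turns the end of the top row into a position on the right side.
    rcases h2.eq_or_lt with h2 | h2
    · exact halfPlaneForm_rpath ⟨hc, by omega, by omega⟩ (by simp only [isX]; omega)
    · exact Or.inl ⟨c, k + 1, hc, by omega, by omega, rfl⟩
  · have hk : (k : ℤ) - 1 ≤ c.hx := by
      by_contra hlt
      have := hd ((k : ℤ) - 2, c.tp) ((hmem _).2 (Or.inr (by dsimp only; omega))) rfl
      dsimp only at this; omega
    refine Or.inl ⟨c, k - 1, hc, by omega, by omega, ?_⟩
    rw [rpath_row, rpath_row, ← hgo_sub_one hi.head_up hk]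
    congr 1; omega
  -- A step up completes the row of `k` cells and starts another one, so far ending above its
  -- starting point.
  · refine Or.inl ⟨row c k, k, hv, h1, le_max_right _ _, ?_⟩
    have hh := hv.rInv.head
    have := hgo_self hv.rInv.head_up
    have e := vgo_add_one hh (y := c.tp) (show (row c k).hy ≤ c.tp from le_rfl)
    rw [rpath_row (row c k) k]
    rw [show ((k : ℤ) - 1) = (row c k).hx from rfl]
    rw [this, show (row c k).tp = c.tp + 1 from rfl, e]
    congr 1
    exact (vgo_self hh).symm
  · obtain ⟨y, hy⟩ := hi.hit_col ((k : ℤ) - 1) (by omega) (by omega)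
    have := hi.box _ hy
    have := hd _ ((hmem _).2 (Or.inl ((hi.mem_up _).2 (Or.inl hy)))) rfl
    dsimp only at *; omega

theorem halfPlaneForm_right_step {c : Code} {y : ℤ} (hc : c.Valid) (hX : ¬ c.isX) (h1 : c.bt ≤ y)
    (h2 : y ≤ c.tp - 1) {r : ℤ × ℤ} (hr : 0 ≤ r.1)
    (hf : FreeStep (c.hx, y) r (vgo y c.rpath)) : HalfPlaneForm (r :: vgo y c.rpath) := by
  have hi := hc.rInv
  have hp := hi.hx_hy
  obtain ⟨g1, g2, g3⟩ := hi.right hX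
  have hmem := fun q => mem_vgo hi.head y q
  dsimp only at hmem
  have hbt : c.bt = c.tp - c.ht := rfl
  have hw := hc.one_le_wd
  rcases hf with ⟨rfl, hd⟩ | ⟨rfl, hd⟩ | ⟨rfl, hd⟩ | ⟨rfl, hd⟩ <;> dsimp only at hr hd
  · have e : (c.hx + 1, y) :: vgo y c.rpath = (col c (c.tp - y).toNat).rpath := by
      rw [rpath_col, bpath_col, show c.tp - ((c.tp - y).toNat : ℤ) = y by omega,
        show (c.wd : ℤ) = c.hx + 1 by omega, hgo_add_one (head_vgo hi.head y) le_rfl,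
        hgo_self (head_vgo hi.head y)]
    rw [e]
    exact halfPlaneForm_rpath ⟨hc, hX, by omega, by omega⟩ id
  -- A node further left in the same row blocks the step; in width one the step would leave the
  -- half-plane.
  · obtain ⟨x, hx, hx'⟩ := g3 (by omega) y h1 h2
    have := hd _ ((hmem _).2 (Or.inl hx')) rfl
    dsimp only at this; omega
  · have hy : c.hy ≤ y := by
      by_contra hlt
      have := hd (c.hx, y + 1) ((hmem _).2 (Or.inr (by dsimp only; omega))) rfl
      dsimp only at this; omega
    rw [← vgo_add_one hi.head hy]
    by_cases hy2 : y = c.tp - 1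
    -- The walk enters the new top row at its right end.
    · refine Or.inl ⟨c, c.wd, hc, hc.one_le_wd, le_rfl, ?_⟩
      rw [rpath_row, ← g1, hgo_self hi.head_up, hy2, sub_add_cancel]
    · exact Or.inr (Or.inl ⟨c, y + 1, hc, hX, by omega, by omega, rfl⟩)
  · have hy : y ≤ c.hy := by
      by_contra hlt
      have := hd (c.hx, y - 1) ((hmem _).2 (Or.inr (by dsimp only; omega))) rfl
      dsimp only at this; omega
    rw [← vgo_sub_one hi.head hy]
    by_cases hy2 : y = c.bt
    -- The code already counts the column that the walk has yet to enter: its `bpath` stops just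
    -- before the step to the right.
    · have hv : (col c (c.ht + 1)).Valid := ⟨hc, hX, by omega, le_rfl⟩
      have hZ : (col c (c.ht + 1)).isZ := by simp [isZ]
      refine Or.inr (Or.inr ⟨col c (c.ht + 1), c.hx, hv, hZ, hp.1, by simp only [wd]; omega, ?_⟩)
      have := hgo_self (hv.bInv hZ).head
      rw [show (col c (c.ht + 1)).bx = c.hx from g1.symm] at this
      rw [this, bpath_col]
      congr 1; push_cast; omega
    · exact Or.inr (Or.inl ⟨c, y - 1, hc, hX, by omega, by omega, rfl⟩)

theorem halfPlaneForm_bottom_step {c : Code} {x : ℤ} (hc : c.Valid) (hZ : c.isZ) (h1 : 0 ≤ x)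
    (h2 : x ≤ c.wd - 2) {r : ℤ × ℤ} (hr : 0 ≤ r.1)
    (hf : FreeStep (x, c.bt) r (hgo x c.bpath)) : HalfPlaneForm (r :: hgo x c.bpath) := by
  have hi := hc.bInv hZ
  have hmem := fun q => mem_hgo hi.head x q
  dsimp only at hmem
  have hp := hi.box _ hi.mem
  dsimp only at hp
  rcases hf with ⟨rfl, hd⟩ | ⟨rfl, hd⟩ | ⟨rfl, hd⟩ | ⟨rfl, hd⟩ <;> dsimp only at hr hd
  · have hx : c.bx ≤ x := by
      by_contra hlt
      have := hd (x + 1, c.bt) ((hmem _).2 (Or.inr (by dsimp only; omega))) rfl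
      dsimp only at this; omega
    rw [← hgo_add_one hi.head hx]
    by_cases hx2 : x = c.wd - 2
    · rw [show x + 1 = c.wd - 1 by omega, ← hi.rpath_eq]
      exact halfPlaneForm_rpath hc (not_isX_of_isZ hZ)
    · exact Or.inr (Or.inr ⟨c, x + 1, hc, hZ, by omega, by omega, rfl⟩)
  · have hx : x ≤ c.bx := by
      by_contra hlt
      have := hd (x - 1, c.bt) ((hmem _).2 (Or.inr (by dsimp only; omega))) rfl
      dsimp only at this; omega
    rw [← hgo_sub_one hi.head hx]
    exact Or.inr (Or.inr ⟨c, x - 1, hc, hZ, by omega, by omega, rfl⟩)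
  · obtain ⟨y, hy, hy'⟩ := hi.hit_col x h1 h2
    have := hd _ ((hmem _).2 (Or.inl hy')) rfl
    dsimp only at this; omega
  · have hk : (((c.wd - 1 - x).toNat : ℕ) : ℤ) = c.wd - 1 - x := by omega
    have hv : (bot c (c.wd - 1 - x).toNat).Valid := ⟨hc, hZ, by omega, by omega⟩
    have hh := (hv.bInv trivial).head
    have hbx : (bot c (c.wd - 1 - x).toNat).bx = x := by simp only [bx]; omega
    have hself := hgo_self hh
    dsimp only at hself
    rw [hbx] at hself
    refine Or.inr (Or.inr ⟨bot c (c.wd - 1 - x).toNat, x, hv, trivial, h1,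
      by simp only [wd]; omega, ?_⟩)
    rw [hself, bpath_bot, show (c.wd : ℤ) - 1 - ((c.wd - 1 - x).toNat : ℕ) = x by omega,
      vgo_sub_one (head_hgo hi.head x) le_rfl]
    congr 1
    exact (vgo_self (head_hgo hi.head x)).symm

/-- The three forms are closed under free steps that stay in the half-plane, and the starting node
is the right side of the unit square. -/
theorem PrudentPath.halfPlaneForm {l : List (ℤ × ℤ)} (h : PrudentPath l) :
    (∀ q ∈ l, 0 ≤ q.1) → HalfPlaneForm l := by
  induction h using PrudentPath.induction with
  | start => exact fun _ => halfPlaneForm_rpath (c := sq) trivial id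
  | step p r l hl hf ih =>
    intro hpos
    have hr := hpos r (by simp)
    rcases ih fun q hq => hpos q (List.mem_cons_of_mem _ hq) with
      ⟨c, k, hc, h1, h2, e⟩ | ⟨c, y, hc, hX, h1, h2, e⟩ | ⟨c, x, hc, hZ, h1, h2, e⟩
    · have hv : (row c k).Valid := ⟨hc, h1, by omega⟩
      have hh := hv.rInv.head
      rw [← e] at hh
      obtain rfl : p = _ := by simpa using hh
      rw [e] at hf ⊢
      exact halfPlaneForm_row_step hc h1 h2 hr hf
    · have hh := head_vgo hc.rInv.head y
      rw [← e] at hh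
      obtain rfl : p = _ := by simpa using hh
      rw [e] at hf ⊢
      exact halfPlaneForm_right_step hc hX h1 h2 hr hf
    · have hh := head_hgo (hc.bInv hZ).head x
      rw [← e] at hh
      obtain rfl : p = _ := by simpa using hh
      rw [e] at hf ⊢
      exact halfPlaneForm_bottom_step hc hZ h1 h2 hr hf

/-! ### Leaving the right half-plane and closing up -/

/-- A prudent path either stays in the right half-plane, or leaves it for the first time by a step
to the left. -/
theorem PrudentPath.exists_exit {l : List (ℤ × ℤ)} (h : PrudentPath l) :
    (∀ q ∈ l, 0 ≤ q.1) ∨ ∃ y t, (-1, y) :: (0, y) :: t <:+ l ∧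
      PrudentPath ((-1, y) :: (0, y) :: t) ∧ ∀ q ∈ (0, y) :: t, 0 ≤ q.1 := by
  induction h using PrudentPath.induction with
  | start => left; simp
  | step p r l hl hf ih =>
    rcases ih with ih | ⟨y, t, hs, h⟩
    · by_cases hr : 0 ≤ r.1
      · left; exact List.forall_mem_cons.2 ⟨hr, ih⟩
      · right
        have hp := ih p (by simp)
        obtain ⟨h1, h2, h3⟩ : p.1 = 0 ∧ r.1 = -1 ∧ r.2 = p.2 := by
          rcases hf with ⟨rfl, -⟩ | ⟨rfl, -⟩ | ⟨rfl, -⟩ | ⟨rfl, -⟩ <;> dsimp only at hr ⊢ <;> omega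
        obtain ⟨p1, p2⟩ := p
        obtain ⟨r1, r2⟩ := r
        dsimp only at h1 h2 h3
        subst h1 h2 h3
        exact ⟨r2, l, List.suffix_rfl, ⟨hf, hl⟩, ih⟩
    · exact Or.inr ⟨y, t, hs.trans (List.suffix_cons _ _), h⟩

theorem PrudentPath.origin_not_mem {p : ℤ × ℤ} {l : List (ℤ × ℤ)} (h : PrudentPath (p :: l))
    (hl : l ≠ []) : p ≠ (0, 0) := by
  rintro rfl
  cases l with
  | nil => exact hl rfl
  | cons r l => exact (List.nodup_cons.1 h.nodup).1 h.2.origin_mem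

/-- Once the path has left the right half-plane through the top of its bounding box, it is forced
to go straight down. -/
theorem eq_vgo_of_suffix {l m : List (ℤ × ℤ)} {a : ℤ} (hm : m.head? = some (-1, a))
    (ho : (0, 0) ∈ m)
    (hrow : (∀ q ∈ m, q.1 ≤ 0) → ∀ y, 0 < y → y < a → (0, y) ∈ m) (h : PrudentPath l) :
    ∀ y, l.head? = some (-1, y) → 0 ≤ y → y ≤ a → m <:+ l → l = vgo y m := by
  have hma : (-1, a) ∈ m := List.mem_of_mem_head? hm
  induction h using PrudentPath.induction with
  | start => intro y hy; simp at hy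
  | step p r l hl hf ih =>
    intro y hy h0 h1 hs
    obtain rfl : r = (-1, y) := by simpa using hy
    rcases List.suffix_cons_iff.1 hs with rfl | hs
    · obtain rfl : y = a := by simpa using hm
      exact (vgo_self hm).symm
    have hsub : ∀ q ∈ m, q ∈ p :: l := fun q hq => hs.subset hq
    have hlt : y < a := by
      refine lt_of_le_of_ne h1 ?_
      rintro rfl
      exact hf.not_mem (hsub _ hma)
    have hb := PrudentPath.head_border (l := (-1, y) :: p :: l) ⟨hf, hl⟩ _ rfl
    have hb' := hl.head_border p rfl
    dsimp only at hb hb'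
    have key : p = (-1, y + 1) := by
      rcases hf with ⟨he, hd⟩ | ⟨he, hd⟩ | ⟨he, hd⟩ | ⟨he, hd⟩ <;>
        obtain ⟨p1, p2⟩ := p <;> simp only [Prod.mk.injEq] at he <;> dsimp only at hd hb'
      -- From the left, the step would head for the origin if `y = 0`; otherwise it would end
      -- strictly inside the bounding box.
      · exfalso
        rcases h0.eq_or_lt with rfl | h0
        · have := hd _ (hsub _ ho) (by dsimp only; omega)
          dsimp only at this; omega
        · rcases hb with hb | hb | hb | hb
          · have := hb (0, 0) (List.mem_cons_of_mem _ (hsub _ ho)); dsimp only at this; omega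
          · have := hb (p1, p2) (by simp); dsimp only at this; omega
          · have := hb (-1, a) (List.mem_cons_of_mem _ (hsub _ hma)); dsimp only at this; omega
          · have := hb (0, 0) (List.mem_cons_of_mem _ (hsub _ ho)); dsimp only at this; omega
      -- From the right, the step would start at `(0, y)`. This is the origin, or a node already
      -- visited by `hrow`, or a node strictly inside the bounding box.
      · exfalso
        have hml : m <:+ l := by
          rcases List.suffix_cons_iff.1 hs with rfl | hs
          · simp at hm; omega
          · exact hs
        have hpl := (List.nodup_cons.1 hl.nodup).1
        rw [show p1 = 0 by omega, ← he.2] at hpl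
        rcases h0.eq_or_lt with rfl | h0
        · exact hpl (hml.subset ho)
        · rcases hb' with hb | hb | hb | hb
          · refine hpl (hml.subset (hrow (fun q hq => ?_) y h0 hlt))
            have := hb q (hsub q hq); omega
          · have := hb (-1, a) (hsub _ hma); dsimp only at this; omega
          · have := hb (-1, a) (hsub _ hma); dsimp only at this; omega
          · have := hb (0, 0) (hsub _ ho); dsimp only at this; omega
      -- From below, the step would head for `(-1, a)`.
      · exfalso
        have := hd _ (hsub _ hma) (by dsimp only; omega)
        dsimp only at this; omega
      · rw [Prod.mk.injEq]; omega
    subst key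
    rw [ih (y + 1) rfl (by omega) (by omega) hs]
    have := vgo_sub_one hm (y := y + 1) (by dsimp only; omega)
    rw [add_sub_cancel_right] at this
    exact this.symm

/-- Of the three forms only the top row can end at a node `(0, y)` with `y` positive: on the right
side this needs width one, hence the unit square and `y = 0`, and the bottom side is never above the
origin. -/
theorem exists_loop_of_top_exit {l t : List (ℤ × ℤ)} {y : ℤ} (h : PrudentPath l)
    (hl : l.head? = some (-1, 0)) (hy : 0 < y) (hs : (-1, y) :: (0, y) :: t <:+ l)
    (ht : PrudentPath ((-1, y) :: (0, y) :: t)) (hpos : ∀ q ∈ (0, y) :: t, 0 ≤ q.1) :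
    ∃ c : Code, c.Valid ∧ l = c.loop := by
  rcases ht.2.halfPlaneForm hpos with
    ⟨c, k, hc, h1, h2, e⟩ | ⟨c, z, hc, hX, h1, h2, e⟩ | ⟨c, x, hc, hZ, h1, h2, e⟩
  · have hi := hc.rInv
    have hv : (row c k).Valid := ⟨hc, h1, by omega⟩
    have hh := hv.rInv.head
    rw [← e] at hh
    simp only [List.head?_cons, Option.some.injEq, Prod.mk.injEq, hx, Code.hy] at hh
    -- The end of the top row is in column 0, so the exit is one more step of the leftward run in
    -- that row.
    obtain rfl : k = 1 := by omega
    refine ⟨c, hc, ?_⟩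
    have hm : (-1, y) :: (0, y) :: t = hgo (-1) (vgo c.tp c.rpath) := by
      rw [e, rpath_row, hh.2]
      exact (hgo_sub_one hi.head_up (x := 0) hi.hx_hy.1).symm
    refine eq_vgo_of_suffix (m := hgo (-1) (vgo c.tp c.rpath)) (a := y) (by rw [← hm]; rfl) ?_ ?_ h
      0 hl le_rfl hy.le (hm ▸ hs)
    · exact (mem_hgo hi.head_up _ _).2 (Or.inl ((hi.mem_up _).2 (Or.inl hi.path.origin_mem)))
    · intro hneg z hz0 hz1
      obtain ⟨x, hx⟩ := hi.hit_row z (by have := hi.bt_nonpos; omega) (by omega)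
      have hx' : (x, z) ∈ hgo (-1) (vgo c.tp c.rpath) :=
        (mem_hgo hi.head_up _ _).2 (Or.inl ((hi.mem_up _).2 (Or.inl hx)))
      have h1 := hneg _ hx'
      have h2 := hi.box _ hx
      dsimp only at h1 h2
      rwa [show x = 0 by omega] at hx'
  · exfalso
    have hi := hc.rInv
    have hh := head_vgo hi.head z
    rw [← e] at hh
    simp only [List.head?_cons, Option.some.injEq, Prod.mk.injEq] at hh
    have hw := (hi.right hX).1
    have hw1 : c.wd = 1 := by omega
    have : c = Code.sq := by
      cases c with
      | sq => rfl
      | row c k =>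
        have := hc.1.one_le_wd
        simp only [isX] at hX
        simp only [wd] at hw1
        omega
      | col c k =>
        have := hc.1.one_le_wd
        simp only [wd] at hw1
        omega
      | bot c k =>
        have := hc.2.2
        simp only [wd] at hw1
        omega
    subst this
    simp only [tp] at h2
    omega
  · exfalso
    have hi := hc.bInv hZ
    have hh := head_hgo hi.head x
    rw [← e] at hh
    simp only [List.head?_cons, Option.some.injEq, Prod.mk.injEq] at hh
    have := hc.rInv.bt_nonpos
    omega

/-- The prudent paths that end at `(-1, 0)` are the closed walks of the codes and their mirror
images. -/
theorem PrudentPath.exists_loop {l : List (ℤ × ℤ)} (h : PrudentPath l)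
    (hl : l.head? = some (-1, 0)) (hlen : 2 < l.length) :
    ∃ c : Code, c.Valid ∧ (l = c.loop ∨ l = c.loop.map PrudentPolygon.flip) := by
  rcases h.exists_exit with hpos | ⟨y, t, hs, ht, hpos⟩
  · have := hpos _ (List.mem_of_mem_head? hl)
    simp at this
  -- An exit below the origin is reflected to one above it. An exit at height 0 means that the path
  -- consists of its first step, and a longer one would visit `(-1, 0)` twice.
  rcases lt_trichotomy y 0 with hy | rfl | hy
  · obtain ⟨c, hc, e⟩ := exists_loop_of_top_exit (l := l.map PrudentPolygon.flip)
      (t := t.map PrudentPolygon.flip) (y := -y) h.flip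
      (by rw [List.head?_map, hl]; rfl) (by omega)
      (by simpa [PrudentPolygon.flip] using hs.map PrudentPolygon.flip)
      (by simpa [PrudentPolygon.flip] using ht.flip)
      (by
        have : ∀ q ∈ ((0, y) :: t).map PrudentPolygon.flip, 0 ≤ q.1 := by
          rw [List.forall_mem_map]; exact hpos
        simpa [PrudentPolygon.flip] using this)
    refine ⟨c, hc, Or.inr ?_⟩
    rw [← e, List.map_map]
    conv_lhs => rw [← List.map_id l]
    congr 1
    funext q
    simp [PrudentPolygon.flip]
  · exfalso
    have ht0 : t = [] := by
      by_contra hne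
      exact ht.2.origin_not_mem hne rfl
    subst ht0
    obtain ⟨m, rfl⟩ := hs
    cases m with
    | nil => simp at hlen
    | cons a m =>
      have := h.nodup
      obtain rfl : a = (-1, 0) := by simpa using hl
      simp at this
  · obtain ⟨c, hc, e⟩ := exists_loop_of_top_exit h hl hy hs ht hpos
    exact ⟨c, hc, Or.inl e⟩

/-! ### The cells of the polygon of a code -/

namespace Code

@[simp] theorem hx_sq : sq.hx = 0 := rfl
@[simp] theorem hx_row (c : Code) (k : ℕ) : (row c k).hx = k - 1 := rfl
@[simp] theorem hx_col (c : Code) (k : ℕ) : (col c k).hx = c.wd := rfl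
@[simp] theorem hx_bot (c : Code) (k : ℕ) : (bot c k).hx = c.wd - 1 := rfl
@[simp] theorem hy_sq : sq.hy = 0 := rfl
@[simp] theorem hy_row (c : Code) (k : ℕ) : (row c k).hy = c.tp := rfl
@[simp] theorem hy_col (c : Code) (k : ℕ) : (col c k).hy = c.tp - k := rfl
@[simp] theorem hy_bot (c : Code) (k : ℕ) : (bot c k).hy = c.bt - 1 := rfl
@[simp] theorem bx_col (c : Code) (k : ℕ) : (col c k).bx = c.wd - 1 := rfl
@[simp] theorem bx_bot (c : Code) (k : ℕ) : (bot c k).bx = c.wd - 1 - k := rfl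
@[simp] theorem isX_row (c : Code) (k : ℕ) : (row c k).isX ↔ k ≤ c.wd := Iff.rfl
@[simp] theorem isZ_col (c : Code) (k : ℕ) : (col c k).isZ ↔ c.ht < k := Iff.rfl

/-- The cells of the polygon. -/
def cellSet : Code → Set (ℤ × ℤ)
  | sq => {(-1, 0)}
  | row c k => c.cellSet ∪ {q | q.2 = c.tp ∧ -1 ≤ q.1 ∧ q.1 < k - 1}
  | col c k => c.cellSet ∪ {q | q.1 = c.wd - 1 ∧ c.tp - k ≤ q.2 ∧ q.2 < c.tp}
  | bot c k => c.cellSet ∪ {q | q.2 = c.bt - 1 ∧ c.wd - 1 - k ≤ q.1 ∧ q.1 < c.wd - 1}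

theorem mem_cellSet_sq (q : ℤ × ℤ) : q ∈ sq.cellSet ↔ q.1 = -1 ∧ q.2 = 0 := by
  simp [cellSet, Prod.ext_iff]

theorem mem_cellSet_row (c : Code) (k : ℕ) (q : ℤ × ℤ) : q ∈ (row c k).cellSet ↔
    q ∈ c.cellSet ∨ q.2 = c.tp ∧ -1 ≤ q.1 ∧ q.1 < k - 1 := Iff.rfl

theorem mem_cellSet_col (c : Code) (k : ℕ) (q : ℤ × ℤ) : q ∈ (col c k).cellSet ↔
    q ∈ c.cellSet ∨ q.1 = c.wd - 1 ∧ c.tp - k ≤ q.2 ∧ q.2 < c.tp := Iff.rfl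

theorem mem_cellSet_bot (c : Code) (k : ℕ) (q : ℤ × ℤ) : q ∈ (bot c k).cellSet ↔
    q ∈ c.cellSet ∨ q.2 = c.bt - 1 ∧ c.wd - 1 - k ≤ q.1 ∧ q.1 < c.wd - 1 := Iff.rfl

theorem bt_row (c : Code) (k : ℕ) : (row c k).bt = c.bt := by
  simp only [bt, tp, ht]; push_cast; ring

theorem bt_bot (c : Code) (k : ℕ) : (bot c k).bt = c.bt - 1 := by
  simp only [bt, tp, ht]; push_cast; ring

theorem bt_col (c : Code) (k : ℕ) : (col c k).bt = c.tp - max (c.ht : ℤ) k := by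
  simp [bt, tp, ht]

theorem Valid.cellSet_box : ∀ {c : Code}, c.Valid → ∀ q ∈ c.cellSet,
    -1 ≤ q.1 ∧ q.1 ≤ c.wd - 2 ∧ c.bt ≤ q.2 ∧ q.2 ≤ c.tp - 1
  | sq, _, q, hq => by
    rw [mem_cellSet_sq] at hq
    simp only [wd, bt, tp, ht]; push_cast; omega
  | row c k, h, q, hq => by
    have hb := h.1.cellSet_box q
    have := h.1.one_le_ht
    have hbt : c.bt = c.tp - c.ht := rfl
    rw [bt_row]
    simp only [wd, tp]; push_cast
    rcases hq with hq | ⟨h1, h2, h3⟩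
    · have := hb hq; omega
    · omega
  | col c k, h, q, hq => by
    have hb := h.1.cellSet_box q
    have := h.1.one_le_ht
    have := h.1.one_le_wd
    have hbt : c.bt = c.tp - c.ht := rfl
    rw [bt_col]
    simp only [wd, tp]; push_cast
    rcases hq with hq | ⟨h1, h2, h3⟩
    · have := hb hq; omega
    · omega
  | bot c k, h, q, hq => by
    have hb := h.1.cellSet_box q
    have := h.1.one_le_ht
    have hbt : c.bt = c.tp - c.ht := rfl
    rw [bt_bot]
    simp only [wd, tp]
    rcases hq with hq | ⟨h1, h2, h3⟩
    · have := hb hq; omega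
    · have := h.2.2; omega

/-- The top row, the right column, the bottom row and the left column of a polygon. -/
theorem Valid.cellSet_border : ∀ {c : Code}, c.Valid →
    (∀ x, -1 ≤ x → x < c.hx → (x, c.tp - 1) ∈ c.cellSet) ∧
    (¬ c.isX → ∀ y, c.hy ≤ y → y < c.tp → ((c.wd : ℤ) - 2, y) ∈ c.cellSet) ∧
    (c.isZ → ∀ x, c.bx ≤ x → x ≤ c.wd - 2 → (x, c.bt) ∈ c.cellSet) ∧
    (∀ y, 0 ≤ y → y < c.tp → (-1, y) ∈ c.cellSet)
  | sq, _ => by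
    refine ⟨fun x h1 h2 => ?_, fun _ y h1 h2 => ?_, fun h => h.elim, fun y h1 h2 => ?_⟩ <;>
    · rw [mem_cellSet_sq]
      simp [wd, tp] at *; omega
  | row c k, h => by
    obtain ⟨i1, i2, i3, i4⟩ := h.1.cellSet_border
    refine ⟨fun x h1 h2 => ?_, fun hX y h1 h2 => ?_, fun h => h.elim, fun y h1 h2 => ?_⟩
    · simp only [mem_cellSet_row, hx_row, tp] at *
      right; omega
    · have := h.2
      simp only [mem_cellSet_row, hy_row, tp, isX_row, wd] at *
      right; push_cast; omega
    · have := h.2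
      simp only [mem_cellSet_row, tp] at *
      by_cases hy : y < c.tp
      · exact Or.inl (i4 y h1 hy)
      · right; omega
  | col c k, h => by
    obtain ⟨i1, i2, i3, i4⟩ := h.1.cellSet_border
    have hr := (h.1.rInv.right h.2.1).1
    refine ⟨fun x h1 h2 => ?_, fun hX y h1 h2 => ?_, fun hZ x h1 h2 => ?_,
      fun y h1 h2 => Or.inl (i4 y h1 h2)⟩
    · have := h.2.2
      simp only [mem_cellSet_col, hx_col, tp] at *
      by_cases hx : x < c.wd - 1
      · exact Or.inl (i1 x h1 (by omega))
      · right; omega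
    · simp only [mem_cellSet_col, hy_col, tp, wd] at *
      right; push_cast; omega
    · have := h.2.2
      rw [bt_col]
      simp only [mem_cellSet_col, bx_col, isZ_col, wd] at *
      right; push_cast at *; omega
  | bot c k, h => by
    obtain ⟨i1, i2, i3, i4⟩ := h.1.cellSet_border
    have hX := not_isX_of_isZ h.2.1
    have hr := (h.1.rInv.right hX).1
    have hb := (h.1.bInv h.2.1).hy_eq
    refine ⟨fun x h1 h2 => ?_, fun _ y h1 h2 => ?_, fun _ x h1 h2 => ?_,
      fun y h1 h2 => Or.inl (i4 y h1 h2)⟩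
    · simp only [mem_cellSet_bot, hx_bot, tp] at *
      exact Or.inl (i1 x h1 (by omega))
    · have := h.2.2
      simp only [mem_cellSet_bot, hy_bot, tp, wd] at *
      by_cases hy : c.bt ≤ y
      · exact Or.inl (i2 hX y (by omega) h2)
      · right; omega
    · rw [bt_bot]
      simp only [mem_cellSet_bot, bx_bot, wd, true_and] at *
      right; omega

theorem Valid.top_row {c : Code} (h : c.Valid) (hX : ¬ c.isX) {x : ℤ} (h1 : -1 ≤ x)
    (h2 : x ≤ c.wd - 2) : (x, c.tp - 1) ∈ c.cellSet :=
  h.cellSet_border.1 x h1 (by have := (h.rInv.right hX).1; omega)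

theorem Valid.corner {c : Code} (h : c.Valid) : (-1, c.tp - 1) ∈ c.cellSet :=
  h.cellSet_border.2.2.2 _ (by have := h.rInv.bt_nonpos; omega) (by omega)

/-- Right columns and bottom rows never reach the left column. This is what tells a polygon from its
mirror image. -/
theorem Valid.left_column : ∀ {c : Code}, c.Valid → ∀ q ∈ c.cellSet, q.1 = -1 → 0 ≤ q.2
  | sq, _, q, hq, _ => by rw [mem_cellSet_sq] at hq; omega
  | row c k, h, q, hq, h1 => by
    rcases hq with hq | hq
    · exact h.1.left_column q hq h1
    · have := h.1.rInv.bt_nonpos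
      have := hq.1; omega
  | col c k, h, q, hq, h1 => by
    rcases hq with hq | hq
    · exact h.1.left_column q hq h1
    · have := h.1.one_le_wd
      have := hq.1; omega
  | bot c k, h, q, hq, h1 => by
    rcases hq with hq | hq
    · exact h.1.left_column q hq h1
    · have := h.2.2
      have := hq.2; omega

/-! ### The enclosed cells -/

theorem RInv.crossings_loop {c : Code} (h : c.RInv) (q : ℤ × ℤ) : crossings c.loop q =
    crossings c.rpath q + (if q.1 < c.hx ∧ c.hy ≤ q.2 ∧ q.2 < c.tp then 1 else 0) +
      (if q.1 < -1 ∧ 0 ≤ q.2 ∧ q.2 < c.tp then 1 else 0) := by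
  have hp := h.hx_hy
  have ht := h.bt_nonpos
  rw [loop, crossings_vgo h.head_left, crossings_hgo h.head_up, crossings_vgo h.head]
  dsimp only
  split_ifs <;> omega

theorem odd_add_ite (n : ℕ) (P : Prop) [Decidable P] :
    Odd (n + if P then 1 else 0) ↔ (Odd n ↔ ¬ P) := by
  split_ifs with h <;> simp [h, Nat.odd_add_one]

/-- The loops of a code and of its predecessor share an initial path and differ by the boundary of
the added strip, so the parity changes exactly on that strip. -/
theorem Valid.odd_crossings : ∀ {c : Code}, c.Valid → ∀ q : ℤ × ℤ,
    Odd (crossings c.loop q) ↔ q ∈ c.cellSet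
  | sq, h, q => by
    rw [h.rInv.crossings_loop, mem_cellSet_sq]
    simp only [rpath_sq, crossings, pathEdges, hx_sq, hy_sq, tp, List.countP_nil]
    grind
  | row c k, h, q => by
    have ih := h.1.odd_crossings q
    have hi := h.1.rInv
    have hb := h.1.cellSet_box q
    have hp := hi.hx_hy
    have ht := hi.bt_nonpos
    have h1 := h.2
    rw [hi.crossings_loop] at ih
    rw [h.rInv.crossings_loop, rpath_row, crossings_hgo hi.head_up, crossings_vgo hi.head,
      mem_cellSet_row]
    simp only [odd_add_ite, hx_row, hy_row, tp] at ih ⊢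
    by_cases hO : Odd (crossings c.rpath q) <;> by_cases hq : q ∈ c.cellSet <;>
      simp only [hO, hq, true_iff, false_iff, iff_true, iff_false, true_or, false_or,
        forall_const] at ih hb ⊢ <;> grind
  | col c k, h, q => by
    have ih := h.1.odd_crossings q
    have hi := h.1.rInv
    have hb := h.1.cellSet_box q
    have hp := hi.hx_hy
    have ht := hi.bt_nonpos
    have h1 := h.2
    have h2 := h.1.one_le_wd
    have h3 := (hi.right h.2.1).1
    have hbh : (col c k).bpath.head? = some (c.hx, c.tp - k) := head_vgo hi.head _
    rw [hi.crossings_loop] at ih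
    rw [h.rInv.crossings_loop, rpath_col, crossings_hgo hbh, bpath_col, crossings_vgo hi.head,
      mem_cellSet_col]
    simp only [odd_add_ite, hx_col, hy_col, tp] at ih ⊢
    by_cases hO : Odd (crossings c.rpath q) <;> by_cases hq : q ∈ c.cellSet <;>
      simp only [hO, hq, true_iff, false_iff, iff_true, iff_false, true_or, false_or,
        forall_const] at ih hb ⊢ <;> grind
  | bot c k, h, q => by
    have ih := h.1.odd_crossings q
    have hi := h.1.rInv
    have hj := h.1.bInv h.2.1
    have hb := h.1.cellSet_box q
    have hp := hi.hx_hy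
    have ht := hi.bt_nonpos
    have h1 := h.2.2
    have h2 := h.1.one_le_wd
    have h3 := (hi.right (not_isX_of_isZ h.2.1)).1
    have h4 := hj.hy_eq
    have h5 := (h.bInv trivial).head
    rw [hi.crossings_loop, hj.rpath_eq, crossings_hgo hj.head] at ih
    rw [h.rInv.crossings_loop, rpath_bot, crossings_hgo h5, bpath_bot,
      crossings_vgo (head_hgo hj.head _), crossings_hgo hj.head, mem_cellSet_bot]
    simp only [odd_add_ite, hx_bot, hy_bot, tp] at ih ⊢
    by_cases hO : Odd (crossings c.bpath q) <;> by_cases hq : q ∈ c.cellSet <;>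
      simp only [hO, hq, true_iff, false_iff, iff_true, iff_false, true_or, false_or,
        forall_const] at ih hb ⊢ <;> grind

end Code

/-! ### Orientation -/

theorem leftCell_right (t y : ℤ) : leftCell (t, y) (t + 1, y) = (t, y) := by
  simp [leftCell]

theorem leftCell_left (t y : ℤ) : leftCell (t + 1, y) (t, y) = (t, y - 1) := by
  have h1 : t ≠ t + 1 + 1 := by omega
  simp [leftCell, h1, sub_eq_add_neg]

theorem leftCell_up (x t : ℤ) : leftCell (x, t) (x, t + 1) = (x - 1, t) := by
  simp [leftCell, sub_eq_add_neg]

theorem leftCell_down (x t : ℤ) : leftCell (x, t + 1) (x, t) = (x, t) := by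
  have h1 : t ≠ t + 1 + 1 := by omega
  simp [leftCell, h1]

namespace Code

theorem Valid.leftCell_up {c : Code} (h : c.Valid)
    (ih : ∀ e ∈ pathEdges c.rpath, leftCell e.1 e.2 ∈ c.cellSet) :
    ∀ e ∈ pathEdges (vgo c.tp c.rpath), leftCell e.1 e.2 ∈ c.cellSet := by
  intro e he
  have hi := h.rInv
  have hp := hi.hx_hy
  obtain ⟨b1, b2, -, -⟩ := h.cellSet_border
  rcases mem_pathEdges_vgo hi.head _ e he with he | ⟨t, h1, h2, rfl⟩ | ⟨t, h1, h2, rfl⟩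
  · exact ih e he
  · rw [PrudentPolygon.leftCell_up]
    dsimp only at h1 h2 ⊢
    by_cases hX : c.isX
    · have := hi.top hX
      rw [show t = c.tp - 1 by omega]
      exact b1 _ (by omega) (by omega)
    · have := b2 hX t h1 h2
      rwa [show c.hx - 1 = c.wd - 2 by have := (hi.right hX).1; omega]
  · dsimp only at h2; omega

/-- Each new edge has on its left either a cell of the new strip or a cell of the old border, known
from `cellSet_border`. -/
theorem Valid.leftCell_paths : ∀ {c : Code}, c.Valid →
    (∀ e ∈ pathEdges c.rpath, leftCell e.1 e.2 ∈ c.cellSet) ∧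
    (c.isZ → ∀ e ∈ pathEdges c.bpath, leftCell e.1 e.2 ∈ c.cellSet)
  | sq, _ => ⟨by simp [rpath_sq, pathEdges], fun h => h.elim⟩
  | row c k, h => by
    refine ⟨fun e he => ?_, fun h => h.elim⟩
    have hi := h.1.rInv
    rw [rpath_row] at he
    rcases mem_pathEdges_hgo hi.head_up _ e he with he | ⟨t, h1, h2, rfl⟩ | ⟨t, h1, h2, rfl⟩
    · exact Or.inl (h.1.leftCell_up h.1.leftCell_paths.1 e he)
    · rw [leftCell_right]
      have := hi.hx_hy
      exact Or.inr ⟨rfl, by dsimp only at *; omega, by dsimp only; omega⟩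
    · rw [leftCell_left]
      have := h.2
      exact Or.inl (h.1.cellSet_border.1 t (by omega) h2)
  | col c k, h => by
    have hi := h.1.rInv
    have hp := hi.hx_hy
    have h3 := (hi.right h.2.1).1
    have hk := h.2.2
    have hbh : (col c k).bpath.head? = some (c.hx, c.tp - k) := head_vgo hi.head _
    have hb : ∀ e ∈ pathEdges (col c k).bpath, leftCell e.1 e.2 ∈ (col c k).cellSet := by
      intro e he
      rcases mem_pathEdges_vgo hi.head _ e he with he | ⟨t, h1, h2, rfl⟩ | ⟨t, h1, h2, rfl⟩
      · exact Or.inl (h.1.leftCell_paths.1 e he)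
      · rw [PrudentPolygon.leftCell_up]
        have := h.1.cellSet_border.2.1 h.2.1 t h1 (by omega)
        exact Or.inl (by rwa [show c.hx - 1 = c.wd - 2 by omega])
      · rw [leftCell_down]
        exact Or.inr (by simp only [Set.mem_ofPred_eq] at *; omega)
    refine ⟨fun e he => ?_, fun _ => hb⟩
    rw [rpath_col] at he
    rcases mem_pathEdges_hgo hbh _ e he with he | ⟨t, h1, h2, rfl⟩ | ⟨t, h1, h2, rfl⟩
    · exact hb e he
    · rw [leftCell_right]
      exact Or.inr (by simp only [Set.mem_ofPred_eq] at *; omega)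
    · dsimp only at *; omega
  | bot c k, h => by
    have hj := h.1.bInv h.2.1
    have hk := h.2.2
    have hp := hj.box _ hj.mem
    dsimp only at hp
    have hv : (bot c k).Valid := h
    have hbh := (hv.bInv trivial).head
    have hb : ∀ e ∈ pathEdges (bot c k).bpath, leftCell e.1 e.2 ∈ (bot c k).cellSet := by
      intro e he
      rcases mem_pathEdges_vgo (head_hgo hj.head _) _ e he with he | ⟨t, h1, h2, rfl⟩ |
        ⟨t, h1, h2, rfl⟩
      · rcases mem_pathEdges_hgo hj.head _ e he with he | ⟨t, h1, h2, rfl⟩ | ⟨t, h1, h2, rfl⟩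
        · exact Or.inl (h.1.leftCell_paths.2 h.2.1 e he)
        · rw [leftCell_right]
          exact Or.inl (h.1.cellSet_border.2.2.1 h.2.1 t h1 (by omega))
        · rw [leftCell_left]
          exact Or.inr (by simp only [Set.mem_ofPred_eq, true_and] at *; omega)
      · dsimp only at *; omega
      · rw [leftCell_down]
        exact Or.inr (by simp only [Set.mem_ofPred_eq] at *; omega)
    refine ⟨fun e he => ?_, fun _ => hb⟩
    rw [rpath_bot] at he
    rcases mem_pathEdges_hgo hbh _ e he with he | ⟨t, h1, h2, rfl⟩ | ⟨t, h1, h2, rfl⟩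
    · exact hb e he
    · rw [leftCell_right, bt_bot]
      simp only [bx_bot] at h1
      exact Or.inr (by simp only [Set.mem_ofPred_eq, true_and] at *; omega)
    · simp only [bx_bot] at h2; omega

theorem Valid.leftCell_loop {c : Code} (h : c.Valid) :
    ∀ e ∈ pathEdges c.loop, leftCell e.1 e.2 ∈ c.cellSet := by
  intro e he
  have hi := h.rInv
  have hp := hi.hx_hy
  have ht := hi.bt_nonpos
  rcases mem_pathEdges_vgo hi.head_left _ e he with he | ⟨t, h1, h2, rfl⟩ | ⟨t, h1, h2, rfl⟩
  · rcases mem_pathEdges_hgo hi.head_up _ e he with he | ⟨t, h1, h2, rfl⟩ | ⟨t, h1, h2, rfl⟩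
    · exact h.leftCell_up h.leftCell_paths.1 e he
    · dsimp only at *; omega
    · rw [leftCell_left]
      exact h.cellSet_border.1 t h1 h2
  · dsimp only at *; omega
  · rw [leftCell_down]
    exact h.cellSet_border.2.2.2 t h1 h2

end Code

/-! ### Bounding boxes and connectedness of sets of cells -/

theorem width_eq {S : Set (ℤ × ℤ)} {a b : ℤ} (h : ∀ q ∈ S, a ≤ q.1 ∧ q.1 ≤ b)
    (ha : ∃ q ∈ S, q.1 = a) (hb : ∃ q ∈ S, q.1 = b) : width S = (b + 1 - a).toNat := by
  have : {x : ℤ | ∃ c ∈ S, ∃ d ∈ S, c.1 ≤ x ∧ x ≤ d.1} = Finset.Icc a b := by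
    ext x
    simp only [Set.mem_ofPred_eq, Finset.coe_Icc, Set.mem_Icc]
    constructor
    · rintro ⟨c, hc, d, hd, h1, h2⟩
      have := h c hc; have := h d hd; omega
    · obtain ⟨p, hp, hp'⟩ := ha
      obtain ⟨r, hr, hr'⟩ := hb
      exact fun hx => ⟨p, hp, r, hr, by omega, by omega⟩
  rw [width, this, Set.ncard_coe_finset, Int.card_Icc]

theorem height_eq {S : Set (ℤ × ℤ)} {a b : ℤ} (h : ∀ q ∈ S, a ≤ q.2 ∧ q.2 ≤ b)
    (ha : ∃ q ∈ S, q.2 = a) (hb : ∃ q ∈ S, q.2 = b) : height S = (b + 1 - a).toNat := by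
  have : {x : ℤ | ∃ c ∈ S, ∃ d ∈ S, c.2 ≤ x ∧ x ≤ d.2} = Finset.Icc a b := by
    ext x
    simp only [Set.mem_ofPred_eq, Finset.coe_Icc, Set.mem_Icc]
    constructor
    · rintro ⟨c, hc, d, hd, h1, h2⟩
      have := h c hc; have := h d hd; omega
    · obtain ⟨p, hp, hp'⟩ := ha
      obtain ⟨r, hr, hr'⟩ := hb
      exact fun hx => ⟨p, hp, r, hr, by omega, by omega⟩
  rw [height, this, Set.ncard_coe_finset, Int.card_Icc]

/-- A set of cells in the columns from `a` to `b` that has the full width meets both extreme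
columns. -/
theorem exists_of_width_eq {S : Set (ℤ × ℤ)} {a b : ℤ} (h : ∀ q ∈ S, a ≤ q.1 ∧ q.1 ≤ b)
    (hab : a ≤ b) (hw : width S = (b + 1 - a).toNat) :
    (∃ q ∈ S, q.1 = a) ∧ ∃ q ∈ S, q.1 = b := by
  have hsub : {x : ℤ | ∃ c ∈ S, ∃ d ∈ S, c.1 ≤ x ∧ x ≤ d.1} ⊆ Finset.Icc a b := by
    rintro x ⟨c, hc, d, hd, h1, h2⟩
    have := h c hc; have := h d hd
    simp; omega
  have heq := Set.eq_of_subset_of_ncard_le hsub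
    (by rw [Set.ncard_coe_finset, Int.card_Icc]; exact hw.ge)
  have m1 : a ∈ {x : ℤ | ∃ c ∈ S, ∃ d ∈ S, c.1 ≤ x ∧ x ≤ d.1} := by rw [heq]; simp; omega
  have m2 : b ∈ {x : ℤ | ∃ c ∈ S, ∃ d ∈ S, c.1 ≤ x ∧ x ≤ d.1} := by rw [heq]; simp; omega
  obtain ⟨c, hc, -, -, h1, -⟩ := m1
  obtain ⟨-, -, d, hd, -, h2⟩ := m2
  exact ⟨⟨c, hc, le_antisymm h1 (h c hc).1⟩, d, hd, le_antisymm (h d hd).2 h2⟩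

theorem exists_of_height_eq {S : Set (ℤ × ℤ)} {a b : ℤ} (h : ∀ q ∈ S, a ≤ q.2 ∧ q.2 ≤ b)
    (hab : a ≤ b) (hw : height S = (b + 1 - a).toNat) :
    (∃ q ∈ S, q.2 = a) ∧ ∃ q ∈ S, q.2 = b := by
  have hsub : {x : ℤ | ∃ c ∈ S, ∃ d ∈ S, c.2 ≤ x ∧ x ≤ d.2} ⊆ Finset.Icc a b := by
    rintro x ⟨c, hc, d, hd, h1, h2⟩
    have := h c hc; have := h d hd
    simp; omega
  have heq := Set.eq_of_subset_of_ncard_le hsub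
    (by rw [Set.ncard_coe_finset, Int.card_Icc]; exact hw.ge)
  have m1 : a ∈ {x : ℤ | ∃ c ∈ S, ∃ d ∈ S, c.2 ≤ x ∧ x ≤ d.2} := by rw [heq]; simp; omega
  have m2 : b ∈ {x : ℤ | ∃ c ∈ S, ∃ d ∈ S, c.2 ≤ x ∧ x ≤ d.2} := by rw [heq]; simp; omega
  obtain ⟨c, hc, -, -, h1, -⟩ := m1
  obtain ⟨-, -, d, hd, -, h2⟩ := m2
  exact ⟨⟨c, hc, le_antisymm h1 (h c hc).1⟩, d, hd, le_antisymm (h d hd).2 h2⟩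

theorem IsOnePiece.insert {S : Set (ℤ × ℤ)} (hS : IsOnePiece S) {s t : ℤ × ℤ} (hs : s ∈ S)
    (hst : |t.1 - s.1| + |t.2 - s.2| = 1) : IsOnePiece (Insert.insert t S) := by
  have mono : ∀ c ∈ S, ∀ d ∈ S, Relation.ReflTransGen
      (fun c d => d ∈ Insert.insert t S ∧ |d.1 - c.1| + |d.2 - c.2| = 1) c d := fun c hc d hd =>
    Relation.ReflTransGen.mono (r := fun c d => d ∈ S ∧ |d.1 - c.1| + |d.2 - c.2| = 1)
      (fun _ _ h => ⟨Or.inr h.1, h.2⟩) _ _ (hS c hc d hd)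
  have hts : |s.1 - t.1| + |s.2 - t.2| = 1 := by rw [abs_sub_comm, abs_sub_comm s.2]; exact hst
  rintro c (rfl | hc) d (rfl | hd)
  · exact .refl
  · exact .head ⟨Or.inr hs, hts⟩ (mono s hs d hd)
  · exact .tail (mono c hc s hs) ⟨Or.inl rfl, hst⟩
  · exact mono c hc d hd

/-- A chain in `S` that starts in `A` can never leave `A`. -/
theorem not_isOnePiece {S A : Set (ℤ × ℤ)} {c d : ℤ × ℤ} (hc : c ∈ S) (hcA : c ∈ A) (hd : d ∈ S)
    (hdA : d ∉ A) (h : ∀ p ∈ A, ∀ q ∈ S, |q.1 - p.1| + |q.2 - p.2| = 1 → q ∈ A) :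
    ¬ IsOnePiece S := by
  intro hS
  have key : ∀ e, Relation.ReflTransGen
      (fun c d => d ∈ S ∧ |d.1 - c.1| + |d.2 - c.2| = 1) c e → e ∈ A := by
    intro e he
    induction he with
    | refl => exact hcA
    | tail _ h' ih => exact h _ ih _ h'.1 h'.2
  exact hdA (key d (hS c hc d hd))

/-! ### Connectedness, area and bounding box of the polygon of a code -/

namespace Code

theorem cellSet_row_zero (c : Code) : (row c 0).cellSet = c.cellSet := by
  ext q
  rw [mem_cellSet_row]
  constructor
  · rintro (h | h)
    · exact h
    · omega
  · exact Or.inl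

theorem cellSet_row_succ (c : Code) (k : ℕ) :
    (row c (k + 1)).cellSet = insert ((k : ℤ) - 1, c.tp) (row c k).cellSet := by
  ext q
  rw [Set.mem_insert_iff, mem_cellSet_row, mem_cellSet_row, Prod.ext_iff]
  by_cases hq : q ∈ c.cellSet
  · simp [hq]
  · simp only [hq, false_or]; push_cast; omega

theorem cellSet_col_zero (c : Code) : (col c 0).cellSet = c.cellSet := by
  ext q
  rw [mem_cellSet_col]
  constructor
  · rintro (h | h)
    · exact h
    · omega
  · exact Or.inl

theorem cellSet_col_succ (c : Code) (k : ℕ) :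
    (col c (k + 1)).cellSet = insert ((c.wd : ℤ) - 1, c.tp - k - 1) (col c k).cellSet := by
  ext q
  rw [Set.mem_insert_iff, mem_cellSet_col, mem_cellSet_col, Prod.ext_iff]
  by_cases hq : q ∈ c.cellSet
  · simp [hq]
  · simp only [hq, false_or]; push_cast; omega

theorem cellSet_bot_zero (c : Code) : (bot c 0).cellSet = c.cellSet := by
  ext q
  rw [mem_cellSet_bot]
  constructor
  · rintro (h | h)
    · exact h
    · omega
  · exact Or.inl

theorem cellSet_bot_succ (c : Code) (k : ℕ) :
    (bot c (k + 1)).cellSet = insert ((c.wd : ℤ) - 2 - k, c.bt - 1) (bot c k).cellSet := by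
  ext q
  rw [Set.mem_insert_iff, mem_cellSet_bot, mem_cellSet_bot, Prod.ext_iff]
  by_cases hq : q ∈ c.cellSet
  · simp [hq]
  · simp only [hq, false_or]; push_cast; omega

theorem Valid.isOnePiece : ∀ {c : Code}, c.Valid → IsOnePiece c.cellSet
  | sq, _ => by
    rintro c rfl d rfl
    exact .refl
  | row c k, h => by
    have key : ∀ k, IsOnePiece (row c k).cellSet := by
      intro k
      induction k with
      | zero => rw [cellSet_row_zero]; exact h.1.isOnePiece
      | succ k ih =>
        rw [cellSet_row_succ]
        rcases k.eq_zero_or_pos with rfl | hk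
        · exact ih.insert (s := (-1, c.tp - 1)) (Or.inl h.1.corner) (by simp)
        · exact ih.insert (s := ((k : ℤ) - 2, c.tp))
            (Or.inr (by simp only [Set.mem_ofPred_eq, true_and]; omega)) (by simp)
    exact key k
  | col c k, h => by
    have hw := h.1.one_le_wd
    have key : ∀ k, IsOnePiece (col c k).cellSet := by
      intro k
      induction k with
      | zero => rw [cellSet_col_zero]; exact h.1.isOnePiece
      | succ k ih =>
        rw [cellSet_col_succ]
        rcases k.eq_zero_or_pos with rfl | hk
        · exact ih.insert (s := ((c.wd : ℤ) - 2, c.tp - 1))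
            (Or.inl (h.1.top_row h.2.1 (by omega) le_rfl)) (by simp)
        · exact ih.insert (s := ((c.wd : ℤ) - 1, c.tp - k))
            (Or.inr (by simp only [Set.mem_ofPred_eq, true_and]; omega)) (by simp)
    exact key k
  | bot c k, h => by
    have hj := h.1.bInv h.2.1
    have hp := hj.box _ hj.mem
    dsimp only at hp
    have key : ∀ k, IsOnePiece (bot c k).cellSet := by
      intro k
      induction k with
      | zero => rw [cellSet_bot_zero]; exact h.1.isOnePiece
      | succ k ih =>
        rw [cellSet_bot_succ]
        rcases k.eq_zero_or_pos with rfl | hk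
        · exact ih.insert (s := ((c.wd : ℤ) - 2, c.bt))
            (Or.inl (h.1.cellSet_border.2.2.1 h.2.1 _ (by omega) le_rfl)) (by simp)
        · exact ih.insert (s := ((c.wd : ℤ) - 1 - k, c.bt - 1))
            (Or.inr (by simp only [Set.mem_ofPred_eq, true_and]; omega)) (by simp)
    exact key k

theorem Valid.ncard_cellSet : ∀ {c : Code}, c.Valid →
    c.cellSet.Finite ∧ c.cellSet.ncard = c.ar
  | sq, _ => by simp [cellSet, ar]
  | row c k, h => by
    have hb := h.1.cellSet_box
    have key : ∀ k, (row c k).cellSet.Finite ∧ (row c k).cellSet.ncard = c.ar + k := by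
      intro k
      induction k with
      | zero => rw [cellSet_row_zero]; exact h.1.ncard_cellSet
      | succ k ih =>
        rw [cellSet_row_succ]
        refine ⟨ih.1.insert _, ?_⟩
        rw [Set.ncard_insert_of_notMem _ ih.1, ih.2, add_assoc]
        rintro (h | h)
        · have := hb _ h; dsimp only at this; omega
        · have := h.2; dsimp only at this; omega
    exact key k
  | col c k, h => by
    have hb := h.1.cellSet_box
    have key : ∀ k, (col c k).cellSet.Finite ∧ (col c k).cellSet.ncard = c.ar + k := by
      intro k
      induction k with
      | zero => rw [cellSet_col_zero]; exact h.1.ncard_cellSet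
      | succ k ih =>
        rw [cellSet_col_succ]
        refine ⟨ih.1.insert _, ?_⟩
        rw [Set.ncard_insert_of_notMem _ ih.1, ih.2, add_assoc]
        rintro (h | h)
        · have := hb _ h; dsimp only at this; omega
        · have := h.2; dsimp only at this; omega
    exact key k
  | bot c k, h => by
    have hb := h.1.cellSet_box
    have key : ∀ k, (bot c k).cellSet.Finite ∧ (bot c k).cellSet.ncard = c.ar + k := by
      intro k
      induction k with
      | zero => rw [cellSet_bot_zero]; exact h.1.ncard_cellSet
      | succ k ih =>
        rw [cellSet_bot_succ]
        refine ⟨ih.1.insert _, ?_⟩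
        rw [Set.ncard_insert_of_notMem _ ih.1, ih.2, add_assoc]
        rintro (h | h)
        · have := hb _ h; dsimp only at this; omega
        · have := h.2; dsimp only at this; omega
    exact key k

theorem Valid.exists_right : ∀ {c : Code}, c.Valid → ∃ q ∈ c.cellSet, q.1 = c.wd - 2
  | sq, h => ⟨_, h.corner, by simp [wd]⟩
  | row c k, h => by
    have := h.2
    by_cases hk : k ≤ c.wd
    · obtain ⟨q, hq, hq1⟩ := h.1.exists_right
      refine ⟨q, Or.inl hq, ?_⟩
      rw [hq1, wd, max_eq_left hk]
    · refine ⟨((k : ℤ) - 2, c.tp), Or.inr (by simp only [Set.mem_ofPred_eq, true_and]; omega), ?_⟩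
      rw [wd, max_eq_right (by omega)]
  | col c k, h => by
    have := h.2.2
    refine ⟨((c.wd : ℤ) - 1, c.tp - 1),
      Or.inr (by simp only [Set.mem_ofPred_eq, true_and]; omega), ?_⟩
    simp only [wd]; push_cast; omega
  | bot c k, h => by
    obtain ⟨q, hq, hq1⟩ := h.1.exists_right
    exact ⟨q, Or.inl hq, hq1⟩

theorem Valid.exists_bottom : ∀ {c : Code}, c.Valid → ∃ q ∈ c.cellSet, q.2 = c.bt
  | sq, h => ⟨(-1, 0), rfl, by simp [bt, tp, ht]⟩
  | row c k, h => by
    obtain ⟨q, hq, hq1⟩ := h.1.exists_bottom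
    exact ⟨q, Or.inl hq, by rw [bt_row, hq1]⟩
  | col c k, h => by
    have := h.2.2
    by_cases hk : k ≤ c.ht
    · obtain ⟨q, hq, hq1⟩ := h.1.exists_bottom
      refine ⟨q, Or.inl hq, ?_⟩
      rw [bt_col, hq1, max_eq_left (by omega), bt]
    · refine ⟨((c.wd : ℤ) - 1, c.tp - k),
        Or.inr (by simp only [Set.mem_ofPred_eq, true_and]; omega), ?_⟩
      rw [bt_col, max_eq_right (by omega)]
  | bot c k, h => by
    have := h.2.2
    exact ⟨((c.wd : ℤ) - 2, c.bt - 1), Or.inr (by simp only [Set.mem_ofPred_eq, true_and]; omega),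
      by rw [bt_bot]⟩

theorem Valid.width_cellSet {c : Code} (h : c.Valid) : width c.cellSet = c.wd := by
  rw [width_eq (a := -1) (b := c.wd - 2)
    (fun q hq => ⟨(h.cellSet_box q hq).1, (h.cellSet_box q hq).2.1⟩) ⟨_, h.corner, rfl⟩
    h.exists_right]
  omega

theorem Valid.height_cellSet {c : Code} (h : c.Valid) : height c.cellSet = c.ht := by
  rw [height_eq (a := c.bt) (b := c.tp - 1) (fun q hq => (h.cellSet_box q hq).2.2)
    h.exists_bottom ⟨_, h.corner, rfl⟩, bt]
  omega

theorem Valid.mem_removeTopRow {c : Code} (h : c.Valid) (q : ℤ × ℤ) :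
    q ∈ removeTopRow c.cellSet ↔ q ∈ c.cellSet ∧ q.2 < c.tp - 1 := by
  constructor
  · rintro ⟨hq, d, hd, hqd⟩
    have := h.cellSet_box d hd
    exact ⟨hq, by omega⟩
  · exact fun hq => ⟨hq.1, _, h.corner, hq.2⟩

theorem Valid.mem_removeRightColumn {c : Code} (h : c.Valid) (q : ℤ × ℤ) :
    q ∈ removeRightColumn c.cellSet ↔ q ∈ c.cellSet ∧ q.1 < c.wd - 2 := by
  constructor
  · rintro ⟨hq, d, hd, hqd⟩
    have := h.cellSet_box d hd
    exact ⟨hq, by omega⟩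
  · obtain ⟨d, hd, hd'⟩ := h.exists_right
    exact fun hq => ⟨hq.1, d, hd, by omega⟩

/-- What is left of a set of cells when its bottom row is removed. -/
def removeBottomRow (S : Set (ℤ × ℤ)) : Set (ℤ × ℤ) := {c ∈ S | ∃ d ∈ S, d.2 < c.2}

theorem Valid.mem_removeBottomRow {c : Code} (h : c.Valid) (q : ℤ × ℤ) :
    q ∈ removeBottomRow c.cellSet ↔ q ∈ c.cellSet ∧ c.bt < q.2 := by
  constructor
  · rintro ⟨hq, d, hd, hqd⟩
    have := h.cellSet_box d hd
    exact ⟨hq, by omega⟩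
  · obtain ⟨d, hd, hd'⟩ := h.exists_bottom
    exact fun hq => ⟨hq.1, d, hd, by omega⟩

theorem removeTopRow_row {c : Code} {k : ℕ} (h : (row c k).Valid) :
    removeTopRow (row c k).cellSet = c.cellSet := by
  ext q
  rw [h.mem_removeTopRow, mem_cellSet_row]
  have := h.1.cellSet_box q
  simp only [tp]
  by_cases hq : q ∈ c.cellSet <;>
    simp only [hq, true_or, false_or, forall_const, true_and, iff_true, iff_false] at this ⊢
  · omega
  · omega

theorem removeRightColumn_col {c : Code} {k : ℕ} (h : (col c k).Valid) :
    removeRightColumn (col c k).cellSet = c.cellSet := by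
  ext q
  rw [h.mem_removeRightColumn, mem_cellSet_col]
  have := h.1.cellSet_box q
  simp only [wd]; push_cast
  by_cases hq : q ∈ c.cellSet <;>
    simp only [hq, true_or, false_or, forall_const, true_and, iff_true, iff_false] at this ⊢
  · omega
  · omega

theorem removeBottomRow_bot {c : Code} {k : ℕ} (h : (bot c k).Valid) :
    removeBottomRow (bot c k).cellSet = c.cellSet := by
  ext q
  rw [h.mem_removeBottomRow, mem_cellSet_bot, bt_bot]
  have := h.1.cellSet_box q
  by_cases hq : q ∈ c.cellSet <;>
    simp only [hq, true_or, false_or, forall_const, true_and, iff_true, iff_false] at this ⊢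
  · omega
  · omega

/-- The right column consists of the protruding cell of the top row alone. -/
theorem removeRightColumn_row {c : Code} (h : c.Valid) :
    removeRightColumn (row c (c.wd + 1)).cellSet = (row c c.wd).cellSet := by
  have hv : (row c (c.wd + 1)).Valid := ⟨h, by omega, le_rfl⟩
  have hw : (row c (c.wd + 1)).wd = c.wd + 1 := max_eq_right (by omega)
  ext q
  rw [hv.mem_removeRightColumn, mem_cellSet_row, mem_cellSet_row, hw]
  have := h.cellSet_box q
  push_cast
  by_cases hq : q ∈ c.cellSet <;>
    simp only [hq, true_or, false_or, forall_const, true_and, iff_true] at this ⊢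
  · omega
  · omega

theorem removeBottomRow_col {c : Code} (h : c.Valid) (hX : ¬ c.isX) :
    removeBottomRow (col c (c.ht + 1)).cellSet = (col c c.ht).cellSet := by
  have hv : (col c (c.ht + 1)).Valid := ⟨h, hX, by omega, le_rfl⟩
  have hw : (col c (c.ht + 1)).bt = c.bt - 1 := by rw [bt_col, bt]; push_cast; omega
  ext q
  rw [hv.mem_removeBottomRow, mem_cellSet_col, mem_cellSet_col, hw]
  have := h.cellSet_box q
  have hb : c.bt = c.tp - c.ht := rfl
  push_cast
  by_cases hq : q ∈ c.cellSet <;>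
    simp only [hq, true_or, false_or, forall_const, true_and, iff_true] at this ⊢
  · omega
  · omega

/-! ### The three classes -/

theorem adj_le {p q : ℤ × ℤ} (h : |q.1 - p.1| + |q.2 - p.2| = 1) :
    q.1 ≤ p.1 + 1 ∧ p.1 ≤ q.1 + 1 ∧ q.2 ≤ p.2 + 1 ∧ p.2 ≤ q.2 + 1 := by
  have h1 := abs_nonneg (q.1 - p.1)
  have h2 := abs_nonneg (q.2 - p.2)
  have h3 := abs_le.1 (show |q.1 - p.1| ≤ 1 by omega)
  have h4 := abs_le.1 (show |q.2 - p.2| ≤ 1 by omega)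
  omega

/-- If the polygon is not in the first class, then below its top row there is a union of connected
components that contains the left column and is disjoint from the right column. -/
theorem Valid.exists_top_split : ∀ {c : Code}, c.Valid → ¬ c.isX → ∃ A : Set (ℤ × ℤ),
    (∀ q ∈ A, q ∈ c.cellSet ∧ q.2 < c.tp - 1 ∧ q.1 ≠ c.wd - 2 ∧ (c.isZ → q.2 ≠ c.bt)) ∧
    (∀ q ∈ c.cellSet, q.2 < c.tp - 1 → q.1 = -1 → q ∈ A) ∧
    (∀ p ∈ A, ∀ q ∈ c.cellSet, q.2 < c.tp - 1 → |q.1 - p.1| + |q.2 - p.2| = 1 → q ∈ A)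
  | sq, _, _ => by
    -- The unit square has nothing below its top row.
    refine ⟨∅, by simp, fun q hq h => ?_, by simp⟩
    rw [mem_cellSet_sq] at hq
    simp only [tp] at h; omega
  | row c k, h, hX => by
    have hb := h.1.cellSet_box
    have hk := h.2
    simp only [isX_row] at hX
    have hsub : ∀ q ∈ (row c k).cellSet, q.2 < (row c k).tp - 1 → q ∈ c.cellSet := by
      rintro q (hq | hq) h
      · exact hq
      · have := hq.1; simp only [tp] at h; omega
    -- Below the protruding row lies all of `c`, and the right column has no cell there.
    refine ⟨c.cellSet, fun q hq => ⟨Or.inl hq, ?_, ?_, fun h => h.elim⟩,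
      fun q hq h _ => hsub q hq h, fun p hp q hq h _ => hsub q hq h⟩
    · have := hb q hq; simp only [tp]; omega
    · have := hb q hq; simp only [wd]; push_cast; omega
  | col c k, h, _ => by
    obtain ⟨A, h1, h2, h3⟩ := h.1.exists_top_split h.2.1
    have hb := h.1.cellSet_box
    have hk := h.2.2
    have hw := h.1.one_le_wd
    refine ⟨A, fun q hq => ⟨Or.inl (h1 q hq).1, (h1 q hq).2.1, ?_, fun hZ => ?_⟩, ?_, ?_⟩
    · have := hb q (h1 q hq).1; simp only [wd]; push_cast; omega
    · have := hb q (h1 q hq).1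
      rw [bt_col]
      rw [bt] at this
      simp only [isZ_col] at hZ
      omega
    · rintro q (hq | hq) hq2 hq1
      · exact h2 q hq hq2 hq1
      · have := hq.1; omega
    · rintro p hp q (hq | hq) hq2 hpq
      · exact h3 p hp q hq hq2 hpq
      · have := hq.1
        have := hb p (h1 p hp).1
        -- The new column touches only the right column of `c`, which `A` avoids.
        have := (h1 p hp).2.2.1
        have := adj_le hpq
        omega
  | bot c k, h, _ => by
    obtain ⟨A, h1, h2, h3⟩ := h.1.exists_top_split (not_isX_of_isZ h.2.1)
    have hb := h.1.cellSet_box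
    have hk := h.2.2
    refine ⟨A, fun q hq => ⟨Or.inl (h1 q hq).1, (h1 q hq).2.1, (h1 q hq).2.2.1, fun _ => ?_⟩,
      ?_, ?_⟩
    · have := hb q (h1 q hq).1
      rw [bt_bot]; omega
    · rintro q (hq | hq) hq2 hq1
      · exact h2 q hq hq2 hq1
      · have := hq.2; omega
    · rintro p hp q (hq | hq) hq2 hpq
      · exact h3 p hp q hq hq2 hpq
      · have := hq.1
        have := hb p (h1 p hp).1
        -- The new row touches only the bottom row of `c`. The clause on bottom rows is carried
        -- through the recursion for this case.
        have := (h1 p hp).2.2.2 h.2.1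
        have := adj_le hpq
        omega

/-- If the polygon is in the third class, then to the left of its right column there is a union of
connected components that contains the top row and is disjoint from the bottom row. -/
theorem Valid.exists_right_split : ∀ {c : Code}, c.Valid → c.isZ → ∃ A : Set (ℤ × ℤ),
    (∀ q ∈ A, q ∈ c.cellSet ∧ q.2 ≠ c.bt) ∧
    (∀ q ∈ c.cellSet, q.1 < c.wd - 2 → q.2 = c.tp - 1 → q ∈ A) ∧
    (∀ p ∈ A, ∀ q ∈ c.cellSet, q.1 < c.wd - 2 → |q.1 - p.1| + |q.2 - p.2| = 1 → q ∈ A)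
  | sq, _, h => h.elim
  | row _ _, _, h => h.elim
  | col c k, h, hZ => by
    have hb := h.1.cellSet_box
    have hk := h.2.2
    simp only [isZ_col] at hZ
    have hsub : ∀ q ∈ (col c k).cellSet, q.1 < (col c k).wd - 2 → q ∈ c.cellSet := by
      rintro q (hq | hq) h
      · exact hq
      · have := hq.1; simp only [wd] at h; push_cast at h; omega
    refine ⟨c.cellSet, fun q hq => ⟨Or.inl hq, ?_⟩,
      fun q hq h _ => hsub q hq h, fun p hp q hq h _ => hsub q hq h⟩
    have := hb q hq
    rw [bt] at this
    rw [bt_col]; omega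
  | bot c k, h, _ => by
    obtain ⟨A, h1, h2, h3⟩ := h.1.exists_right_split h.2.1
    have hb := h.1.cellSet_box
    have ht := h.1.one_le_ht
    refine ⟨A, fun q hq => ⟨Or.inl (h1 q hq).1, ?_⟩, ?_, ?_⟩
    · have := hb q (h1 q hq).1
      rw [bt_bot]; omega
    · rintro q (hq | hq) hq2 hq1
      · exact h2 q hq hq2 hq1
      · have := hq.1
        simp only [tp] at hq1
        rw [bt] at this; omega
    · rintro p hp q (hq | hq) hq2 hpq
      · exact h3 p hp q hq hq2 hpq
      · have := hq.1
        have := hb p (h1 p hp).1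
        -- Again the new row touches only the bottom row of `c`, which `A` avoids.
        have := (h1 p hp).2
        have := adj_le hpq
        omega

/-- Removing a top row within the width gives back the previous polygon. In every other case a
remainder of full width meets both extreme columns, and `exists_top_split` separates these. -/
theorem Valid.isX_iff {c : Code} (h : c.Valid) : c.isX ↔
    width (removeTopRow c.cellSet) = width c.cellSet ∧ IsOnePiece (removeTopRow c.cellSet) := by
  constructor
  · intro hX
    cases c with
    | row c k =>
      rw [removeTopRow_row h, h.width_cellSet, h.1.width_cellSet]
      exact ⟨(max_eq_left hX).symm, h.1.isOnePiece⟩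
    | _ => exact hX.elim
  · rintro ⟨h1, h2⟩
    by_contra hX
    obtain ⟨A, hA, hl, hc⟩ := h.exists_top_split hX
    have hw := h.one_le_wd
    rw [h.width_cellSet] at h1
    obtain ⟨⟨p, hp, hp1⟩, q, hq, hq1⟩ := exists_of_width_eq (S := removeTopRow c.cellSet) (a := -1)
      (b := c.wd - 2) (fun q hq => by have := h.cellSet_box q hq.1; omega) (by omega)
      (by rw [h1]; omega)
    refine not_isOnePiece (A := A) hp ?_ hq (fun hqA => (hA q hqA).2.2.1 hq1) ?_ h2
    · rw [h.mem_removeTopRow] at hp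
      exact hl p hp.1 hp.2 hp1
    · intro p hp q hq hpq
      rw [h.mem_removeTopRow] at hq
      exact hc p hp q hq.1 hq.2 hpq

/-- Outside the classes X and Z, and apart from the unit square, the removed column is the
protruding cell of a top row or a column within the height, and a polygon of the same height is
left. In class Z a remainder of full height meets the top and bottom rows, which
`exists_right_split` separates. -/
theorem Valid.isZ_iff {c : Code} (h : c.Valid) (hX : ¬ c.isX) : ¬ c.isZ ↔ c.ar = 1 ∨
    height (removeRightColumn c.cellSet) = height c.cellSet ∧
      IsOnePiece (removeRightColumn c.cellSet) := by
  constructor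
  · intro hZ
    cases c with
    | sq => exact Or.inl rfl
    | row c k =>
      obtain rfl : k = c.wd + 1 := le_antisymm h.2.2 (by simp only [isX_row] at hX; omega)
      have hv : (row c c.wd).Valid := ⟨h.1, h.1.one_le_wd, by omega⟩
      rw [removeRightColumn_row h.1, h.height_cellSet, hv.height_cellSet]
      exact Or.inr ⟨rfl, hv.isOnePiece⟩
    | col c k =>
      rw [removeRightColumn_col h, h.height_cellSet, h.1.height_cellSet]
      simp only [isZ_col, not_lt] at hZ
      exact Or.inr ⟨(max_eq_left hZ).symm, h.1.isOnePiece⟩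
    | bot c k => exact absurd trivial hZ
  · rintro (h1 | ⟨h1, h2⟩) hZ
    · cases c with
      | col c k =>
        have := h.1.one_le_ar
        have := h.2.2
        simp only [ar] at h1; omega
      | bot c k =>
        have := h.1.one_le_ar
        have := h.2.2
        simp only [ar] at h1; omega
      | _ => exact hZ.elim
    · obtain ⟨A, hA, hl, hc⟩ := h.exists_right_split hZ
      have hw := h.one_le_ht
      have hb : c.bt = c.tp - c.ht := rfl
      rw [h.height_cellSet] at h1
      obtain ⟨⟨p, hp, hp1⟩, q, hq, hq1⟩ := exists_of_height_eq (S := removeRightColumn c.cellSet)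
        (a := c.bt) (b := c.tp - 1) (fun q hq => (h.cellSet_box q hq.1).2.2) (by omega)
        (by rw [h1]; omega)
      refine not_isOnePiece (A := A) hq ?_ hp (fun hpA => (hA p hpA).2 hp1) ?_ h2
      · rw [h.mem_removeRightColumn] at hq
        exact hl q hq.1 hq.2 hq1
      · intro p hp q hq hpq
        rw [h.mem_removeRightColumn] at hq
        exact hc p hp q hq.1 hq.2 hpq

theorem Valid.isX_congr {c d : Code} (hc : c.Valid) (hd : d.Valid) (h : c.cellSet = d.cellSet) :
    c.isX ↔ d.isX := by
  rw [hc.isX_iff, hd.isX_iff, h]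

theorem Valid.ar_congr {c d : Code} (hc : c.Valid) (hd : d.Valid) (h : c.cellSet = d.cellSet) :
    c.ar = d.ar := by
  rw [← hc.ncard_cellSet.2, ← hd.ncard_cellSet.2, h]

theorem Valid.isZ_congr {c d : Code} (hc : c.Valid) (hd : d.Valid) (h : c.cellSet = d.cellSet) :
    c.isZ ↔ d.isZ := by
  have hX := hc.isX_congr hd h
  by_cases hcX : c.isX
  · have h1 : ¬ c.isZ := fun hZ => not_isX_of_isZ hZ hcX
    have h2 : ¬ d.isZ := fun hZ => not_isX_of_isZ hZ (hX.1 hcX)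
    tauto
  · rw [← not_iff_not, hc.isZ_iff hcX, hd.isZ_iff (hX.not.1 hcX), h, hc.ar_congr hd h]

/-- A protruding top row could also be seen as a row within the width followed by a column of one
cell; `Valid` excludes the latter by allowing no column after a code with `isX`. -/
theorem row_ne_col {c d : Code} {k m : ℕ} (hc : (row c k).Valid) (hd : (col d m).Valid) :
    (row c k).cellSet ≠ (col d m).cellSet := by
  intro h
  have hX : ¬ (row c k).isX := fun hX => ((hc.isX_congr hd h).1 hX).elim
  obtain rfl : k = c.wd + 1 := le_antisymm hc.2.2 (by simp only [isX_row] at hX; omega)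
  have hv : (row c c.wd).Valid := ⟨hc.1, hc.1.one_le_wd, by omega⟩
  have h' := congrArg removeRightColumn h
  rw [removeRightColumn_row hc.1, removeRightColumn_col hd] at h'
  exact hd.2.1 ((hv.isX_congr hd.1 h').1 (by simp))

theorem row_ne_bot {c d : Code} {k m : ℕ} (hc : (row c k).Valid) (hd : (bot d m).Valid) :
    (row c k).cellSet ≠ (bot d m).cellSet := fun h =>
  ((hc.isZ_congr hd h).2 trivial).elim

/-- A protruding column could also be seen as a column within the height followed by a bottom row of
one cell; `Valid` allows a bottom row only after a code with `isZ`. -/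
theorem col_ne_bot {c d : Code} {k m : ℕ} (hc : (col c k).Valid) (hd : (bot d m).Valid) :
    (col c k).cellSet ≠ (bot d m).cellSet := by
  intro h
  have hZ : (col c k).isZ := (hc.isZ_congr hd h).2 trivial
  obtain rfl : k = c.ht + 1 := le_antisymm hc.2.2.2 (by simp only [isZ_col] at hZ; omega)
  have hv : (col c c.ht).Valid := ⟨hc.1, hc.2.1, hc.1.one_le_ht, by omega⟩
  have h' := congrArg removeBottomRow h
  rw [removeBottomRow_col hc.1 hc.2.1, removeBottomRow_bot hd] at h'
  have := (hv.isZ_congr hd.1 h').2 hd.2.1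
  simp at this

/-- A code is determined by the cells of its polygon. -/
theorem cellSet_injOn : ∀ {c d : Code}, c.Valid → d.Valid → c.cellSet = d.cellSet → c = d := by
  intro c
  induction c with
  | sq =>
    intro d hc hd h
    have h1 := hc.ar_congr hd h
    cases d with
    | sq => rfl
    | row d k => have := hd.1.one_le_ar; have := hd.2; simp only [ar] at h1; omega
    | col d k => have := hd.1.one_le_ar; have := hd.2.2; simp only [ar] at h1; omega
    | bot d k => have := hd.1.one_le_ar; have := hd.2.2; simp only [ar] at h1; omega
  | row c k ih =>
    intro d hc hd h
    have h1 := hc.ar_congr hd h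
    cases d with
    | sq => have := hc.1.one_le_ar; have := hc.2; simp only [ar] at h1; omega
    | row d m =>
      have h' := congrArg removeTopRow h
      rw [removeTopRow_row hc, removeTopRow_row hd] at h'
      obtain rfl := ih hc.1 hd.1 h'
      simp only [ar] at h1
      rw [Nat.add_left_cancel h1]
    | col d m => exact absurd h (row_ne_col hc hd)
    | bot d m => exact absurd h (row_ne_bot hc hd)
  | col c k ih =>
    intro d hc hd h
    have h1 := hc.ar_congr hd h
    cases d with
    | sq => have := hc.1.one_le_ar; have := hc.2.2; simp only [ar] at h1; omega
    | row d m => exact absurd h.symm (row_ne_col hd hc)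
    | col d m =>
      have h' := congrArg removeRightColumn h
      rw [removeRightColumn_col hc, removeRightColumn_col hd] at h'
      obtain rfl := ih hc.1 hd.1 h'
      simp only [ar] at h1
      rw [Nat.add_left_cancel h1]
    | bot d m => exact absurd h (col_ne_bot hc hd)
  | bot c k ih =>
    intro d hc hd h
    have h1 := hc.ar_congr hd h
    cases d with
    | sq => have := hc.1.one_le_ar; have := hc.2.2; simp only [ar] at h1; omega
    | row d m => exact absurd h.symm (row_ne_bot hd hc)
    | col d m => exact absurd h.symm (col_ne_bot hd hc)
    | bot d m =>
      have h' := congrArg removeBottomRow h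
      rw [removeBottomRow_bot hc, removeBottomRow_bot hd] at h'
      obtain rfl := ih hc.1 hd.1 h'
      simp only [ar] at h1
      rw [Nat.add_left_cancel h1]

end Code

/-! ### Prudent walks and prudent paths -/

theorem freeStep_iff (p r : ℤ × ℤ) (l : List (ℤ × ℤ)) (hp : p ∈ l) : FreeStep p r l ↔
    |r.1 - p.1| + |r.2 - p.2| = 1 ∧ ∀ q ∈ l, ∀ k : ℕ, 1 ≤ k → q ≠ p + k • (r - p) := by
  obtain ⟨p1, p2⟩ := p
  obtain ⟨r1, r2⟩ := r
  simp only [FreeStep, Prod.mk_sub_mk, Prod.smul_mk, Prod.mk_add_mk, Prod.mk.injEq, ne_eq,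
    nsmul_eq_mul, Prod.forall]
  constructor
  · rintro (⟨⟨rfl, rfl⟩, h⟩ | ⟨⟨rfl, rfl⟩, h⟩ | ⟨⟨rfl, rfl⟩, h⟩ | ⟨⟨rfl, rfl⟩, h⟩) <;>
      refine ⟨by simp, fun a b hq k hk he => ?_⟩ <;> have := h a b hq <;> simp at he this <;> omega
  · rintro ⟨hstep, h⟩
    have key : ∀ a b : ℤ, (a, b) ∈ l → ∀ t : ℤ, 1 ≤ t → a = p1 + t * (r1 - p1) →
        b = p2 + t * (r2 - p2) → False := by
      intro a b hq t ht ha hb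
      refine h a b hq t.toNat (by omega) ?_
      rw [show ((t.toNat : ℕ) : ℤ) = t by omega]
      exact ⟨ha, hb⟩
    have h1 := abs_nonneg (r1 - p1)
    have h2 := abs_nonneg (r2 - p2)
    have hcase : |r1 - p1| = 1 ∧ |r2 - p2| = 0 ∨ |r1 - p1| = 0 ∧ |r2 - p2| = 1 := by omega
    rw [abs_eq_zero, abs_eq_zero, abs_eq one_pos.le, abs_eq one_pos.le] at hcase
    rcases hcase with ⟨h3 | h3, h4⟩ | ⟨h3, h4 | h4⟩
    · refine Or.inl ⟨by omega, fun a b hq hb => ?_⟩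
      by_contra hlt
      exact key a b hq (a - p1) (by omega) (by rw [h3]; ring) (by rw [h4, hb]; ring)
    · refine Or.inr (Or.inl ⟨by omega, fun a b hq hb => ?_⟩)
      by_contra hlt
      exact key a b hq (p1 - a) (by omega) (by rw [h3]; ring) (by rw [h4, hb]; ring)
    · refine Or.inr (Or.inr (Or.inl ⟨by omega, fun a b hq hb => ?_⟩))
      by_contra hlt
      exact key a b hq (b - p2) (by omega) (by rw [h3, hb]; ring) (by rw [h4]; ring)
    · refine Or.inr (Or.inr (Or.inr ⟨by omega, fun a b hq hb => ?_⟩))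
      by_contra hlt
      exact key a b hq (p2 - b) (by omega) (by rw [h3, hb]; ring) (by rw [h4]; ring)

theorem isSAW_concat {w : List (ℤ × ℤ)} {p : ℤ × ℤ} (hw : w.getLast? = some p) (r : ℤ × ℤ) :
    IsSAW (w ++ [r]) ↔ IsSAW w ∧ |r.1 - p.1| + |r.2 - p.2| = 1 ∧ r ∉ w := by
  have hne : w ≠ [] := by rintro rfl; simp at hw
  simp only [IsSAW, List.head?_append_of_ne_nil _ hne, List.isChain_append, hw, List.nodup_append]
  simp
  grind

theorem isPrudent_concat {w : List (ℤ × ℤ)} {p : ℤ × ℤ} (hw : w.getLast? = some p) (r : ℤ × ℤ) :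
    IsPrudent (w ++ [r]) ↔ IsPrudent w ∧ ∀ q ∈ w, ∀ k : ℕ, 1 ≤ k → q ≠ p + k • (r - p) := by
  have hne : w ≠ [] := by rintro rfl; simp at hw
  have hpos := List.length_pos_of_ne_nil hne
  have hlast : w[w.length - 1] = p := by
    rw [List.getLast?_eq_getElem?, List.getElem?_eq_some_iff] at hw
    exact hw.2
  constructor
  · intro h
    refine ⟨fun i hi q hq k hk => ?_, fun q hq k hk => ?_⟩
    · have := h i (by simp; omega) q (by rwa [List.take_append_of_le_length (by omega)]) k hk
      rwa [List.getElem_append_left (by omega), List.getElem_append_left (by omega)] at this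
    · have := h (w.length - 1) (by simp; omega) q
        (by rw [List.take_append_of_le_length (by omega), Nat.sub_add_cancel hpos, List.take_length]
            exact hq) k hk
      rw [List.getElem_append_left (by omega), hlast, List.getElem_append_right (by omega)] at this
      simpa using this
  · rintro ⟨h1, h2⟩ i hi q hq k hk
    simp only [List.length_append, List.length_singleton] at hi
    rw [List.take_append_of_le_length (by omega)] at hq
    rw [List.getElem_append_left (show i < w.length by omega)]
    by_cases hi' : i + 1 < w.length
    · rw [List.getElem_append_left hi']
      exact h1 i hi' q hq k hk
    · obtain rfl : i = w.length - 1 := by omega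
      rw [List.getElem_append_right (by omega), hlast]
      simpa using h2 q (List.mem_of_mem_take hq) k hk

theorem prudentPath_iff : ∀ l : List (ℤ × ℤ),
    PrudentPath l ↔ IsSAW l.reverse ∧ IsPrudent l.reverse
  | [] => by simp [PrudentPath, IsSAW]
  | [p] => by
    simp only [PrudentPath, IsSAW, IsPrudent, List.reverse_singleton, List.head?_cons,
      Option.some.injEq, List.isChain_singleton, List.nodup_singleton, and_true, iff_self_and]
    intro _ i hi
    simp at hi
  | r :: p :: l => by
    have hlast : (p :: l).reverse.getLast? = some p := by simp
    rw [List.reverse_cons, isSAW_concat hlast, isPrudent_concat hlast,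
      show PrudentPath (r :: p :: l) ↔ FreeStep p r (p :: l) ∧ PrudentPath (p :: l) from Iff.rfl,
      prudentPath_iff (p :: l), freeStep_iff p r (p :: l) (by simp)]
    constructor
    · rintro ⟨⟨h1, h2⟩, h3, h4⟩
      refine ⟨⟨h3, h1, fun hr => ?_⟩, h4, fun q hq => h2 q (List.mem_reverse.1 hq)⟩
      exact h2 r (List.mem_reverse.1 hr) 1 le_rfl (by simp)
    · rintro ⟨⟨h1, h2, -⟩, h3, h4⟩
      exact ⟨⟨h2, fun q hq => h4 q (List.mem_reverse.2 hq)⟩, h1, h3⟩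

theorem isPrudentPolygon_iff (w : List (ℤ × ℤ)) : IsPrudentPolygon w ↔
    PrudentPath w.reverse ∧ 2 < w.length ∧ ∃ p, w.getLast? = some p ∧ |p.1| + |p.2| = 1 := by
  rw [prudentPath_iff, List.reverse_reverse, IsPrudentPolygon, and_assoc]

/-! ### The edges of a closed walk -/

theorem zip_reverse_tail : ∀ (l : List (ℤ × ℤ)) (p a : ℤ × ℤ), l.head? = some p →
    l.reverse.zip (l.reverse.tail ++ [a]) = (pathEdges l).reverse ++ [(p, a)]
  | [], _, _, h => by simp at h
  | [r], p, a, h => by simp at h; simp [pathEdges, h]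
  | r :: s :: l, p, a, h => by
    obtain rfl : r = p := by simpa using h
    have hne : (s :: l).reverse ≠ [] := by simp
    have ih := zip_reverse_tail (s :: l) s r rfl
    rw [List.reverse_cons, List.tail_append_of_ne_nil hne, List.zip_append (by simp), ih]
    simp [pathEdges]

theorem edges_reverse {l : List (ℤ × ℤ)} {p a : ℤ × ℤ} (hp : l.head? = some p)
    (ha : l.getLast? = some a) : edges l.reverse = (pathEdges l).reverse ++ [(p, a)] := by
  rw [← zip_reverse_tail l p a hp, edges]
  congr 1
  have : l.reverse.head? = some a := by rw [List.head?_reverse, ha]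
  obtain ⟨t, ht⟩ := List.head?_eq_some_iff.mp this
  rw [ht]
  simp

theorem PrudentPath.getLast {l : List (ℤ × ℤ)} (h : PrudentPath l) : l.getLast? = some (0, 0) := by
  induction h using PrudentPath.induction with
  | start => rfl
  | step p r l _ _ ih => rw [List.getLast?_cons_cons, ih]

theorem PrudentPath.unit_edges {l : List (ℤ × ℤ)} (h : PrudentPath l) :
    ∀ e ∈ pathEdges l, |e.2.1 - e.1.1| + |e.2.2 - e.1.2| = 1 := by
  induction h using PrudentPath.induction with
  | start => simp [pathEdges]
  | step p r l _ hf ih =>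
    rw [pathEdges, List.forall_mem_cons]
    exact ⟨((freeStep_iff p r _ (by simp)).1 hf).1, ih⟩

theorem IsPrudentPolygon.unit_edges {w : List (ℤ × ℤ)} (h : IsPrudentPolygon w) :
    ∀ e ∈ edges w, |e.2.1 - e.1.1| + |e.2.2 - e.1.2| = 1 := by
  obtain ⟨h1, -, p, hp, hp1⟩ := (isPrudentPolygon_iff w).1 h
  intro e he
  rw [← w.reverse_reverse, edges_reverse (by rw [List.head?_reverse, hp]) h1.getLast,
    List.mem_append, List.mem_reverse, List.mem_singleton] at he
  rcases he with he | rfl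
  · exact h1.unit_edges e he
  · simpa using hp1

/-! ### The polygons of the codes -/

namespace Code

/-- The walk of the polygon. -/
def walk (c : Code) : List (ℤ × ℤ) := c.loop.reverse

theorem Valid.edges_walk {c : Code} (h : c.Valid) :
    edges c.walk = (pathEdges c.loop).reverse ++ [((-1, 0), (0, 0))] :=
  edges_reverse h.rInv.head_loop h.rInv.path_loop.getLast

theorem Valid.cells_walk {c : Code} (h : c.Valid) : cells c.walk = c.cellSet := by
  ext q
  rw [← h.odd_crossings, cells, Set.mem_ofPred_eq, h.edges_walk, List.countP_append,
    List.countP_reverse, List.countP_singleton]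
  simp [crossings]

theorem Valid.isCounterclockwise_walk {c : Code} (h : c.Valid) : IsCounterclockwise c.walk := by
  intro e he
  rw [h.cells_walk]
  rw [h.edges_walk, List.mem_append, List.mem_reverse, List.mem_singleton] at he
  rcases he with he | rfl
  · exact h.leftCell_loop e he
  · rw [show leftCell (-1, 0) (0, 0) = (-1, 0) from leftCell_right (-1) 0]
    exact h.cellSet_border.2.2.2 0 le_rfl (by have := h.rInv.bt_nonpos; omega)

theorem Valid.getLast_walk {c : Code} (h : c.Valid) : c.walk.getLast? = some (-1, 0) := by
  rw [walk, List.getLast?_reverse, h.rInv.head_loop]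

theorem Valid.isPrudentPolygon_walk {c : Code} (h : c.Valid) : IsPrudentPolygon c.walk := by
  rw [isPrudentPolygon_iff]
  refine ⟨by rw [walk, List.reverse_reverse]; exact h.rInv.path_loop, ?_, _, h.getLast_walk, rfl⟩
  have hi := h.rInv
  have ht := hi.bt_nonpos
  have h0 : (0, 0) ∈ c.loop := hi.path_loop.origin_mem
  have h1 : (-1, 0) ∈ c.loop := List.mem_of_mem_head? hi.head_loop
  -- Together with the origin and `(-1, 0)` this is a third node, because `c.tp` is positive.
  have h2 : (-1, c.tp) ∈ c.loop :=
    (mem_vgo hi.head_left _ _).2 (Or.inl (List.mem_of_mem_head? hi.head_left))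
  rw [walk, List.length_reverse]
  by_contra hlen
  match hl : c.loop with
  | [] => simp [hl] at h0
  | [a] => simp [hl] at h0 h1; rw [← h0] at h1; simp at h1
  | [a, b] =>
    have := hi.head_loop
    simp [hl] at h0 h1 h2 this
    subst this
    simp at h0 h2
    subst h0
    simp at h2
    omega
  | a :: b :: d :: l => simp [hl] at hlen

theorem Valid.walk_mem_classW {c : Code} (h : c.Valid) : c.walk ∈ classW :=
  ⟨h.isPrudentPolygon_walk, h.getLast_walk, h.isCounterclockwise_walk⟩

theorem walk_injOn : Set.InjOn walk {c | c.Valid} := fun c hc d hd h =>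
  cellSet_injOn hc hd (by rw [← Valid.cells_walk hc, ← Valid.cells_walk hd, h])

end Code

/-! ### Symmetries of polygons -/

theorem edges_map (f : ℤ × ℤ → ℤ × ℤ) (w : List (ℤ × ℤ)) :
    edges (w.map f) = (edges w).map (Prod.map f f) := by
  rw [edges, edges, ← List.map_rotate, List.zip_map]

theorem flip_flip (p : ℤ × ℤ) : flip (flip p) = p := by simp [flip]

theorem map_flip_flip (w : List (ℤ × ℤ)) : (w.map flip).map flip = w := by
  rw [List.map_map]
  conv_rhs => rw [← List.map_id w]
  exact congrArg (List.map · w) (funext flip_flip)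

theorem map_swap_swap (w : List (ℤ × ℤ)) : (w.map Prod.swap).map Prod.swap = w := by
  rw [List.map_map, Prod.swap_swap_eq, List.map_id]

theorem IsPrudentPolygon.flip {w : List (ℤ × ℤ)} (h : IsPrudentPolygon w) :
    IsPrudentPolygon (w.map flip) := by
  rw [isPrudentPolygon_iff] at h ⊢
  obtain ⟨h1, h2, p, hp, hp1⟩ := h
  refine ⟨by rw [← List.map_reverse]; exact h1.flip, by simpa using h2,
    PrudentPolygon.flip p, ?_, ?_⟩
  · rw [List.getLast?_map, hp]; rfl
  · simpa [PrudentPolygon.flip] using hp1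

theorem IsPrudentPolygon.swap {w : List (ℤ × ℤ)} (h : IsPrudentPolygon w) :
    IsPrudentPolygon (w.map Prod.swap) := by
  rw [isPrudentPolygon_iff] at h ⊢
  obtain ⟨h1, h2, p, hp, hp1⟩ := h
  refine ⟨by rw [← List.map_reverse]; exact h1.swap, by simpa using h2, p.swap, ?_, ?_⟩
  · rw [List.getLast?_map, hp]; rfl
  · simpa [add_comm] using hp1

/-- Cells are named by their south-west corners, so reflection sends the ordinate `b` to `-b - 1`.
-/
theorem IsPrudentPolygon.mem_cells_flip {w : List (ℤ × ℤ)} (h : IsPrudentPolygon w) (q : ℤ × ℤ) :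
    q ∈ cells (w.map PrudentPolygon.flip) ↔ (q.1, -q.2 - 1) ∈ cells w := by
  rw [cells, cells, Set.mem_ofPred_eq, Set.mem_ofPred_eq, edges_map, List.countP_map]
  rw [List.countP_congr]
  intro e he
  have hu := h.unit_edges e he
  change decide (e.1.1 = e.2.1 ∧ q.1 < e.1.1 ∧ min (-e.1.2) (-e.2.2) = q.2) = true ↔ _
  rw [decide_eq_true_iff, decide_eq_true_iff]
  constructor <;> rintro ⟨h1, h2, h3⟩ <;> refine ⟨h1, h2, ?_⟩ <;>
  · rw [h1, sub_self, abs_zero, zero_add, abs_eq one_pos.le] at hu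
    omega

/-- The even-odd rule gives the same result for the ray to the north as for the ray to the east.
These rays bound a quadrant, and a closed walk crosses the boundary of the quadrant an even number
of times. -/
theorem IsPrudentPolygon.mem_cells_swap {w : List (ℤ × ℤ)} (h : IsPrudentPolygon w) (q : ℤ × ℤ) :
    q ∈ cells (w.map Prod.swap) ↔ q.swap ∈ cells w := by
  rw [cells, cells, Set.mem_ofPred_eq, Set.mem_ofPred_eq, edges_map, List.countP_map]
  -- The indicator of the north-east quadrant of the cell `q.swap`: an edge crosses exactly one of
  -- the two rays if and only if `f e.1 + f e.2` is odd.
  let f : ℤ × ℤ → ℕ := fun p => if q.2 < p.1 ∧ q.1 < p.2 then 1 else 0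
  have key : ∀ E : List ((ℤ × ℤ) × (ℤ × ℤ)), 
      (∀ e ∈ E, |e.2.1 - e.1.1| + |e.2.2 - e.1.2| = 1) →
      (E.countP (fun e => decide (e.1.2 = e.2.2 ∧ q.1 < e.1.2 ∧ min e.1.1 e.2.1 = q.2)) +
        E.countP (fun e => decide (e.1.1 = e.2.1 ∧ q.2 < e.1.1 ∧ min e.1.2 e.2.2 = q.1)) +
        (E.map fun e => f e.1 + f e.2).sum) % 2 = 0 := by
    intro E
    induction E with
    | nil => simp
    | cons e E ih =>
      intro hE
      rw [List.forall_mem_cons] at hE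
      have ih := ih hE.2
      have he := hE.1
      rw [List.countP_cons, List.countP_cons, List.map_cons, List.sum_cons]
      have hcase : |e.2.1 - e.1.1| = 1 ∧ |e.2.2 - e.1.2| = 0 ∨
          |e.2.1 - e.1.1| = 0 ∧ |e.2.2 - e.1.2| = 1 := by
        have h1 := abs_nonneg (e.2.1 - e.1.1)
        have h2 := abs_nonneg (e.2.2 - e.1.2)
        omega
      rw [abs_eq_zero, abs_eq_zero, abs_eq one_pos.le, abs_eq one_pos.le] at hcase
      have hf : ∀ p, f p = if q.2 < p.1 ∧ q.1 < p.2 then 1 else 0 := fun _ => rfl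
      simp only [hf e.1, hf e.2, decide_eq_true_eq]
      have : ((if e.1.2 = e.2.2 ∧ q.1 < e.1.2 ∧ min e.1.1 e.2.1 = q.2 then 1 else 0) +
          (if e.1.1 = e.2.1 ∧ q.2 < e.1.1 ∧ min e.1.2 e.2.2 = q.1 then 1 else 0) +
          ((if q.2 < e.1.1 ∧ q.1 < e.1.2 then 1 else 0) +
            if q.2 < e.2.1 ∧ q.1 < e.2.2 then 1 else 0)) % 2 = 0 := by
        split_ifs <;> omega
      omega
  have hE := key (edges w) h.unit_edges
  -- In a closed walk each node is once the start and once the end of an edge.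
  have hsum : ((edges w).map fun e => f e.1 + f e.2).sum = 2 * (w.map f).sum := by
    have h1 : ∀ E : List ((ℤ × ℤ) × (ℤ × ℤ)), (E.map fun e => f e.1 + f e.2).sum =
        ((E.map Prod.fst).map f).sum + ((E.map Prod.snd).map f).sum := by
      intro E
      induction E with
      | nil => simp
      | cons e E ih => simp only [List.map_cons, List.sum_cons, ih]; omega
    rw [h1, edges, List.map_fst_zip (by simp), List.map_snd_zip (by simp), List.map_rotate,
      (List.rotate_perm _ _).sum_eq]
    omega
  rw [hsum] at hE
  simp only [Nat.odd_iff]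
  have e1 : List.countP ((fun e : (ℤ × ℤ) × (ℤ × ℤ) =>
        decide (e.1.1 = e.2.1 ∧ q.1 < e.1.1 ∧ min e.1.2 e.2.2 = q.2)) ∘
      Prod.map Prod.swap Prod.swap) (edges w) =
      (edges w).countP (fun e => decide (e.1.2 = e.2.2 ∧ q.1 < e.1.2 ∧ min e.1.1 e.2.1 = q.2)) :=
    rfl
  rw [e1]
  simp only [Prod.fst_swap, Prod.snd_swap]
  omega

theorem IsPrudentPolygon.area_flip {w : List (ℤ × ℤ)} (h : IsPrudentPolygon w) :
    area (cells (w.map PrudentPolygon.flip)) = area (cells w) := by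
  have : cells (w.map PrudentPolygon.flip) = (fun q : ℤ × ℤ => (q.1, -q.2 - 1)) '' cells w := by
    ext q
    rw [h.mem_cells_flip]
    constructor
    · exact fun hq => ⟨_, hq, by simp⟩
    · rintro ⟨r, hr, rfl⟩
      simpa using hr
  rw [area, area, this, Set.ncard_image_of_injective]
  rintro ⟨a, b⟩ ⟨c, d⟩ he
  simp only [Prod.mk.injEq] at he ⊢
  omega

theorem IsPrudentPolygon.area_swap {w : List (ℤ × ℤ)} (h : IsPrudentPolygon w) :
    area (cells (w.map Prod.swap)) = area (cells w) := by
  have : cells (w.map Prod.swap) = Prod.swap '' cells w := by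
    ext q
    rw [h.mem_cells_swap]
    constructor
    · exact fun hq => ⟨_, hq, by simp⟩
    · rintro ⟨r, hr, rfl⟩
      simpa using hr
  rw [area, area, this, Set.ncard_image_of_injective _ Prod.swap_injective]

/-! ### The polygons ending at `(-1, 0)` and their classes in terms of codes -/

theorem IsPrudentPolygon.exists_walk {w : List (ℤ × ℤ)} (h : IsPrudentPolygon w)
    (hw : w.getLast? = some (-1, 0)) :
    ∃ c : Code, c.Valid ∧ (w = c.walk ∨ w = c.walk.map PrudentPolygon.flip) := by
  obtain ⟨h1, h2, -⟩ := (isPrudentPolygon_iff w).1 h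
  obtain ⟨c, hc, e⟩ := h1.exists_loop (by rw [List.head?_reverse, hw]) (by simpa using h2)
  refine ⟨c, hc, ?_⟩
  rw [walk, List.map_reverse, ← List.reverse_eq_iff, ← List.reverse_eq_iff]
  exact e

/-- The closing edge has the cell `(-1, 0)` on its left. This is the mirror image of `(-1, -1)`,
which lies below the left column of the polygon. -/
theorem Code.Valid.not_isCounterclockwise_flip {c : Code} (h : c.Valid) :
    ¬ IsCounterclockwise (c.walk.map flip) := by
  intro hccw
  have := hccw ((-1, 0), (0, 0)) (by
    rw [edges_map, h.edges_walk]
    simp [PrudentPolygon.flip])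
  rw [show leftCell (-1, 0) (0, 0) = (-1, 0) from leftCell_right (-1) 0,
    h.isPrudentPolygon_walk.mem_cells_flip, h.cells_walk] at this
  have := h.left_column _ this rfl
  simp at this

theorem mem_classW_iff (w : List (ℤ × ℤ)) : w ∈ classW ↔ ∃ c : Code, c.Valid ∧ w = c.walk := by
  constructor
  · rintro ⟨h1, h2, h3⟩
    obtain ⟨c, hc, rfl | rfl⟩ := h1.exists_walk h2
    · exact ⟨c, hc, rfl⟩
    · exact absurd h3 hc.not_isCounterclockwise_flip
  · rintro ⟨c, hc, rfl⟩
    exact hc.walk_mem_classW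

theorem Code.Valid.walk_mem_classX_iff {c : Code} (h : c.Valid) : c.walk ∈ classX ↔ c.isX := by
  rw [h.isX_iff, ← h.cells_walk]
  exact and_iff_right h.walk_mem_classW

theorem Code.Valid.walk_mem_classY_iff {c : Code} (h : c.Valid) :
    c.walk ∈ classY ↔ ¬ c.isX ∧ ¬ c.isZ := by
  have h1 : c.walk ∈ classY ↔ area (cells c.walk) = 1 ∨
      (c.walk ∉ classX ∧ height (removeRightColumn (cells c.walk)) = height (cells c.walk) ∧
        IsOnePiece (removeRightColumn (cells c.walk))) := and_iff_right h.walk_mem_classW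
  rw [h1, h.walk_mem_classX_iff, h.cells_walk, area, h.ncard_cellSet.2]
  by_cases hX : c.isX
  -- The unit square is put into class Y by definition, so it must not be in X.
  · have : c.ar ≠ 1 := by
      cases c with
      | row c k =>
        have := h.1.one_le_ar
        have := h.2
        simp only [ar]; omega
      | _ => exact hX.elim
    simp [hX, this]
  · simp only [hX, not_false_eq_true, true_and]
    exact (h.isZ_iff hX).symm

theorem Code.Valid.walk_mem_classZ_iff {c : Code} (h : c.Valid) : c.walk ∈ classZ ↔ c.isZ := by
  have h1 : c.walk ∈ classZ ↔ c.walk ∉ classX ∧ c.walk ∉ classY := and_iff_right h.walk_mem_classW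
  rw [h1, h.walk_mem_classX_iff, h.walk_mem_classY_iff]
  have := not_isX_of_isZ (c := c)
  tauto

theorem ncard_walks {s : Set (List (ℤ × ℤ))} (hs : s ⊆ classW) (P : Code → Prop)
    (h : ∀ c : Code, c.Valid → (c.walk ∈ s ↔ P c)) :
    s.ncard = {c : Code | c.Valid ∧ P c}.ncard := by
  have : s = walk '' {c : Code | c.Valid ∧ P c} := by
    ext w
    constructor
    · intro hw
      obtain ⟨c, hc, rfl⟩ := (mem_classW_iff w).1 (hs hw)
      exact ⟨c, ⟨hc, (h c hc).1 hw⟩, rfl⟩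
    · rintro ⟨c, ⟨hc, hP⟩, rfl⟩
      exact (h c hc).2 hP
  rw [this, Set.InjOn.ncard_image (walk_injOn.mono fun c hc => hc.1)]

/-! ### Counting all prudent polygons -/

/-- The codes of the polygons of area `n`. -/
def codesOfArea (n : ℕ) : Set Code := {c | c.Valid ∧ c.ar = n}

theorem codesOfArea_finite (n : ℕ) : (codesOfArea n).Finite := by
  induction n using Nat.strong_induction_on with
  | _ n ih =>
    let T : Set Code := ⋃ k ∈ Finset.Icc 1 n, ⋃ m ∈ Finset.range n,
      (fun c => row c k) '' codesOfArea m ∪ (fun c => col c k) '' codesOfArea m ∪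
        (fun c => bot c k) '' codesOfArea m
    have hT : T.Finite := by
      refine Set.Finite.biUnion (Finset.finite_toSet _) fun k _ =>
        Set.Finite.biUnion (Finset.finite_toSet _) fun m hm => ?_
      have := ih m (by simpa using hm)
      exact ((this.image _).union (this.image _)).union (this.image _)
    refine (hT.insert sq).subset ?_
    rintro c ⟨hc, rfl⟩
    cases c with
    | sq => exact Or.inl rfl
    | row c k =>
      refine Or.inr (Set.mem_biUnion (x := k) ?_ (Set.mem_biUnion (x := c.ar) ?_
        (Or.inl (Or.inl ⟨c, ⟨hc.1, rfl⟩, rfl⟩))))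
      · have := hc.2; simp [ar]; omega
      · have := hc.2; simp [ar]; omega
    | col c k =>
      refine Or.inr (Set.mem_biUnion (x := k) ?_ (Set.mem_biUnion (x := c.ar) ?_
        (Or.inl (Or.inr ⟨c, ⟨hc.1, rfl⟩, rfl⟩))))
      · have := hc.2; simp [ar]; omega
      · have := hc.2; simp [ar]; omega
    | bot c k =>
      refine Or.inr (Set.mem_biUnion (x := k) ?_ (Set.mem_biUnion (x := c.ar) ?_
        (Or.inr ⟨c, ⟨hc.1, rfl⟩, rfl⟩)))
      · have := hc.2; simp [ar]; omega
      · have := hc.2; simp [ar]; omega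

/-- The prudent polygons of area `n` that end at `e`. -/
def polygonsEndingAt (n : ℕ) (e : ℤ × ℤ) : Set (List (ℤ × ℤ)) :=
  {w | IsPrudentPolygon w ∧ area (cells w) = n ∧ w.getLast? = some e}

theorem polygonsEndingAt_flip (n : ℕ) (e : ℤ × ℤ) :
    polygonsEndingAt n (flip e) = List.map flip '' polygonsEndingAt n e := by
  ext w
  constructor
  · rintro ⟨h1, h2, h3⟩
    refine ⟨w.map flip, ⟨h1.flip, by rw [h1.area_flip, h2], ?_⟩, map_flip_flip w⟩
    rw [List.getLast?_map, h3, Option.map_some, flip_flip]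
  · rintro ⟨w, ⟨h1, h2, h3⟩, rfl⟩
    refine ⟨h1.flip, by rw [h1.area_flip, h2], ?_⟩
    rw [List.getLast?_map, h3, Option.map_some]

theorem polygonsEndingAt_swap (n : ℕ) (e : ℤ × ℤ) :
    polygonsEndingAt n e.swap = List.map Prod.swap '' polygonsEndingAt n e := by
  ext w
  constructor
  · rintro ⟨h1, h2, h3⟩
    refine ⟨w.map Prod.swap, ⟨h1.swap, by rw [h1.area_swap, h2], ?_⟩, map_swap_swap w⟩
    rw [List.getLast?_map, h3, Option.map_some, Prod.swap_swap]
  · rintro ⟨w, ⟨h1, h2, h3⟩, rfl⟩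
    refine ⟨h1.swap, by rw [h1.area_swap, h2], ?_⟩
    rw [List.getLast?_map, h3, Option.map_some]

theorem flip_injective : Function.Injective flip := Function.Involutive.injective flip_flip

theorem polygonsEndingAt_left (n : ℕ) : (polygonsEndingAt n (-1, 0)).Finite ∧
    (polygonsEndingAt n (-1, 0)).ncard = 2 * (codesOfArea n).ncard := by
  have he : polygonsEndingAt n (-1, 0) =
      walk '' codesOfArea n ∪ List.map flip '' (walk '' codesOfArea n) := by
    ext w
    constructor
    · rintro ⟨h1, h2, h3⟩
      obtain ⟨c, hc, rfl | rfl⟩ := h1.exists_walk h3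
      · refine Or.inl ⟨c, ⟨hc, ?_⟩, rfl⟩
        rw [← h2, hc.cells_walk, area, hc.ncard_cellSet.2]
      · refine Or.inr ⟨_, ⟨c, ⟨hc, ?_⟩, rfl⟩, rfl⟩
        rw [← h2, hc.isPrudentPolygon_walk.area_flip, hc.cells_walk, area, hc.ncard_cellSet.2]
    · rintro (⟨c, ⟨hc, rfl⟩, rfl⟩ | ⟨_, ⟨c, ⟨hc, rfl⟩, rfl⟩, rfl⟩)
      · exact ⟨hc.isPrudentPolygon_walk, by rw [hc.cells_walk, area, hc.ncard_cellSet.2],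
          hc.getLast_walk⟩
      · refine ⟨hc.isPrudentPolygon_walk.flip, ?_, ?_⟩
        · rw [hc.isPrudentPolygon_walk.area_flip, hc.cells_walk, area, hc.ncard_cellSet.2]
        · rw [List.getLast?_map, hc.getLast_walk]; rfl
  have hfin : (walk '' codesOfArea n).Finite := (codesOfArea_finite n).image _
  rw [he]
  refine ⟨hfin.union (hfin.image _), ?_⟩
  rw [Set.ncard_union_eq ?_ hfin (hfin.image _),
    Set.ncard_image_of_injective _ (List.map_injective_iff.2 flip_injective),
    Set.InjOn.ncard_image (walk_injOn.mono fun c hc => hc.1)]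
  · omega
  · rw [Set.disjoint_left]
    rintro _ ⟨c, ⟨hc, -⟩, rfl⟩ ⟨_, ⟨d, ⟨hd, -⟩, rfl⟩, h⟩
    exact hd.not_isCounterclockwise_flip (h ▸ hc.isCounterclockwise_walk)

/-- Reflections carry the polygons ending at `(-1, 0)` to those with the other three end nodes, and
each end node contributes both orientations. -/
theorem polygons_of_area (n : ℕ) : {w | IsPrudentPolygon w ∧ area (cells w) = n}.Finite ∧
    {w | IsPrudentPolygon w ∧ area (cells w) = n}.ncard = 8 * (codesOfArea n).ncard := by
  have hl := polygonsEndingAt_left n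
  have hs : Function.Injective (List.map (Prod.swap : ℤ × ℤ → ℤ × ℤ)) :=
    List.map_injective_iff.2 Prod.swap_injective
  have hb : (polygonsEndingAt n (0, -1)).Finite ∧
      (polygonsEndingAt n (0, -1)).ncard = 2 * (codesOfArea n).ncard := by
    rw [show ((0, -1) : ℤ × ℤ) = Prod.swap (-1, 0) from rfl, polygonsEndingAt_swap,
      Set.ncard_image_of_injective _ hs]
    exact ⟨hl.1.image _, hl.2⟩
  have ht : (polygonsEndingAt n (0, 1)).Finite ∧
      (polygonsEndingAt n (0, 1)).ncard = 2 * (codesOfArea n).ncard := by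
    rw [show ((0, 1) : ℤ × ℤ) = flip (0, -1) from rfl, polygonsEndingAt_flip,
      Set.ncard_image_of_injective _ (List.map_injective_iff.2 flip_injective)]
    exact ⟨hb.1.image _, hb.2⟩
  have hr : (polygonsEndingAt n (1, 0)).Finite ∧
      (polygonsEndingAt n (1, 0)).ncard = 2 * (codesOfArea n).ncard := by
    rw [show ((1, 0) : ℤ × ℤ) = Prod.swap (0, 1) from rfl, polygonsEndingAt_swap,
      Set.ncard_image_of_injective _ hs]
    exact ⟨ht.1.image _, ht.2⟩
  have he : {w | IsPrudentPolygon w ∧ area (cells w) = n} =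
      (polygonsEndingAt n (-1, 0) ∪ polygonsEndingAt n (0, -1)) ∪
        (polygonsEndingAt n (0, 1) ∪ polygonsEndingAt n (1, 0)) := by
    ext w
    constructor
    · rintro ⟨h1, h2⟩
      have h1' := h1
      obtain ⟨-, -, -, ⟨a, b⟩, hp, hp1⟩ := h1'
      have hcase : |a| = 1 ∧ |b| = 0 ∨ |a| = 0 ∧ |b| = 1 := by
        have h1 := abs_nonneg a
        have h2 := abs_nonneg b
        dsimp only at hp1
        omega
      rw [abs_eq_zero, abs_eq_zero, abs_eq one_pos.le, abs_eq one_pos.le] at hcase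
      rcases hcase with ⟨rfl | rfl, rfl⟩ | ⟨rfl, rfl | rfl⟩
      · exact Or.inr (Or.inr ⟨h1, h2, hp⟩)
      · exact Or.inl (Or.inl ⟨h1, h2, hp⟩)
      · exact Or.inr (Or.inl ⟨h1, h2, hp⟩)
      · exact Or.inl (Or.inr ⟨h1, h2, hp⟩)
    · rintro ((h | h) | (h | h)) <;> exact ⟨h.1, h.2.1⟩
  have hd : ∀ e e', e ≠ e' → Disjoint (polygonsEndingAt n e) (polygonsEndingAt n e') := by
    intro e e' hne
    rw [Set.disjoint_left]
    rintro w ⟨-, -, h⟩ ⟨-, -, h'⟩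
    exact hne (Option.some.inj (h.symm.trans h'))
  rw [he]
  refine ⟨(hl.1.union hb.1).union (ht.1.union hr.1), ?_⟩
  rw [Set.ncard_union_eq ?_ (hl.1.union hb.1) (ht.1.union hr.1), Set.ncard_union_eq ?_ hl.1 hb.1,
    Set.ncard_union_eq ?_ ht.1 hr.1, hl.2, hb.2, ht.2, hr.2]
  · omega
  · exact hd _ _ (by decide)
  · exact hd _ _ (by decide)
  · rw [Set.disjoint_union_left, Set.disjoint_union_right, Set.disjoint_union_right]
    exact ⟨⟨hd _ _ (by decide), hd _ _ (by decide)⟩, hd _ _ (by decide), hd _ _ (by decide)⟩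

open MvPowerSeries

/-! ### Generating functions of weighted sets -/

/-- The exponent vector `(i, j, k)`. -/
noncomputable def expo (i j k : ℕ) : Fin 3 →₀ ℕ := Finsupp.equivFunOnFinite.symm ![i, j, k]

@[simp] theorem expo_zero (i j k : ℕ) : expo i j k 0 = i := rfl
@[simp] theorem expo_one (i j k : ℕ) : expo i j k 1 = j := rfl
@[simp] theorem expo_two (i j k : ℕ) : expo i j k 2 = k := rfl

theorem expo_ext {m n : Fin 3 →₀ ℕ} : m = n ↔ m 0 = n 0 ∧ m 1 = n 1 ∧ m 2 = n 2 := by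
  rw [Finsupp.ext_iff, Fin.forall_fin_succ, Fin.forall_fin_two]
  rfl

theorem expo_add (i j k i' j' k' : ℕ) :
    expo i j k + expo i' j' k' = expo (i + i') (j + j') (k + k') := by
  simp [expo_ext]

/-- The monomial `q ^ i * u ^ j * v ^ k`. -/
noncomputable def mono (i j k : ℕ) : MvPowerSeries (Fin 3) ℚ := monomial (expo i j k) 1

theorem X_zero_eq : (X 0 : MvPowerSeries (Fin 3) ℚ) = mono 1 0 0 := by
  rw [X_def, mono, show Finsupp.single (0 : Fin 3) 1 = expo 1 0 0 from expo_ext.2 (by simp)]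

theorem X_one_eq : (X 1 : MvPowerSeries (Fin 3) ℚ) = mono 0 1 0 := by
  rw [X_def, mono, show Finsupp.single (1 : Fin 3) 1 = expo 0 1 0 from expo_ext.2 (by simp)]

theorem X_two_eq : (X 2 : MvPowerSeries (Fin 3) ℚ) = mono 0 0 1 := by
  rw [X_def, mono, show Finsupp.single (2 : Fin 3) 1 = expo 0 0 1 from expo_ext.2 (by simp)]

theorem mono_mul_mono (i j k i' j' k' : ℕ) :
    mono i j k * mono i' j' k' = mono (i + i') (j + j') (k + k') := by
  rw [mono, mono, monomial_mul_monomial, expo_add, one_mul, mono]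

section gf

variable {α β : Type*}

/-- The generating function of the set `s`, where `q, u, v` mark the statistics `f, g, h`. -/
noncomputable def gf (s : Set α) (f g h : α → ℕ) : MvPowerSeries (Fin 3) ℚ := fun m =>
  ({a ∈ s | f a = m 0 ∧ g a = m 1 ∧ h a = m 2}.ncard : ℚ)

theorem coeff_gf (s : Set α) (f g h : α → ℕ) (m : Fin 3 →₀ ℕ) : coeff m (gf s f g h) =
    ({a ∈ s | f a = m 0 ∧ g a = m 1 ∧ h a = m 2}.ncard : ℚ) := rfl

/-- There are finitely many elements of `s` up to each value of the statistic `f`. -/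
def FiniteFibers (s : Set α) (f : α → ℕ) : Prop := ∀ n, {a ∈ s | f a ≤ n}.Finite

theorem FiniteFibers.mono {s t : Set α} {f f' : α → ℕ} (h : FiniteFibers s f) (hs : t ⊆ s)
    (hf : ∀ a, f a ≤ f' a) : FiniteFibers t f' := fun n =>
  (h n).subset fun a ha => ⟨hs ha.1, (hf a).trans ha.2⟩

theorem FiniteFibers.finite {s : Set α} {f : α → ℕ} (h : FiniteFibers s f) (n : ℕ) (P : α → Prop) :
    {a ∈ s | f a = n ∧ P a}.Finite := (h n).subset fun _ ha => ⟨ha.1, ha.2.1.le⟩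

theorem gf_congr {s : Set α} {f g h f' g' h' : α → ℕ} (hf : ∀ a ∈ s, f a = f' a)
    (hg : ∀ a ∈ s, g a = g' a) (hh : ∀ a ∈ s, h a = h' a) : gf s f g h = gf s f' g' h' := by
  ext m
  rw [coeff_gf, coeff_gf]
  congr 2
  ext a
  constructor
  · rintro ⟨h1, h2⟩; exact ⟨h1, by rwa [← hf a h1, ← hg a h1, ← hh a h1]⟩
  · rintro ⟨h1, h2⟩; exact ⟨h1, by rwa [hf a h1, hg a h1, hh a h1]⟩

theorem gf_union {s t : Set α} {f g h : α → ℕ} (hd : Disjoint s t) (hs : FiniteFibers s f)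
    (ht : FiniteFibers t f) : gf (s ∪ t) f g h = gf s f g h + gf t f g h := by
  ext m
  rw [map_add, coeff_gf, coeff_gf, coeff_gf, ← Nat.cast_add,
    ← Set.ncard_union_eq ?_ (hs.finite _ _) (ht.finite _ _)]
  · congr 2
    ext a
    exact or_and_right
  · exact hd.mono (fun a ha => ha.1) (fun a ha => ha.1)

theorem gf_image {s : Set α} {e : α → β} (he : Set.InjOn e s) (f g h : β → ℕ) :
    gf (e '' s) f g h = gf s (fun a => f (e a)) (fun a => g (e a)) (fun a => h (e a)) := by
  ext m
  rw [coeff_gf, coeff_gf, ← Set.InjOn.ncard_image (he.mono fun a ha => ha.1)]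
  congr 2
  ext b
  constructor
  · rintro ⟨⟨a, ha, rfl⟩, hb⟩; exact ⟨a, ⟨ha, hb⟩, rfl⟩
  · rintro ⟨a, ⟨ha, hb⟩, rfl⟩; exact ⟨⟨a, ha, rfl⟩, hb⟩

theorem gf_singleton (a : α) (f g h : α → ℕ) : gf {a} f g h = mono (f a) (g a) (h a) := by
  classical
  ext m
  rw [coeff_gf, mono, coeff_monomial]
  split_ifs with hm
  · subst hm
    rw [show {b ∈ ({a} : Set α) | f b = (expo (f a) (g a) (h a)) 0 ∧
      g b = (expo (f a) (g a) (h a)) 1 ∧ h b = (expo (f a) (g a) (h a)) 2} = {a} from ?_]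
    · simp
    · ext b
      constructor
      · exact fun hb => hb.1
      · rintro rfl; exact ⟨rfl, by simp⟩
  · rw [show {b ∈ ({a} : Set α) | f b = m 0 ∧ g b = m 1 ∧ h b = m 2} = ∅ from ?_]
    · simp
    · ext b
      simp only [Set.mem_empty_iff_false, iff_false]
      rintro ⟨rfl, h1, h2, h3⟩
      exact hm (expo_ext.2 ⟨h1.symm, h2.symm, h3.symm⟩)

theorem mono_mul_gf (i j k : ℕ) (s : Set α) (f g h : α → ℕ) : mono i j k * gf s f g h =
    gf s (fun a => f a + i) (fun a => g a + j) (fun a => h a + k) := by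
  classical
  ext m
  rw [mono, coeff_monomial_mul, one_mul, coeff_gf, coeff_gf]
  have hle : expo i j k ≤ m ↔ i ≤ m 0 ∧ j ≤ m 1 ∧ k ≤ m 2 := by
    rw [Finsupp.le_def, Fin.forall_fin_succ, Fin.forall_fin_two]
    rfl
  split_ifs with hm
  · rw [hle] at hm
    congr 2
    ext a
    simp only [Finsupp.coe_tsub, Pi.sub_apply, expo_zero, expo_one, expo_two]
    refine and_congr_right fun _ => ?_
    omega
  · rw [hle] at hm
    rw [show {a ∈ s | f a + i = m 0 ∧ g a + j = m 1 ∧ h a + k = m 2} = ∅ from ?_]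
    · simp
    · ext a
      simp only [Set.mem_empty_iff_false, iff_false]
      rintro ⟨-, h1, h2, h3⟩
      omega

theorem ncard_eq_finsum {t : Set α} (ht : t.Finite) (g : α → β) :
    (t.ncard : ℚ) = ∑ᶠ b, ({a ∈ t | g a = b}.ncard : ℚ) := by
  classical
  lift t to Finset α using ht
  have h1 : ∀ b, {a ∈ (t : Set α) | g a = b} = (t.filter fun a => g a = b : Finset α) := by
    intro b; ext a; simp
  rw [finsum_eq_sum_of_support_subset (s := t.image g)]
  · rw [Set.ncard_coe_finset,
      Finset.card_eq_sum_card_fiberwise (fun a ha => Finset.mem_image_of_mem g ha), Nat.cast_sum]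
    refine Finset.sum_congr rfl fun b _ => ?_
    rw [h1, Set.ncard_coe_finset]
  · intro b hb
    rw [Function.mem_support, h1, Set.ncard_coe_finset, Nat.cast_ne_zero, ← Nat.pos_iff_ne_zero,
      Finset.card_pos] at hb
    obtain ⟨a, ha⟩ := hb
    rw [Finset.mem_filter] at ha
    simpa using ⟨a, ha⟩

/-- A substitution of monomials acts linearly on the statistics. `hA` and `hB` exclude constant
terms, so that the substitution is defined; `hs` is needed because infinite sets have `ncard` zero.
-/
theorem substUV_gf {s : Set α} {f g h f' g' h' : α → ℕ} (hs : FiniteFibers s f')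
    (i j k i' j' k' : ℕ) (hA : i + j + k ≠ 0) (hB : i' + j' + k' ≠ 0)
    (hf : ∀ a ∈ s, f' a = f a + g a * i + h a * i') (hg : ∀ a ∈ s, g' a = g a * j + h a * j')
    (hh : ∀ a ∈ s, h' a = g a * k + h a * k') :
    substUV (gf s f g h) (mono i j k) (mono i' j' k') = gf s f' g' h' := by
  classical
  have hsub : HasSubst ![(X 0 : MvPowerSeries (Fin 3) ℚ), mono i j k, mono i' j' k'] := by
    refine hasSubst_of_constantCoeff_zero fun t => ?_
    have hc : ∀ i j k, i + j + k ≠ 0 → constantCoeff (mono i j k) = 0 := by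
      intro i j k hne
      rw [← coeff_zero_eq_constantCoeff_apply, mono, coeff_monomial, if_neg]
      intro h0
      rw [expo_ext] at h0
      simp at h0
      omega
    fin_cases t
    · exact constantCoeff_X 0
    · exact hc _ _ _ hA
    · exact hc _ _ _ hB
  have hprod : ∀ d : Fin 3 →₀ ℕ, (d.prod fun t e =>
      (![(X 0 : MvPowerSeries (Fin 3) ℚ), mono i j k, mono i' j' k'] t) ^ e) =
      mono (d 0 + d 1 * i + d 2 * i') (d 1 * j + d 2 * j') (d 1 * k + d 2 * k') := by
    have hpow : ∀ i j k n, mono i j k ^ n = mono (n * i) (n * j) (n * k) := by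
      intro i j k n
      induction n with
      | zero =>
        rw [pow_zero, mono, show expo (0 * i) (0 * j) (0 * k) = 0 by simp [expo_ext]]
        rfl
      | succ n ih =>
        rw [pow_succ, ih, mono_mul_mono]
        congr 1 <;> ring
    intro d
    rw [Finsupp.prod_fintype _ _ (by simp), Fin.prod_univ_three]
    change X 0 ^ d 0 * mono i j k ^ d 1 * mono i' j' k' ^ d 2 = _
    rw [X_zero_eq, hpow, hpow, hpow, mono_mul_mono, mono_mul_mono]
    congr 1 <;> ring
  -- The coefficient of a substitution is a sum over the old exponents `d`. It splits the objects of
  -- new exponent `e` according to their old exponent.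
  ext e
  rw [substUV, coeff_subst hsub, coeff_gf,
    ncard_eq_finsum (hs.finite _ _) fun a => expo (f a) (g a) (h a)]
  refine finsum_congr fun d => ?_
  rw [hprod, mono, coeff_monomial, coeff_gf]
  split_ifs with he
  · rw [smul_eq_mul, mul_one]
    congr 2
    subst he
    ext a
    constructor
    · rintro ⟨ha, h1, h2, h3⟩
      refine ⟨⟨ha, ?_⟩, expo_ext.2 ⟨h1, h2, h3⟩⟩
      rw [hf a ha, hg a ha, hh a ha, h1, h2, h3]
      simp
    · rintro ⟨⟨ha, -⟩, h1⟩
      exact ⟨ha, expo_ext.1 h1⟩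
  · rw [smul_zero, eq_comm, Nat.cast_eq_zero]
    rw [show {a ∈ {a ∈ s | f' a = e 0 ∧ g' a = e 1 ∧ h' a = e 2} | expo (f a) (g a) (h a) = d} = ∅
      from ?_, Set.ncard_empty]
    ext a
    simp only [Set.mem_empty_iff_false, iff_false]
    rintro ⟨⟨ha, h1, h2, h3⟩, rfl⟩
    refine he (expo_ext.2 ?_)
    rw [← h1, ← h2, ← h3, hf a ha, hg a ha, hh a ha]
    simp

theorem coeff_evalOne_gf {s : Set α} {f : α → ℕ} (hs : FiniteFibers s f) (g h : α → ℕ) (n : ℕ) :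
    PowerSeries.coeff n (evalOne (gf s f g h)) = ({a ∈ s | f a = n}.ncard : ℚ) := by
  rw [evalOne, PowerSeries.coeff_mk,
    ncard_eq_finsum ((hs n).subset fun a ha => ⟨ha.1, ha.2.le⟩) fun a => (g a, h a)]
  refine finsum_congr fun p => ?_
  rw [coeff_gf]
  congr 2
  ext a
  change _ ∧ _ = n ∧ _ = p.1 ∧ _ = p.2 ↔ (_ ∧ _) ∧ (g a, h a) = p
  rw [Prod.ext_iff, and_assoc]

/-- The pairs of an element `a` of `s` and a number `k` with `1 ≤ k ≤ n a`. -/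
def pairs (s : Set α) (n : α → ℕ) : Set (α × ℕ) := {p | p.1 ∈ s ∧ 1 ≤ p.2 ∧ p.2 ≤ n p.1}

theorem FiniteFibers.pairs {s : Set α} {f : α → ℕ} (hs : FiniteFibers s f) (n : α → ℕ) :
    FiniteFibers (pairs s n) fun p => f p.1 + p.2 := by
  intro m
  refine ((hs m).prod (Set.finite_Iic m)).subset ?_
  rintro ⟨a, k⟩ ⟨⟨h1, -⟩, h2⟩
  dsimp only at h1 h2
  exact ⟨⟨h1, show f a ≤ m by omega⟩, show k ≤ m by omega⟩

/-- A finite geometric sum without division: the pairs with `k` up to `n a + 1` are split off at the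
top value and, after a shift, at the bottom value. Comparing the two gives `(1 - q) G`. -/
theorem gf_pairs {s : Set α} {f : α → ℕ} (hs : FiniteFibers s f) (n g h : α → ℕ) :
    gf (pairs s n) (fun p => f p.1 + p.2) (fun p => g p.1) (fun p => h p.1) =
      X 0 * (1 - X 0)⁻¹ * (gf s f g h - gf s (fun a => f a + n a) g h) := by
  set G := gf (pairs s n) (fun p => f p.1 + p.2) (fun p => g p.1) (fun p => h p.1) with hG
  have hfin : ∀ n, FiniteFibers (PrudentPolygon.pairs s n) fun p => f p.1 + p.2 :=
    fun n => hs.pairs n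
  have e1 : pairs s (fun a => n a + 1) = pairs s n ∪ (fun a => (a, n a + 1)) '' s := by
    ext ⟨a, k⟩
    simp only [pairs, Set.mem_ofPred_eq, Set.mem_union, Set.mem_image, Prod.mk.injEq]
    constructor
    · rintro ⟨h1, h2, h3⟩
      by_cases hk : k ≤ n a
      · exact Or.inl ⟨h1, h2, hk⟩
      · exact Or.inr ⟨a, h1, rfl, by omega⟩
    · rintro (⟨h1, h2, h3⟩ | ⟨b, hb, rfl, rfl⟩)
      · exact ⟨h1, h2, by omega⟩
      · exact ⟨hb, by omega, le_rfl⟩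
  have e2 : pairs s (fun a => n a + 1) =
      (fun p : α × ℕ => (p.1, p.2 + 1)) '' pairs s n ∪ (fun a => (a, 1)) '' s := by
    ext ⟨a, k⟩
    simp only [pairs, Set.mem_ofPred_eq, Set.mem_union, Set.mem_image, Prod.mk.injEq, Prod.exists]
    constructor
    · rintro ⟨h1, h2, h3⟩
      by_cases hk : k = 1
      · exact Or.inr ⟨a, h1, rfl, hk.symm⟩
      · exact Or.inl ⟨a, k - 1, ⟨h1, by omega, by omega⟩, rfl, by omega⟩
    · rintro (⟨b, m, ⟨h1, h2, h3⟩, rfl, rfl⟩ | ⟨b, hb, rfl, rfl⟩)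
      · exact ⟨h1, by omega, by omega⟩
      · exact ⟨hb, by omega, by omega⟩
  have i1 : Set.InjOn (fun a => (a, n a + 1)) s := fun a _ b _ hab => (Prod.mk.inj hab).1
  have i2 : Set.InjOn (fun a : α => (a, 1)) s := fun a _ b _ hab => (Prod.mk.inj hab).1
  have i3 : Set.InjOn (fun p : α × ℕ => (p.1, p.2 + 1)) (pairs s n) := by
    rintro ⟨a, k⟩ _ ⟨b, m⟩ _ hab
    simp only [Prod.mk.injEq, add_left_inj] at hab ⊢
    exact hab
  have k1 : gf (pairs s fun a => n a + 1) (fun p => f p.1 + p.2) (fun p => g p.1) (fun p => h p.1) =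
      G + X 0 * gf s (fun a => f a + n a) g h := by
    rw [e1, gf_union ?_ (hfin _)
      ((hfin fun a => n a + 1).mono (e1 ▸ Set.subset_union_right) fun _ => le_rfl),
      gf_image i1, X_zero_eq, mono_mul_gf]
    · rfl
    · rw [Set.disjoint_left]
      rintro _ ⟨-, -, h3⟩ ⟨a, ha, rfl⟩
      dsimp only at h3; omega
  have k2 : gf (pairs s fun a => n a + 1) (fun p => f p.1 + p.2) (fun p => g p.1) (fun p => h p.1) =
      X 0 * G + X 0 * gf s f g h := by
    rw [e2, gf_union ?_ ((hfin fun a => n a + 1).mono (e2 ▸ Set.subset_union_left) fun _ => le_rfl)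
      ((hfin fun a => n a + 1).mono (e2 ▸ Set.subset_union_right) fun _ => le_rfl),
      gf_image i3, gf_image i2, X_zero_eq, mono_mul_gf, mono_mul_gf]
    · rfl
    · rw [Set.disjoint_left]
      rintro _ ⟨⟨a, k⟩, ⟨-, h2, -⟩, rfl⟩ ⟨b, -, hb⟩
      simp only [Prod.mk.injEq] at hb
      dsimp only at h2; omega
  -- `⁻¹` is a true inverse only for a series with nonzero constant coefficient.
  have hc : constantCoeff (1 - X 0 : MvPowerSeries (Fin 3) ℚ) ≠ 0 := by simp
  rw [mul_right_comm, MvPowerSeries.eq_mul_inv_iff_mul_eq hc]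
  linear_combination k2 - k1

end gf

/-! ### The functional equations -/

/-- The codes of class `𝒳`. -/
def codesX : Set Code := {c | c.Valid ∧ c.isX}

/-- The codes of class `𝒴`. -/
def codesY : Set Code := {c | c.Valid ∧ ¬ c.isX ∧ ¬ c.isZ}

/-- The codes of class `𝒵`. -/
def codesZ : Set Code := {c | c.Valid ∧ c.isZ}

theorem codesY_union_codesZ : codesY ∪ codesZ = {c | c.Valid ∧ ¬ c.isX} := by
  ext c
  have := @not_isX_of_isZ c
  simp only [codesY, codesZ, Set.mem_union, Set.mem_ofPred_eq]
  tauto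

theorem codes_union : codesX ∪ (codesY ∪ codesZ) = {c | c.Valid} := by
  ext c
  rw [codesY_union_codesZ]
  simp only [codesX, Set.mem_union, Set.mem_ofPred_eq]
  tauto

theorem disjoint_codesY_codesZ : Disjoint codesY codesZ :=
  Set.disjoint_left.2 fun _ h h' => h.2.2 h'.2

theorem disjoint_codesX : Disjoint codesX (codesY ∪ codesZ) := by
  rw [codesY_union_codesZ]
  exact Set.disjoint_left.2 fun _ h h' => h'.2 h.2

theorem finiteFibers_valid : FiniteFibers {c | c.Valid} ar := by
  intro n
  refine ((Set.finite_Iic n).biUnion fun m _ => codesOfArea_finite m).subset ?_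
  rintro c ⟨h1, h2⟩
  exact Set.mem_biUnion (show c.ar ∈ Set.Iic n from h2) ⟨h1, rfl⟩

theorem finiteFibers_codes {s : Set Code} (hs : s ⊆ {c | c.Valid}) {f : Code → ℕ}
    (hf : ∀ c, c.ar ≤ f c) : FiniteFibers s f := finiteFibers_valid.mono hs hf

theorem codesX_subset : codesX ⊆ {c | c.Valid} := fun _ h => h.1
theorem codesY_subset : codesY ⊆ {c | c.Valid} := fun _ h => h.1
theorem codesZ_subset : codesZ ⊆ {c | c.Valid} := fun _ h => h.1

theorem gf_valid {f : Code → ℕ} (hf : ∀ c, c.ar ≤ f c) (g h : Code → ℕ) :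
    gf {c | c.Valid} f g h = gf codesX f g h + (gf codesY f g h + gf codesZ f g h) := by
  have hY := finiteFibers_codes codesY_subset hf
  have hZ := finiteFibers_codes codesZ_subset hf
  rw [← codes_union, gf_union disjoint_codesX (finiteFibers_codes codesX_subset hf)
    (finiteFibers_codes (Set.union_subset codesY_subset codesZ_subset) hf),
    gf_union disjoint_codesY_codesZ hY hZ]

theorem gf_not_isX {f : Code → ℕ} (hf : ∀ c, c.ar ≤ f c) (g h : Code → ℕ) :
    gf {c | c.Valid ∧ ¬ c.isX} f g h = gf codesY f g h + gf codesZ f g h := by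
  rw [← codesY_union_codesZ, gf_union disjoint_codesY_codesZ
    (finiteFibers_codes codesY_subset hf) (finiteFibers_codes codesZ_subset hf)]

theorem codesX_eq : codesX = (fun p : Code × ℕ => row p.1 p.2) '' pairs {c | c.Valid} wd := by
  ext c
  constructor
  · rintro ⟨h1, h2⟩
    cases c with
    | row c k => exact ⟨(c, k), ⟨h1.1, h1.2.1, h2⟩, rfl⟩
    | _ => exact h2.elim
  · rintro ⟨⟨c, k⟩, ⟨h1, h2, h3⟩, rfl⟩
    exact ⟨⟨h1, h2, Nat.le_succ_of_le h3⟩, h3⟩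

theorem codesY_eq : codesY = ({sq} ∪ (fun c : Code => row c (c.wd + 1)) '' {c | c.Valid}) ∪
    (fun p : Code × ℕ => col p.1 p.2) '' pairs {c | c.Valid ∧ ¬ c.isX} ht := by
  ext c
  constructor
  · rintro ⟨h1, h2, h3⟩
    cases c with
    | sq => exact Or.inl (Or.inl rfl)
    | row c k =>
      obtain ⟨h1, -, h4⟩ := h1
      rw [isX_row] at h2
      obtain rfl : k = c.wd + 1 := by omega
      exact Or.inl (Or.inr ⟨c, h1, rfl⟩)
    | col c k =>
      obtain ⟨h1, h4, h5, -⟩ := h1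
      rw [isZ_col] at h3
      exact Or.inr ⟨(c, k), ⟨⟨h1, h4⟩, h5, not_lt.1 h3⟩, rfl⟩
    | bot c k => exact (h3 trivial).elim
  · rintro ((rfl | ⟨c, h1, rfl⟩) | ⟨⟨c, k⟩, ⟨⟨h1, h4⟩, h2, h3⟩, rfl⟩)
    · exact ⟨trivial, id, id⟩
    · exact ⟨⟨h1, by omega, le_rfl⟩, by rw [isX_row]; omega, id⟩
    · exact ⟨⟨h1, h4, h2, Nat.le_succ_of_le h3⟩, id, by rw [isZ_col]; exact not_lt.2 h3⟩

theorem codesZ_eq : codesZ = (fun c : Code => col c (c.ht + 1)) '' {c | c.Valid ∧ ¬ c.isX} ∪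
    (fun p : Code × ℕ => bot p.1 p.2) '' pairs codesZ (fun c => c.wd - 1) := by
  ext c
  constructor
  · rintro ⟨h1, h2⟩
    cases c with
    | sq => exact h2.elim
    | row c k => exact h2.elim
    | col c k =>
      obtain ⟨h1, h4, h5, h6⟩ := h1
      rw [isZ_col] at h2
      obtain rfl : k = c.ht + 1 := by omega
      exact Or.inl ⟨c, ⟨h1, h4⟩, rfl⟩
    | bot c k =>
      obtain ⟨h1, h4, h5, h6⟩ := h1
      exact Or.inr ⟨(c, k), ⟨⟨h1, h4⟩, h5, Nat.le_sub_one_of_lt h6⟩, rfl⟩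
  · rintro (⟨c, ⟨h1, h4⟩, rfl⟩ | ⟨⟨c, k⟩, ⟨⟨h1, h4⟩, h2, h3⟩, rfl⟩)
    · exact ⟨⟨h1, h4, by omega, le_rfl⟩, by rw [isZ_col]; omega⟩
    · dsimp only at h2 h3
      exact ⟨⟨h1, h4, h2, show k + 1 ≤ c.wd by omega⟩, trivial⟩

/-- Any polygon may receive a top row of 1 up to `wd` cells, which raises only the height. -/
theorem gf_codesX_eq : gf codesX ar wd ht = X 2 * (X 0 * (1 - X 0)⁻¹ *
    (gf {c | c.Valid} ar wd ht - gf {c | c.Valid} (fun c => c.ar + c.wd) wd ht)) := by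
  rw [← gf_pairs finiteFibers_valid, X_two_eq, mono_mul_gf]
  nth_rw 1 [codesX_eq]
  rw [gf_image fun a _ b _ h => Prod.ext (row.inj h).1 (row.inj h).2]
  exact gf_congr (fun _ _ => rfl) (fun p h => max_eq_left h.2.2) fun _ _ => rfl

/-- The three kinds are the unit square, the top rows protruding by one cell, and the right columns
within the height of a polygon outside class X. -/
theorem gf_codesY_eq : gf codesY ar ht wd = X 0 * X 1 * X 2 +
    X 0 * X 1 * X 2 * gf {c | c.Valid} (fun c => c.ar + c.wd) ht wd + X 2 * (X 0 * (1 - X 0)⁻¹ *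
    (gf {c | c.Valid ∧ ¬ c.isX} ar ht wd -
      gf {c | c.Valid ∧ ¬ c.isX} (fun c => c.ar + c.ht) ht wd)) := by
  have hsub : {c : Code | c.Valid ∧ ¬ c.isX} ⊆ {c | c.Valid} := fun _ h => h.1
  have hY := codesY_subset
  rw [codesY_eq] at hY
  rw [← gf_pairs (finiteFibers_codes hsub fun _ => le_rfl), X_zero_eq, X_one_eq, X_two_eq,
    mono_mul_mono, mono_mul_mono, mono_mul_gf, mono_mul_gf]
  nth_rw 1 [codesY_eq]
  rw [gf_union ?_ (finiteFibers_codes (Set.subset_union_left.trans hY) fun _ => le_rfl)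
      (finiteFibers_codes (Set.subset_union_right.trans hY) fun _ => le_rfl),
    gf_union ?_ (finiteFibers_codes ((Set.subset_union_left.trans Set.subset_union_left).trans hY)
        fun _ => le_rfl)
      (finiteFibers_codes ((Set.subset_union_right.trans Set.subset_union_left).trans hY)
        fun _ => le_rfl),
    gf_singleton, gf_image fun a _ b _ h => (row.inj h).1,
    gf_image fun a _ b _ h => Prod.ext (col.inj h).1 (col.inj h).2]
  · congr 1
    · congr 1
      exact gf_congr (fun _ _ => rfl) (fun _ _ => rfl) fun c _ => max_eq_right (Nat.le_succ _)
    · exact gf_congr (fun _ _ => rfl) (fun p h => max_eq_left h.2.2) fun _ _ => rfl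
  · rw [Set.disjoint_left]
    rintro _ rfl ⟨c, -, h⟩
    cases h
  · rw [Set.disjoint_left]
    rintro _ (rfl | ⟨c, -, rfl⟩) ⟨p, -, h⟩ <;> cases h

/-- A protruding column increases the width by one, so width minus one of the result is the full
width of its predecessor. A bottom row leaves the width unchanged and has at most `wd - 1` cells. -/
theorem gf_codesZ_eq : gf codesZ ar (fun c => c.wd - 1) ht =
    X 0 * X 2 * gf {c | c.Valid ∧ ¬ c.isX} (fun c => c.ar + c.ht) wd ht + X 2 * (X 0 * (1 - X 0)⁻¹ *
    (gf codesZ ar (fun c => c.wd - 1) ht -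
      gf codesZ (fun c => c.ar + (c.wd - 1)) (fun c => c.wd - 1) ht)) := by
  have hZ := codesZ_subset
  rw [codesZ_eq] at hZ
  rw [← gf_pairs (finiteFibers_codes codesZ_subset fun _ => le_rfl), X_zero_eq, X_two_eq,
    mono_mul_mono, mono_mul_gf, mono_mul_gf]
  nth_rw 1 [codesZ_eq]
  rw [gf_union ?_ (finiteFibers_codes (Set.subset_union_left.trans hZ) fun _ => le_rfl)
      (finiteFibers_codes (Set.subset_union_right.trans hZ) fun _ => le_rfl),
    gf_image fun a _ b _ h => (col.inj h).1,
    gf_image fun a _ b _ h => Prod.ext (bot.inj h).1 (bot.inj h).2]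
  · congr 1
    exact gf_congr (fun _ _ => rfl) (fun _ _ => rfl) fun c _ => max_eq_right (Nat.le_succ _)
  · rw [Set.disjoint_left]
    rintro _ ⟨c, -, rfl⟩ ⟨p, -, h⟩
    cases h

/-! ### Transfer to the generating functions of the walks -/

theorem Code.Valid.area_cells {c : Code} (h : c.Valid) : area (cells c.walk) = c.ar := by
  rw [h.cells_walk]
  exact h.ncard_cellSet.2

theorem Code.Valid.width_cells {c : Code} (h : c.Valid) : width (cells c.walk) = c.wd := by
  rw [h.cells_walk, h.width_cellSet]

theorem Code.Valid.height_cells {c : Code} (h : c.Valid) : height (cells c.walk) = c.ht := by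
  rw [h.cells_walk, h.height_cellSet]

theorem genX_eq : genX = gf codesX ar wd ht := by
  ext m
  rw [coeff_gf]
  refine congrArg Nat.cast (ncard_walks (fun w hw => hw.1.1)
    (fun c => c.isX ∧ c.ar = m 0 ∧ c.wd = m 1 ∧ c.ht = m 2) fun c hc => ?_) |>.trans ?_
  · rw [Set.mem_ofPred_eq, hc.walk_mem_classX_iff, hc.area_cells, hc.width_cells, hc.height_cells]
  · congr 2
    ext c
    exact and_assoc.symm

theorem genY_eq : genY = gf codesY ar ht wd := by
  ext m
  rw [coeff_gf]
  refine congrArg Nat.cast (ncard_walks (fun w hw => hw.1.1)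
    (fun c => (¬ c.isX ∧ ¬ c.isZ) ∧ c.ar = m 0 ∧ c.ht = m 1 ∧ c.wd = m 2)
      fun c hc => ?_) |>.trans ?_
  · rw [Set.mem_ofPred_eq, hc.walk_mem_classY_iff, hc.area_cells, hc.width_cells, hc.height_cells]
  · congr 2
    ext c
    exact and_assoc.symm

theorem genZ_eq : genZ = gf codesZ ar (fun c => c.wd - 1) ht := by
  ext m
  rw [coeff_gf]
  refine congrArg Nat.cast (ncard_walks (fun w hw => hw.1.1)
    (fun c => c.isZ ∧ c.ar = m 0 ∧ c.wd - 1 = m 1 ∧ c.ht = m 2) fun c hc => ?_) |>.trans ?_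
  · rw [Set.mem_ofPred_eq, hc.walk_mem_classZ_iff, hc.area_cells, hc.width_cells, hc.height_cells]
    have := hc.one_le_wd
    refine and_congr_right fun _ => and_congr_right fun _ => and_congr_left fun _ => ?_
    omega
  · congr 2
    ext c
    exact and_assoc.symm

theorem genX_functional_equation : genX =
    X 0 * X 2 * (1 - X 0)⁻¹ * (genX - substUV genX (X 0 * X 1) (X 2))
      + X 0 * X 2 * (1 - X 0)⁻¹ * (substUV genY (X 2) (X 1) - substUV genY (X 2) (X 0 * X 1))
      + X 0 * X 1 * X 2 * (1 - X 0)⁻¹ * (genZ - X 0 * substUV genZ (X 0 * X 1) (X 2)) := by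
  have h1 : substUV genX (X 0 * X 1) (X 2) = gf codesX (fun c => c.ar + c.wd) wd ht := by
    rw [genX_eq, X_zero_eq, X_one_eq, X_two_eq, mono_mul_mono]
    refine substUV_gf (finiteFibers_codes codesX_subset fun c => ?_) _ _ _ _ _ _ (by omega)
      (by omega) ?_ ?_ ?_ <;> intros <;> omega
  have h2 : substUV genY (X 2) (X 1) = gf codesY ar wd ht := by
    rw [genY_eq, X_one_eq, X_two_eq]
    refine substUV_gf (finiteFibers_codes codesY_subset fun c => ?_) _ _ _ _ _ _ (by omega)
      (by omega) ?_ ?_ ?_ <;> intros <;> omega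
  have h3 : substUV genY (X 2) (X 0 * X 1) = gf codesY (fun c => c.ar + c.wd) wd ht := by
    rw [genY_eq, X_zero_eq, X_one_eq, X_two_eq, mono_mul_mono]
    refine substUV_gf (finiteFibers_codes codesY_subset fun c => ?_) _ _ _ _ _ _ (by omega)
      (by omega) ?_ ?_ ?_ <;> intros <;> omega
  -- `genZ` marks the width minus one, so passing to the full width costs one more factor of the
  -- marking monomial, here and in `h5`.
  have h4 : gf codesZ ar wd ht = X 1 * genZ := by
    rw [genZ_eq, X_one_eq, mono_mul_gf]
    refine gf_congr (fun _ _ => rfl) (fun c hc => ?_) fun _ _ => rfl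
    have := hc.1.one_le_wd
    omega
  have h5 : gf codesZ (fun c => c.ar + c.wd) wd ht =
      X 0 * X 1 * substUV genZ (X 0 * X 1) (X 2) := by
    rw [genZ_eq, X_zero_eq, X_one_eq, X_two_eq, mono_mul_mono,
      substUV_gf (f' := fun c => c.ar + (c.wd - 1)) (g' := fun c => c.wd - 1) (h' := ht)
        (finiteFibers_codes codesZ_subset fun c => ?_) _ _ _ _ _ _ (by omega) (by omega)
        (fun c _ => ?_) (fun c _ => ?_) (fun c _ => ?_), mono_mul_gf]
    · refine gf_congr (fun c hc => ?_) (fun c hc => ?_) fun _ _ => rfl <;>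
      · have := hc.1.one_le_wd
        omega
    all_goals omega
  have h := gf_codesX_eq
  rw [gf_valid (fun _ => le_rfl), gf_valid (fun c => Nat.le_add_right _ _), ← genX_eq, ← h1, ← h2,
    ← h3, h4, h5] at h
  linear_combination h

theorem genY_functional_equation : genY = X 0 * X 1 * X 2
      + X 0 * X 2 * (1 - X 0)⁻¹ * (genY - substUV genY (X 0 * X 1) (X 2))
      + X 0 * X 2 ^ 2 * (1 - X 0)⁻¹ * (substUV genZ (X 2) (X 1) - substUV genZ (X 2) (X 0 * X 1))
      + X 0 * X 1 * X 2 * (substUV genX (X 0 * X 2) (X 1) + substUV genY (X 1) (X 0 * X 2)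
        + X 0 * X 2 * substUV genZ (X 0 * X 2) (X 1)) := by
  have h1 : substUV genY (X 0 * X 1) (X 2) = gf codesY (fun c => c.ar + c.ht) ht wd := by
    rw [genY_eq, X_zero_eq, X_one_eq, X_two_eq, mono_mul_mono]
    refine substUV_gf (finiteFibers_codes codesY_subset fun c => ?_) _ _ _ _ _ _ (by omega)
      (by omega) ?_ ?_ ?_ <;> intros <;> omega
  have h2 : gf codesZ ar ht wd = X 2 * substUV genZ (X 2) (X 1) := by
    rw [genZ_eq, X_one_eq, X_two_eq,
      substUV_gf (f' := ar) (g' := ht) (h' := fun c => c.wd - 1)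
        (finiteFibers_codes codesZ_subset fun c => ?_) _ _ _ _ _ _ (by omega) (by omega)
        (fun c _ => ?_) (fun c _ => ?_) (fun c _ => ?_), mono_mul_gf]
    · refine gf_congr (fun c hc => ?_) (fun c hc => ?_) (fun c hc => ?_) <;>
      · have := hc.1.one_le_wd
        omega
    all_goals omega
  have h3 : gf codesZ (fun c => c.ar + c.ht) ht wd = X 2 * substUV genZ (X 2) (X 0 * X 1) := by
    rw [genZ_eq, X_zero_eq, X_one_eq, X_two_eq, mono_mul_mono,
      substUV_gf (f' := fun c => c.ar + c.ht) (g' := ht) (h' := fun c => c.wd - 1)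
        (finiteFibers_codes codesZ_subset fun c => ?_) _ _ _ _ _ _ (by omega) (by omega)
        (fun c _ => ?_) (fun c _ => ?_) (fun c _ => ?_), mono_mul_gf]
    · refine gf_congr (fun c hc => ?_) (fun c hc => ?_) (fun c hc => ?_) <;>
      · have := hc.1.one_le_wd
        omega
    all_goals omega
  have h4 : substUV genX (X 0 * X 2) (X 1) = gf codesX (fun c => c.ar + c.wd) ht wd := by
    rw [genX_eq, X_zero_eq, X_one_eq, X_two_eq, mono_mul_mono]
    refine substUV_gf (finiteFibers_codes codesX_subset fun c => ?_) _ _ _ _ _ _ (by omega)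
      (by omega) ?_ ?_ ?_ <;> intros <;> omega
  have h5 : substUV genY (X 1) (X 0 * X 2) = gf codesY (fun c => c.ar + c.wd) ht wd := by
    rw [genY_eq, X_zero_eq, X_one_eq, X_two_eq, mono_mul_mono]
    refine substUV_gf (finiteFibers_codes codesY_subset fun c => ?_) _ _ _ _ _ _ (by omega)
      (by omega) ?_ ?_ ?_ <;> intros <;> omega
  have h6 : gf codesZ (fun c => c.ar + c.wd) ht wd =
      X 0 * X 2 * substUV genZ (X 0 * X 2) (X 1) := by
    rw [genZ_eq, X_zero_eq, X_one_eq, X_two_eq, mono_mul_mono,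
      substUV_gf (f' := fun c => c.ar + (c.wd - 1)) (g' := ht) (h' := fun c => c.wd - 1)
        (finiteFibers_codes codesZ_subset fun c => ?_) _ _ _ _ _ _ (by omega) (by omega)
        (fun c _ => ?_) (fun c _ => ?_) (fun c _ => ?_), mono_mul_gf]
    · refine gf_congr (fun c hc => ?_) (fun c hc => ?_) (fun c hc => ?_) <;>
      · have := hc.1.one_le_wd
        omega
    all_goals omega
  have h := gf_codesY_eq
  rw [gf_valid (fun c => Nat.le_add_right _ _), gf_not_isX (fun _ => le_rfl),
    gf_not_isX (fun c => Nat.le_add_right _ _), ← genY_eq, ← h1, h2, h3, ← h4, ← h5, h6] at h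
  linear_combination h

theorem genZ_functional_equation : genZ =
    X 0 * X 2 * (1 - X 0)⁻¹ * (genZ - substUV genZ (X 0 * X 1) (X 2))
      + X 0 * X 2 * substUV genY (X 0 * X 2) (X 1)
      + X 0 * X 1 * X 2 * substUV genZ (X 1) (X 0 * X 2) := by
  have h1 : substUV genZ (X 0 * X 1) (X 2) =
      gf codesZ (fun c => c.ar + (c.wd - 1)) (fun c => c.wd - 1) ht := by
    rw [genZ_eq, X_zero_eq, X_one_eq, X_two_eq, mono_mul_mono]
    refine substUV_gf (finiteFibers_codes codesZ_subset fun c => ?_) _ _ _ _ _ _ (by omega)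
      (by omega) ?_ ?_ ?_ <;> intros <;> omega
  have h2 : substUV genY (X 0 * X 2) (X 1) = gf codesY (fun c => c.ar + c.ht) wd ht := by
    rw [genY_eq, X_zero_eq, X_one_eq, X_two_eq, mono_mul_mono]
    refine substUV_gf (finiteFibers_codes codesY_subset fun c => ?_) _ _ _ _ _ _ (by omega)
      (by omega) ?_ ?_ ?_ <;> intros <;> omega
  have h3 : gf codesZ (fun c => c.ar + c.ht) wd ht = X 1 * substUV genZ (X 1) (X 0 * X 2) := by
    rw [genZ_eq, X_zero_eq, X_one_eq, X_two_eq, mono_mul_mono,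
      substUV_gf (f' := fun c => c.ar + c.ht) (g' := fun c => c.wd - 1) (h' := ht)
        (finiteFibers_codes codesZ_subset fun c => ?_) _ _ _ _ _ _ (by omega) (by omega)
        (fun c _ => ?_) (fun c _ => ?_) (fun c _ => ?_), mono_mul_gf]
    · refine gf_congr (fun c hc => ?_) (fun c hc => ?_) (fun c hc => ?_) <;>
      · have := hc.1.one_le_wd
        omega
    all_goals omega
  have h := gf_codesZ_eq
  rw [gf_not_isX (fun c => Nat.le_add_right _ _), ← genZ_eq, ← h1, ← h2, h3] at h
  linear_combination h

/-! ### The series of all prudent polygons -/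

theorem coeff_genPA (n : ℕ) : PowerSeries.coeff n genPA = 8 * ((codesOfArea n).ncard : ℚ) := by
  rw [genPA, PowerSeries.coeff_mk, (polygons_of_area n).2]
  push_cast
  rfl

theorem genPA_eq : genPA = 8 * (evalOne genX + evalOne genY + evalOne genZ) := by
  have hdisj : ∀ {s t : Set Code} (n : ℕ), Disjoint s t →
      Disjoint {c ∈ s | c.ar = n} {c ∈ t | c.ar = n} := fun n h =>
    h.mono (fun _ h => h.1) fun _ h => h.1
  have hfin : ∀ {s : Set Code} (n : ℕ), s ⊆ {c | c.Valid} → {c ∈ s | c.ar = n}.Finite :=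
    fun n h => (codesOfArea_finite n).subset fun c hc => ⟨h hc.1, hc.2⟩
  ext n
  have h8 : (8 : PowerSeries ℚ) = PowerSeries.C 8 := (map_ofNat PowerSeries.C 8).symm
  rw [h8, PowerSeries.coeff_C_mul, map_add, map_add, genX_eq, genY_eq, genZ_eq,
    coeff_evalOne_gf (finiteFibers_codes codesX_subset fun _ => le_rfl),
    coeff_evalOne_gf (finiteFibers_codes codesY_subset fun _ => le_rfl),
    coeff_evalOne_gf (finiteFibers_codes codesZ_subset fun _ => le_rfl), coeff_genPA, add_assoc,
    ← Nat.cast_add, ← Set.ncard_union_eq (hdisj n disjoint_codesY_codesZ)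
      (hfin n codesY_subset) (hfin n codesZ_subset), ← Nat.cast_add, ← Set.ncard_union_eq ?_
      (hfin n codesX_subset) ((hfin n codesY_subset).union (hfin n codesZ_subset))]
  · congr 3
    ext c
    have := Set.ext_iff.1 codes_union c
    simp only [codesOfArea, Set.mem_union, Set.mem_ofPred_eq] at this ⊢
    tauto
  · rw [Set.disjoint_left]
    rintro c ⟨h1, -⟩ (⟨h2, -⟩ | ⟨h2, -⟩)
    · exact Set.disjoint_left.1 disjoint_codesX h1 (Or.inl h2)
    · exact Set.disjoint_left.1 disjoint_codesX h1 (Or.inr h2)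

/-! ### Enumeration of the codes of small area -/

namespace Code

instance : DecidablePred isX
  | sq => isFalse id
  | row c k => Nat.decLe k c.wd
  | col _ _ => isFalse id
  | bot _ _ => isFalse id

instance : DecidablePred isZ
  | sq => isFalse id
  | row _ _ => isFalse id
  | col c k => Nat.decLt c.ht k
  | bot _ _ => isTrue trivial

/-- The codes obtained from `c` by adding a row or column of `k` cells. -/
def extensions (c : Code) (k : ℕ) : List Code :=
  (if k ≤ c.wd + 1 then [row c k] else []) ++ (if ¬ c.isX ∧ k ≤ c.ht + 1 then [col c k] else []) ++
    if c.isZ ∧ k + 1 ≤ c.wd then [bot c k] else []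

/-- The list of the codes of area `n`, with recursion depth at most `t`. -/
def enum : ℕ → ℕ → List Code
  | 0, _ => []
  | t + 1, n => (if n = 1 then [sq] else []) ++
      (List.range n).flatMap fun i => (enum t i).flatMap fun c => c.extensions (n - i)

/-- The code before the last addition. -/
def parent : Code → Code
  | sq => sq
  | row c _ => c
  | col c _ => c
  | bot c _ => c

theorem mem_extensions {c d : Code} {k : ℕ} : d ∈ c.extensions k ↔
    (k ≤ c.wd + 1 ∧ d = row c k) ∨ (¬ c.isX ∧ k ≤ c.ht + 1 ∧ d = col c k) ∨
      (c.isZ ∧ k + 1 ≤ c.wd ∧ d = bot c k) := by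
  have aux : ∀ (p : Prop) [Decidable p] (e : Code), (d ∈ if p then [e] else []) ↔ p ∧ d = e := by
    intro p _ e
    split_ifs with h <;> simp [h]
  rw [extensions, List.mem_append, List.mem_append, aux, aux, aux, or_assoc, and_assoc, and_assoc]

theorem parent_of_mem_extensions {c d : Code} {k : ℕ} (h : d ∈ c.extensions k) : d.parent = c := by
  rw [mem_extensions] at h
  rcases h with ⟨-, rfl⟩ | ⟨-, -, rfl⟩ | ⟨-, -, rfl⟩ <;> rfl

theorem nodup_extensions (c : Code) (k : ℕ) : (c.extensions k).Nodup := by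
  rw [extensions]
  split_ifs <;> simp

/-- Every addition increases the area, so recursion depth `n` reaches all codes of area `n`. The
added length `n - i` is positive because `i < n`, which is why `extensions` does not test it. -/
theorem mem_enum {t n : ℕ} (h : n ≤ t) (c : Code) : c ∈ enum t n ↔ c.Valid ∧ c.ar = n := by
  induction t generalizing n c with
  | zero =>
    obtain rfl : n = 0 := by omega
    refine ⟨fun h => absurd h (by simp [enum]), fun h => ?_⟩
    have := h.1.one_le_ar
    omega
  | succ t ih =>
    have hsq : (c ∈ if n = 1 then [sq] else []) ↔ n = 1 ∧ c = sq := by split_ifs with h <;> simp [h]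
    have hrec : (c ∈ (List.range n).flatMap fun i => (enum t i).flatMap fun c =>
        c.extensions (n - i)) ↔ ∃ d : Code, d.Valid ∧ d.ar < n ∧ c ∈ d.extensions (n - d.ar) := by
      simp only [List.mem_flatMap, List.mem_range]
      constructor
      · rintro ⟨i, hi, d, hd, hc⟩
        obtain ⟨h1, rfl⟩ := (ih (by omega) d).1 hd
        exact ⟨d, h1, hi, hc⟩
      · rintro ⟨d, h1, h2, h3⟩
        exact ⟨d.ar, h2, d, (ih (by omega) d).2 ⟨h1, rfl⟩, h3⟩
    rw [enum, List.mem_append, hsq, hrec]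
    constructor
    · rintro (⟨rfl, rfl⟩ | ⟨d, h1, h2, h3⟩)
      · exact ⟨trivial, rfl⟩
      · rw [mem_extensions] at h3
        rcases h3 with ⟨h3, rfl⟩ | ⟨h3, h4, rfl⟩ | ⟨h3, h4, rfl⟩
        · exact ⟨⟨h1, by omega, h3⟩, Nat.add_sub_cancel' h2.le⟩
        · exact ⟨⟨h1, h3, by omega, h4⟩, Nat.add_sub_cancel' h2.le⟩
        · exact ⟨⟨h1, h3, by omega, h4⟩, Nat.add_sub_cancel' h2.le⟩
    · rintro ⟨h1, rfl⟩
      cases c with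
      | sq => exact Or.inl ⟨rfl, rfl⟩
      | row d k =>
        refine Or.inr ⟨d, h1.1, Nat.lt_add_of_pos_right h1.2.1, ?_⟩
        rw [mem_extensions, show (row d k).ar - d.ar = k from Nat.add_sub_cancel_left _ _]
        exact Or.inl ⟨h1.2.2, rfl⟩
      | col d k =>
        refine Or.inr ⟨d, h1.1, Nat.lt_add_of_pos_right h1.2.2.1, ?_⟩
        rw [mem_extensions, show (col d k).ar - d.ar = k from Nat.add_sub_cancel_left _ _]
        exact Or.inr (Or.inl ⟨h1.2.1, h1.2.2.2, rfl⟩)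
      | bot d k =>
        refine Or.inr ⟨d, h1.1, Nat.lt_add_of_pos_right h1.2.2.1, ?_⟩
        rw [mem_extensions, show (bot d k).ar - d.ar = k from Nat.add_sub_cancel_left _ _]
        exact Or.inr (Or.inr ⟨h1.2.1, h1.2.2.2, rfl⟩)

/-- A code determines its parent, and the area of the parent determines the index `i` under which
the code is listed. -/
theorem nodup_enum {t n : ℕ} (h : n ≤ t) : (enum t n).Nodup := by
  induction t generalizing n with
  | zero => exact List.nodup_nil
  | succ t ih =>
    rw [enum, List.nodup_append']
    refine ⟨by split_ifs <;> simp, List.nodup_flatMap.2 ⟨fun i hi => List.nodup_flatMap.2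
      ⟨fun c _ => nodup_extensions c _, ?_⟩, ?_⟩, ?_⟩
    · rw [List.mem_range] at hi
      refine (ih (show i ≤ t by omega)).imp fun {c d} hcd e hc hd => hcd ?_
      rw [← parent_of_mem_extensions hc, parent_of_mem_extensions hd]
    · refine (List.nodup_range (n := n)).imp_of_mem fun {i j} hi hj hij e hc hd => hij ?_
      rw [List.mem_range] at hi hj
      rw [List.mem_flatMap] at hc hd
      obtain ⟨c, hc, hec⟩ := hc
      obtain ⟨d, hd, hed⟩ := hd
      rw [← ((mem_enum (show i ≤ t by omega) c).1 hc).2,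
        ← ((mem_enum (show j ≤ t by omega) d).1 hd).2, ← parent_of_mem_extensions hec,
        parent_of_mem_extensions hed]
    · intro c hc hd
      obtain rfl : c = sq := by
        split_ifs at hc
        · exact List.mem_singleton.1 hc
        · cases hc
      simp only [List.mem_flatMap, mem_extensions] at hd
      obtain ⟨i, -, d, -, ⟨-, h⟩ | ⟨-, -, h⟩ | ⟨-, -, h⟩⟩ := hd <;> cases h

end Code

theorem ncard_codesOfArea (n : ℕ) : (codesOfArea n).ncard = (enum n n).length := by
  classical
  rw [show codesOfArea n = ((enum n n).toFinset : Set Code) from ?_, Set.ncard_coe_finset,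
    List.toFinset_card_of_nodup (nodup_enum le_rfl)]
  ext c
  rw [Finset.mem_coe, List.mem_toFinset, mem_enum le_rfl]
  rfl

theorem length_enum : (List.range 11).map (fun n => (enum n n).length) =
    [0, 1, 2, 5, 12, 29, 70, 167, 397, 935, 2191] := by
  decide +kernel

theorem coeff_genPA_range : (List.range 11).map (fun n => PowerSeries.coeff n genPA) =
    [0, 8, 16, 40, 96, 232, 560, 1336, 3176, 7480, 17528] := by
  have h := congrArg (List.map fun n : ℕ => 8 * (n : ℚ)) length_enum
  rw [List.map_map] at h
  simp only [coeff_genPA, ncard_codesOfArea]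
  refine h.trans ?_
  norm_num

end PrudentPolygon

/-- `substUV genX a b` is `X(q, a, b)`, and similarly for `Y` and `Z`. The finiteness of the number
of prudent polygons of each area makes all the coefficients genuine cardinalities and all the sums
in `evalOne` finite. -/
theorem proposition2p2 (q u v : MvPowerSeries (Fin 3) ℚ) (hq : q = MvPowerSeries.X 0)
    (hu : u = MvPowerSeries.X 1) (hv : v = MvPowerSeries.X 2) :
    (∀ n : ℕ, {w | IsPrudentPolygon w ∧ area (cells w) = n}.Finite) ∧
    genX = q * v * (1 - q)⁻¹ * (genX - substUV genX (q * u) v)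
      + q * v * (1 - q)⁻¹ * (substUV genY v u - substUV genY v (q * u))
      + q * u * v * (1 - q)⁻¹ * (genZ - q * substUV genZ (q * u) v) ∧
    genY = q * u * v
      + q * v * (1 - q)⁻¹ * (genY - substUV genY (q * u) v)
      + q * v ^ 2 * (1 - q)⁻¹ * (substUV genZ v u - substUV genZ v (q * u))
      + q * u * v * (substUV genX (q * v) u + substUV genY u (q * v)
        + q * v * substUV genZ (q * v) u) ∧
    genZ = q * v * (1 - q)⁻¹ * (genZ - substUV genZ (q * u) v)
      + q * v * substUV genY (q * v) u + q * u * v * substUV genZ u (q * v) ∧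
    genPA = 8 * (evalOne genX + evalOne genY + evalOne genZ) ∧
    (List.range 11).map (fun n => PowerSeries.coeff n genPA)
      = [0, 8, 16, 40, 96, 232, 560, 1336, 3176, 7480, 17528] := by
  subst hq hu hv
  exact ⟨fun n => (polygons_of_area n).1, genX_functional_equation, genY_functional_equation,
    genZ_functional_equation, genPA_eq, coeff_genPA_range⟩
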